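/- **Setting.** Let $\alpha\in\mathbb R$, $\sigma\ge 0$, $\delta>0$. For $\beta>0$ put $$I^{\sigma,\beta}_{0,t}u(t)=\frac1{\Gamma(\beta)}\int_0^t (t-s)^{\beta-1}e^{-\sigma(t-s)}u(s)\,ds,\qquad I^{\sigma,0}_{0,t}u=u,$$ and let $D^{\sigma,\alpha}_{0,t}u=\left(\tfrac{d}{dt}+\sigma\right)^m I^{\sigma,m-\alpha}_{0,t}u$, where $m$ is the positive integer with $m-1<\alpha\le m$ if $\alpha>0$, and $m=0$ if $\alpha\le 0$ (so that $D^{\sigma,\alpha}_{0,t}=I^{\sigma,-\alpha}_{0,t}$ for $\alpha\le 0$). Let $p\ge1$ be an integer and let $\omega^{(\alpha,0)}(z)$ be one of the following generating functions of order $p$ (near $z=0$): * (FBDF-$p$, $1\le p\le 6$) $\ \omega^{(\alpha,0)}(z)=\Big(\sum_{k=1}^p\frac1k(1-z)^k\Big)^{\alpha}$; * (GNGF-$p$) $\ \omega^{(\alpha,0)}(z)=(1-z)^\alpha\sum_{k=1}^p g_{k-1}(1-z)^{k-1}$, where $\sum_{k\ge0}g_kx^k=\big(-\ln(1-x)/x\big)^\alpha$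 (so $g_0=1$, $g_1=\alpha/2$); * (fractional trapezoidal rule, $p=2$, under the condition $\alpha\le0$ or $\delta\ge2\alpha+1$) $\ \omega^{(\alpha,0)}(z)=\Big(\frac{2(1-z)}{1+z}\Big)^{\alpha}$; * (linear multistep methods) $\ \omega^{(\alpha,0)}(z)=\omega(z)^{-\alpha}$ with $\omega(z)=\hat\sigma(1/z)/\hat\rho(1/z)$, where $\hat\rho,\hat\sigma$ are the real characteristic polynomials, of equal degree, of an implicit linear multistep method that is zero-stable (the zeros of $\hat\rho$ lie in the closed unit disc, those on the unit circle are simple) and consistent of order $p$ ($\hat\rho(e^h)-h\hat\sigma(e^h)=O(h^{p+1})$ as $h\to0$), and all zeros of $\hat\sigma$ have absolute value less than $1$. For $\tau>0$ let the weights $\omega_k^{(\alpha,\sigma)}$ be the Taylor coefficients at $0$ of $\omega^{(\alpha,\sigma)}(z)=\omega^{(\alpha,0)}(ze^{-\sigma\tau})$, and put $t_k=k\tau$. **Theorem.** For all $\tau>0$ one has $\omega^{(\alpha,\sigma)}(z)=\sum_{k\ge0}\omega^{(\alpha,\sigma)}_kz^k$ for $z$ near $0$ and $\omega_k^{(\alpha,\sigma)}=e^{-k\sigma\tau}\omega_k^{(\alpha,0)}$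 for all $k\ge 0$. For $u(t)=t^\delta$ the derivative $D^{\sigma,\alpha}_{0,t}u(t)$ exists at every $t>0$: the integral defining $I^{\sigma,m-\alpha}_{0,t}u$ converges and is $m$ times continuously differentiable there. Moreover $$\left[D^{\sigma,\alpha}_{0,t}u(t)\right]_{t=t_n}=\tau^{-\alpha}\sum_{k=0}^n\omega^{(\alpha,\sigma)}_{n-k}\,(u(t_k)-u(0))+O\!\left(t_n^{\delta-\alpha-p}\tau^p\right)+O\!\left(t_n^{-\alpha-1}\tau^{\delta+1}\right),$$ uniformly on bounded time intervals: for every $T>0$ there is a constant $C$, depending only on $\alpha,\sigma,\delta,p$, the chosen method and $T$, such that for all $\tau>0$ and all integers $n\ge1$ with $t_n\le T$ the error is at most $C\left(t_n^{\delta-\alpha-p}\tau^p+t_n^{-\alpha-1}\tau^{\delta+1}\right)$ in absolute value. -/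

import Mathlib

open Filter Topology Asymptotics Polynomial

noncomputable section

namespace TemperedFLMM

/-- The tempered fractional integral of order `β ≥ 0`,
`(1/Γ(β)) ∫₀ᵗ (t-s)^(β-1) e^(-σ(t-s)) u(s) ds`, with the usual convention that the integral of
order `0` is the identity. -/
def temperedIntegral (σ β : ℝ) (u : ℝ → ℝ) (t : ℝ) : ℝ :=
  if β = 0 then u t
  else (Real.Gamma β)⁻¹ *
    ∫ s in (0 : ℝ)..t, (t - s) ^ (β - 1) * Real.exp (-σ * (t - s)) * u s

/-- The tempered fractional derivative of order `α ∈ ℝ`: `(d/dt + σ)^m` applied to the tempered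
integral of order `m - α`, where `(d/dt + σ)^m = ∑ₖ C(m,k) σ^(m-k) (d/dt)^k`.
For `α > 0`, `m = ⌈α⌉₊` is the positive integer with `m - 1 < α ≤ m`.
For `α ≤ 0` one has `m = 0`, and this is the tempered integral of order `-α`. -/
def temperedDeriv (σ α : ℝ) (u : ℝ → ℝ) (t : ℝ) : ℝ :=
  ∑ k ∈ Finset.range (⌈α⌉₊ + 1),
    (Nat.choose ⌈α⌉₊ k : ℝ) * σ ^ (⌈α⌉₊ - k) *
      iteratedDeriv k (temperedIntegral σ (⌈α⌉₊ - α) u) t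

/-- The tempered derivative of order `α` of `u` exists at `t`: the defining integral converges near
`t` and is `⌈α⌉₊` times continuously differentiable at `t`. -/
def TemperedDerivExistsAt (σ α : ℝ) (u : ℝ → ℝ) (t : ℝ) : Prop :=
  ((⌈α⌉₊ : ℝ) - α ≠ 0 → ∀ᶠ x in 𝓝 t, IntervalIntegrable
    (fun s => (x - s) ^ ((⌈α⌉₊ : ℝ) - α - 1) * Real.exp (-σ * (x - s)) * u s)
    MeasureTheory.volume 0 x) ∧
  ContDiffAt ℝ ⌈α⌉₊ (temperedIntegral σ (⌈α⌉₊ - α) u) t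

/-- The `k`-th Taylor coefficient at `0`. -/
def taylorCoeff (f : ℝ → ℝ) (k : ℕ) : ℝ :=
  iteratedDeriv k f 0 / (Nat.factorial k : ℝ)

/-- The coefficients `g_k` of the generalized Newton-Gregory formulas:
`∑ g_k x^k = (-ln(1-x)/x)^α`, so that `g_0 = 1` and `g_1 = α/2`. -/
def newtonGregoryCoeff (α : ℝ) (k : ℕ) : ℝ :=
  taylorCoeff (fun x => if x = 0 then 1 else (-Real.log (1 - x) / x) ^ α) k

/-- The families of fractional linear multistep methods: the fractional backward difference
formula of order `p`, the generalized Newton-Gregory formula of order `p`, the fractional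
trapezoidal rule, and the methods built from the characteristic polynomials `ρ`, `s` of a linear
multistep method. -/
inductive Scheme : Type
  | fbdf (p : ℕ)
  | gngf (p : ℕ)
  | trapezoidal
  | lmm (ρ s : ℝ[X])

/-- The (untempered) generating function of a scheme for the derivative of order `α`, as a real
function near `z = 0`. In the last case `q.reverse` evaluated at `z ≠ 0` is `z ^ deg q * q (1/z)`,
so for `deg ρ = deg s` the function is `ω(z)^(-α)`, where `ω(z) = s(1/z)/ρ(1/z)` is the generating
function of the multistep method as an integration rule. -/
def Scheme.gen (α : ℝ) : Scheme → ℝ → ℝ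
  | .fbdf p, z => (∑ k ∈ Finset.Icc 1 p, (1 / (k : ℝ)) * (1 - z) ^ k) ^ α
  | .gngf p, z =>
      (1 - z) ^ α * ∑ k ∈ Finset.Icc 1 p, newtonGregoryCoeff α (k - 1) * (1 - z) ^ (k - 1)
  | .trapezoidal, z => (2 * (1 - z) / (1 + z)) ^ α
  | .lmm ρ s, z => (s.reverse.eval z / ρ.reverse.eval z) ^ (-α)

/-- A linear multistep method is (zero-)stable: all zeros of its first characteristic polynomial
lie in the closed unit disc, and those on the unit circle are simple. -/
def LMMStable (ρ : ℝ[X]) : Prop :=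
  ∀ z : ℂ, aeval z ρ = 0 → ‖z‖ ≤ 1 ∧ (‖z‖ = 1 → aeval z (derivative ρ) ≠ 0)

/-- A linear multistep method is consistent of order `p`: `ρ(e^h) - h s(e^h) = O(h^(p+1))`. -/
def LMMConsistent (ρ s : ℝ[X]) (p : ℕ) : Prop :=
  (fun h : ℝ => ρ.eval (Real.exp h) - h * s.eval (Real.exp h)) =O[𝓝 0] fun h : ℝ => h ^ (p + 1)

/-- The scheme is a stable method of order `p`, to be used for the derivative of order `α` of
`t^δ`. A multistep method with `deg s = deg ρ` is implicit. -/
def Scheme.Admissible (p : ℕ) (α δ : ℝ) : Scheme → Prop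
  | .fbdf q => q = p ∧ 1 ≤ p ∧ p ≤ 6
  | .gngf q => q = p ∧ 1 ≤ p
  | .trapezoidal => p = 2 ∧ (α ≤ 0 ∨ 2 * α + 1 ≤ δ)
  | .lmm ρ s => 1 ≤ p ∧ s.natDegree = ρ.natDegree ∧ LMMStable ρ ∧ LMMConsistent ρ s p ∧
      ∀ z : ℂ, aeval z s = 0 → ‖z‖ < 1

/-- The convolution quadrature weights `ω_k^(α,σ)` for step size `τ`: the Taylor coefficients of
the tempered generating function `z ↦ ω(z e^(-στ))`. -/
def Scheme.weight (S : Scheme) (α σ τ : ℝ) (k : ℕ) : ℝ :=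
  taylorCoeff (fun z => S.gen α (z * Real.exp (-σ * τ))) k

/-- The fractional linear multistep approximation at `t_n = nτ`, without correction terms. -/
def Scheme.flmm (S : Scheme) (α σ τ : ℝ) (n : ℕ) (u : ℝ → ℝ) : ℝ :=
  τ ^ (-α) * ∑ k ∈ Finset.range (n + 1), S.weight α σ τ (n - k) * (u (k * τ) - u 0)

end TemperedFLMM

end

noncomputable section

namespace TemperedFLMM

open MeasureTheory
open scoped PowerSeries

/-! ### Power series with polynomially bounded coefficients -/

/-! Conjugation by `e^(σt)` removes the tempering. The operator satisfies `D^(σ,α) u = e^(-σt) D^α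
(e^(σt) u)`, and the factors `e^(-kστ)` in the weights do the same on the discrete side. With
`e^(σt) t^δ = ∑ σ^j t^(δ+j) / j!`, the error becomes a series in `j` of untempered errors `quadErr`
for the powers `t^(δ+j)` with unit step (`IsQuad.hasSum_error`). It remains to bound `quadErr`
summably in `j`.

For a single power `t^β` put `s = β + 1`. Up to the factor `-Γ(s)`, the error at `n` is the `n`-th
coefficient of `ω(x) ∑ n^(s-1)/Γ(s) x^n - ∑ n^(s-α-1)/Γ(s-α) x^n`. At `x = 1` the two power-function
series behave like `(-log x)^(-s)` and `(-log x)^(α-s)`, and consistency says that the part of `ω`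
singular at `1` agrees with `(-log x)^α` up to a relative error `O((1-x)^p)`. Expanding everything
in powers of `1 - x`, whose coefficients have known size, gives three contributions: `n^(β-α-p)`
from the mismatch of order `p`, `n^(-α-1)` from the singularity of `ω` at `1` times the remainder of
the power-function series, and `n^(-κ-1)` from the other singularities of `ω` on the unit circle.
The argument uses power series with polynomially decaying coefficients instead of contour integrals;
it is carried by `decay_powRem`, `IsQuad.exists_smooth` and `IsQuad.mul_powSeries`.

The constants so obtained depend on `β` without control. For large `β`, `t^β` is a superposition of
truncated powers `(t-y)_+^q` with one fixed `q`, and a Peano kernel argument bounds the error by `C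
β^q n^(β-α-p)` (`IsQuad.quadErr_le_uniform`); the factor `1/j!` absorbs `β^q`.

What a scheme must provide is collected in `IsQuad`. Apart from the Newton-Gregory formulas, every
generating function is a power of a quotient of reversed polynomials. Factoring over the complex
roots, roots inside the disc contribute rapidly decaying series, roots on the circle are simple, and
a Bézout identity separates the singularity at `1` from the others (`exists_decomp_prod`,
`isQuad_of_lmm`). For the backward difference formulas stability is checked by the Schur-Cohn
recursion. One may take `κ = α` except for the trapezoidal rule with `α > 0`, where `(1+x)^(-α)`
forces `κ = -α`, and `δ ≥ 2α+1` makes the extra term harmless. -/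

/-- The coefficients of `f` are `O((n+1)^(-a))`. -/
def Decay {𝕂 : Type*} [RCLike 𝕂] (f : 𝕂⟦X⟧) (a : ℝ) : Prop :=
  ∃ C : ℝ, 0 ≤ C ∧ ∀ n : ℕ, ‖PowerSeries.coeff n f‖ ≤ C * ((n : ℝ) + 1) ^ (-a)

/-- The formal power series `(1 - ζ X)^a`. -/
def bin {𝕂 : Type*} [RCLike 𝕂] (ζ : 𝕂) (a : ℝ) : 𝕂⟦X⟧ :=
  PowerSeries.rescale (-ζ) (PowerSeries.binomialSeries 𝕂 a)

section Decay

variable {𝕂 : Type*} [RCLike 𝕂]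

theorem Decay.of_le {f : 𝕂⟦X⟧} {a C : ℝ}
    (h : ∀ n : ℕ, ‖PowerSeries.coeff n f‖ ≤ C * ((n : ℝ) + 1) ^ (-a)) : Decay f a := by
  refine ⟨C, ?_, h⟩
  have := (norm_nonneg _).trans (h 0)
  simpa using this

theorem Decay.of_eventually {f : 𝕂⟦X⟧} {a C : ℝ}
    (h : ∀ᶠ n : ℕ in atTop, ‖PowerSeries.coeff n f‖ ≤ C * ((n : ℝ) + 1) ^ (-a)) : Decay f a := by
  obtain ⟨N, hN⟩ := eventually_atTop.1 h
  refine Decay.of_le (C := max C 0 + ∑ n ∈ Finset.range N,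
    ‖PowerSeries.coeff n f‖ * ((n : ℝ) + 1) ^ a) fun n => ?_
  have hpos : 0 < ((n : ℝ) + 1) ^ (-a) := by positivity
  have hs : 0 ≤ ∑ n ∈ Finset.range N, ‖PowerSeries.coeff n f‖ * ((n : ℝ) + 1) ^ a :=
    Finset.sum_nonneg fun i _ => by positivity
  rcases le_or_gt N n with hn | hn
  · refine (hN n hn).trans ?_
    gcongr
    linarith [le_max_left C 0]
  · have h1 : ‖PowerSeries.coeff n f‖ * ((n : ℝ) + 1) ^ a ≤
        ∑ n ∈ Finset.range N, ‖PowerSeries.coeff n f‖ * ((n : ℝ) + 1) ^ a :=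
      Finset.single_le_sum (f := fun n : ℕ => ‖PowerSeries.coeff n f‖ * ((n : ℝ) + 1) ^ a)
        (fun i _ => by positivity) (Finset.mem_range.2 hn)
    calc ‖PowerSeries.coeff n f‖
        = ‖PowerSeries.coeff n f‖ * ((n : ℝ) + 1) ^ a * ((n : ℝ) + 1) ^ (-a) := by
          rw [mul_assoc, ← Real.rpow_add (by positivity)]; simp
      _ ≤ _ := by
        gcongr
        linarith [le_max_right C 0]

theorem Decay.mono {f : 𝕂⟦X⟧} {a b : ℝ} (h : Decay f a) (hab : b ≤ a) : Decay f b := by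
  obtain ⟨C, hC, h⟩ := h
  refine ⟨C, hC, fun n => (h n).trans ?_⟩
  gcongr
  linarith [(Nat.cast_nonneg n : (0 : ℝ) ≤ n)]

theorem Decay.add {f g : 𝕂⟦X⟧} {a : ℝ} (hf : Decay f a) (hg : Decay g a) : Decay (f + g) a := by
  obtain ⟨C, hC, hf⟩ := hf
  obtain ⟨D, hD, hg⟩ := hg
  refine ⟨C + D, by positivity, fun n => ?_⟩
  rw [map_add, add_mul]
  exact (norm_add_le _ _).trans (add_le_add (hf n) (hg n))

theorem Decay.neg {f : 𝕂⟦X⟧} {a : ℝ} (hf : Decay f a) : Decay (-f) a := by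
  obtain ⟨C, hC, hf⟩ := hf
  exact ⟨C, hC, fun n => by simpa using hf n⟩

theorem Decay.sub {f g : 𝕂⟦X⟧} {a : ℝ} (hf : Decay f a) (hg : Decay g a) : Decay (f - g) a := by
  rw [sub_eq_add_neg]
  exact hf.add hg.neg

theorem decay_zero (a : ℝ) : Decay (0 : 𝕂⟦X⟧) a := ⟨0, le_rfl, fun n => by simp⟩

theorem decay_sum {ι : Type*} (s : Finset ι) {f : ι → 𝕂⟦X⟧} {a : ℝ}
    (h : ∀ i ∈ s, Decay (f i) a) : Decay (∑ i ∈ s, f i) a := by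
  classical
  induction s using Finset.induction_on with
  | empty => simpa using decay_zero a
  | insert i s hi ih =>
    rw [Finset.sum_insert hi]
    exact (h i (by simp)).add (ih fun j hj => h j (by simp [hj]))

theorem decay_coe (q : 𝕂[X]) (a : ℝ) : Decay (q : 𝕂⟦X⟧) a := by
  refine Decay.of_eventually (C := 0) ?_
  filter_upwards [eventually_gt_atTop q.natDegree] with n hn
  simp [Polynomial.coeff_eq_zero_of_natDegree_lt hn]

theorem decay_C (c : 𝕂) (a : ℝ) : Decay (PowerSeries.C c) a := by
  simpa using decay_coe (Polynomial.C c) a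

/-- A Peetre type inequality. -/
theorem rpow_peetre (a : ℝ) (k l : ℕ) :
    ((k : ℝ) + 1) ^ (-a) ≤ (((k + l : ℕ) : ℝ) + 1) ^ (-a) * ((l : ℝ) + 1) ^ |a| := by
  have hk : (0 : ℝ) < (k : ℝ) + 1 := by positivity
  have hl : (1 : ℝ) ≤ (l : ℝ) + 1 := by linarith [(Nat.cast_nonneg l : (0 : ℝ) ≤ l)]
  have hkl : (0 : ℝ) < ((k + l : ℕ) : ℝ) + 1 := by positivity
  rcases le_total 0 a with h | h
  · have h1 : (((k + l : ℕ) : ℝ) + 1) ≤ ((k : ℝ) + 1) * ((l : ℝ) + 1) := by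
      push_cast
      nlinarith [(Nat.cast_nonneg l : (0 : ℝ) ≤ l), (Nat.cast_nonneg k : (0 : ℝ) ≤ k)]
    have h2 := Real.rpow_le_rpow hkl.le h1 h
    rw [Real.mul_rpow hk.le (by positivity)] at h2
    rw [abs_of_nonneg h, Real.rpow_neg hk.le, Real.rpow_neg hkl.le]
    have e1 : (0 : ℝ) < ((k : ℝ) + 1) ^ a := by positivity
    have e2 : (0 : ℝ) < (((k + l : ℕ) : ℝ) + 1) ^ a := by positivity
    rw [inv_mul_eq_div, le_div_iff₀ e2, inv_mul_le_iff₀ e1]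
    exact h2
  · have h1 : ((k : ℝ) + 1) ^ (-a) ≤ (((k + l : ℕ) : ℝ) + 1) ^ (-a) := by
      apply Real.rpow_le_rpow hk.le _ (by linarith)
      push_cast
      linarith [(Nat.cast_nonneg l : (0 : ℝ) ≤ l)]
    have h2 : (1 : ℝ) ≤ ((l : ℝ) + 1) ^ |a| := Real.one_le_rpow hl (abs_nonneg a)
    have e2 : (0 : ℝ) < (((k + l : ℕ) : ℝ) + 1) ^ (-a) := by positivity
    nlinarith

/-- The Peetre inequality moves the weight from the index of `f` to `n`, at the price of `(l+1)^|a|`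
on the index of `g`; the two extra orders in `b` leave the summable `(l+1)^(-2)`. -/
theorem Decay.mul {f g : 𝕂⟦X⟧} {a b : ℝ} (hf : Decay f a) (hg : Decay g b) (hb : |a| + 2 ≤ b) :
    Decay (f * g) a := by
  obtain ⟨C, hC, hf⟩ := hf
  obtain ⟨D, hD, hg⟩ := hg
  have hsum : Summable fun l : ℕ => ((l : ℝ) + 1) ^ (-2 : ℝ) := by
    have := (Real.summable_one_div_nat_add_rpow 1 2).2 one_lt_two
    refine this.congr fun l => ?_
    rw [abs_of_nonneg (by positivity), Real.rpow_neg (by positivity), one_div]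
  refine Decay.of_le (C := C * D * ∑' l : ℕ, ((l : ℝ) + 1) ^ (-2 : ℝ)) fun n => ?_
  rw [PowerSeries.coeff_mul]
  calc ‖∑ kl ∈ Finset.HasAntidiagonal.antidiagonal n, PowerSeries.coeff kl.1 f * PowerSeries.coeff kl.2 g‖
      ≤ ∑ kl ∈ Finset.HasAntidiagonal.antidiagonal n, C * D * ((n : ℝ) + 1) ^ (-a) *
          ((kl.2 : ℝ) + 1) ^ (-2 : ℝ) := by
        refine norm_sum_le_of_le _ fun kl hkl => ?_
        rw [norm_mul]
        have hkl' : kl.1 + kl.2 = n := Finset.HasAntidiagonal.mem_antidiagonal.1 hkl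
        have h1 := rpow_peetre a kl.1 kl.2
        rw [hkl'] at h1
        have h2 : ((kl.2 : ℝ) + 1) ^ |a| * ((kl.2 : ℝ) + 1) ^ (-b) ≤
            ((kl.2 : ℝ) + 1) ^ (-2 : ℝ) := by
          rw [← Real.rpow_add (by positivity)]
          apply Real.rpow_le_rpow_of_exponent_le
          · linarith [(Nat.cast_nonneg kl.2 : (0 : ℝ) ≤ kl.2)]
          · linarith
        calc ‖PowerSeries.coeff kl.1 f‖ * ‖PowerSeries.coeff kl.2 g‖
            ≤ (C * ((n : ℝ) + 1) ^ (-a) * ((kl.2 : ℝ) + 1) ^ |a|) *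
                (D * ((kl.2 : ℝ) + 1) ^ (-b)) := by
              refine mul_le_mul ((hf _).trans ?_) (hg _) (norm_nonneg _) (by positivity)
              rw [mul_assoc]
              gcongr
          _ = C * D * ((n : ℝ) + 1) ^ (-a) *
              (((kl.2 : ℝ) + 1) ^ |a| * ((kl.2 : ℝ) + 1) ^ (-b)) := by ring
          _ ≤ _ := by gcongr
    _ = C * D * ((n : ℝ) + 1) ^ (-a) * ∑ l ∈ Finset.range (n + 1), ((l : ℝ) + 1) ^ (-2 : ℝ) := by
        rw [Finset.mul_sum, ← Finset.Nat.sum_antidiagonal_swap]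
        simp only [Prod.snd_swap]
        rw [Finset.Nat.sum_antidiagonal_eq_sum_range_succ
          (fun i _ => C * D * ((n : ℝ) + 1) ^ (-a) * ((i : ℝ) + 1) ^ (-2 : ℝ))]
    _ ≤ C * D * ((n : ℝ) + 1) ^ (-a) * ∑' l : ℕ, ((l : ℝ) + 1) ^ (-2 : ℝ) := by
        gcongr
        exact hsum.sum_le_tsum _ fun i _ => by positivity
    _ = _ := by ring

theorem Decay.const_mul {f : 𝕂⟦X⟧} {a : ℝ} (c : 𝕂) (hf : Decay f a) :
    Decay (PowerSeries.C c * f) a := by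
  rw [mul_comm]
  exact hf.mul (decay_C c _) le_rfl

/-- Power series whose coefficients decay faster than every power. -/
def Rapid (f : 𝕂⟦X⟧) : Prop := ∀ a : ℝ, Decay f a

theorem Rapid.mul {f g : 𝕂⟦X⟧} (hf : Rapid f) (hg : Rapid g) : Rapid (f * g) :=
  fun a => (hf a).mul (hg (|a| + 2)) le_rfl

theorem rapid_coe (q : 𝕂[X]) : Rapid (q : 𝕂⟦X⟧) := decay_coe q

theorem rapid_C (c : 𝕂) : Rapid (PowerSeries.C c) := decay_C c

theorem Rapid.multiset_prod {ι : Type*} (s : Multiset ι) {f : ι → 𝕂⟦X⟧}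
    (h : ∀ i ∈ s, Rapid (f i)) : Rapid (s.map f).prod := by
  induction s using Multiset.induction_on with
  | empty => simpa using rapid_coe (1 : 𝕂[X])
  | cons i s ih =>
    rw [Multiset.map_cons, Multiset.prod_cons]
    exact (h i (by simp)).mul (ih fun j hj => h j (by simp [hj]))

/-- Each new factor needs two orders more than the running product in order not to spoil it, by
`Decay.mul`; so `a + 2` suffices for any number of factors. -/
theorem decay_finset_prod {ι : Type*} (s : Finset ι) {f : ι → 𝕂⟦X⟧} {a : ℝ} (ha : 0 ≤ a)
    (h : ∀ i ∈ s, Decay (f i) (a + 2)) : Decay (∏ i ∈ s, f i) a := by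
  classical
  induction s using Finset.induction_on with
  | empty => simpa using decay_coe (1 : 𝕂[X]) a
  | insert i s hi ih =>
    rw [Finset.prod_insert hi, mul_comm]
    exact (ih fun j hj => h j (by simp [hj])).mul (h i (by simp)) (by rw [abs_of_nonneg ha])

end Decay

/-! ### The binomial series -/

theorem choose_eq_prod_div (a : ℝ) (n : ℕ) :
    Ring.choose a n = (∏ j ∈ Finset.range n, (a - j)) / (n.factorial : ℝ) := by
  have h : ∀ n : ℕ, (descPochhammer ℤ n).smeval a = ∏ j ∈ Finset.range n, (a - j) := by
    intro n
    induction n with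
    | zero => simp
    | succ n ih =>
      rw [descPochhammer_succ_right, Polynomial.smeval_mul, ih, Finset.prod_range_succ,
        Polynomial.smeval_sub, Polynomial.smeval_X, Polynomial.smeval_natCast]
      simp
  rw [Ring.choose_eq_smul, h, smul_eq_mul, inv_mul_eq_div]

theorem choose_natCast_eq_zero {k n : ℕ} (h : k < n) : Ring.choose (k : ℝ) n = 0 := by
  rw [Ring.choose_natCast, Nat.choose_eq_zero_of_lt h, Nat.cast_zero]

/-- Unless `a` is a natural number, when the coefficients eventually vanish, `|choose a n|` is
`n^(-a) / (n - a)` divided by the Euler product `GammaSeq (-a) n`, which tends to `Γ(-a) ≠ 0`. -/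
theorem choose_norm_bound (a : ℝ) :
    ∃ C : ℝ, ∀ᶠ n : ℕ in atTop, |Ring.choose a n| ≤ C * ((n : ℝ) + 1) ^ (-(a + 1)) := by
  by_cases ha : ∃ k : ℕ, a = k
  · obtain ⟨k, rfl⟩ := ha
    refine ⟨0, ?_⟩
    filter_upwards [eventually_gt_atTop k] with n hn
    simp [choose_natCast_eq_zero hn]
  · push Not at ha
    have hG : Real.Gamma (-a) ≠ 0 := Real.Gamma_ne_zero fun m h => ha m (by linarith)
    have hlim := (Real.GammaSeq_tendsto_Gamma (-a)).abs
    have hev := hlim.eventually_const_lt (half_lt_self (abs_pos.2 hG))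
    refine ⟨2 * 2 ^ |a| * (|Real.Gamma (-a)| / 2)⁻¹, ?_⟩
    -- `n ≥ 1 + 2a` is exactly `n + 1 ≤ 2(n - a)`, and `n ≥ 1` allows `n` to be replaced by `n + 1`
    -- at the cost of `2^|a|`.
    filter_upwards [hev, eventually_ge_atTop 1,
      eventually_ge_atTop ⌈1 + 2 * a⌉₊] with n hn h1 h2
    have hn1 : (1 : ℝ) ≤ n := by exact_mod_cast h1
    have hn2 : 1 + 2 * a ≤ n := (Nat.le_ceil _).trans (by exact_mod_cast h2)
    have hp : ∀ m : ℕ, ∏ j ∈ Finset.range m, (-a + (j : ℝ)) ≠ 0 := fun m =>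
      Finset.prod_ne_zero_iff.2 fun j _ h => ha j (by linarith)
    have hprod : |∏ j ∈ Finset.range n, (a - j)| = |∏ j ∈ Finset.range n, (-a + (j : ℝ))| := by
      rw [Finset.abs_prod, Finset.abs_prod]
      refine Finset.prod_congr rfl fun j _ => ?_
      rw [← abs_neg]; ring_nf
    have hfac : (0 : ℝ) < n.factorial := by exact_mod_cast n.factorial_pos
    have hna : 0 < -a + n := by linarith
    have key : |Ring.choose a n| = (n : ℝ) ^ (-a) / (-a + n) * |Real.GammaSeq (-a) n|⁻¹ := by
      rw [choose_eq_prod_div, abs_div, hprod, Real.GammaSeq, Finset.prod_range_succ, abs_div,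
        abs_mul, abs_mul, abs_of_pos hfac, abs_of_pos hna,
        abs_of_pos (show (0 : ℝ) < (n : ℝ) ^ (-a) by positivity)]
      have h0 := abs_pos.2 (hp n)
      have h3 : (0 : ℝ) < (n : ℝ) ^ (-a) := by positivity
      field_simp
    rw [key]
    have e1 : (n : ℝ) ^ (-a) ≤ 2 ^ |a| * ((n : ℝ) + 1) ^ (-a) := by
      rcases le_total 0 a with h | h
      · have : ((n : ℝ) + 1) ^ a ≤ (2 * n) ^ a := by
          gcongr; linarith
        rw [Real.mul_rpow (by norm_num) (by positivity)] at this
        rw [abs_of_nonneg h, Real.rpow_neg (by positivity), Real.rpow_neg (by positivity),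
          ← div_eq_mul_inv, le_div_iff₀ (by positivity), inv_mul_le_iff₀ (by positivity)]
        linarith
      · have h4 : (n : ℝ) ^ (-a) ≤ ((n : ℝ) + 1) ^ (-a) := by
          apply Real.rpow_le_rpow (by positivity) (by linarith) (by linarith)
        have h5 : (1 : ℝ) ≤ 2 ^ |a| := Real.one_le_rpow (by norm_num) (abs_nonneg a)
        have h6 : (0 : ℝ) < ((n : ℝ) + 1) ^ (-a) := by positivity
        nlinarith
    have e2 : (-a + n)⁻¹ ≤ 2 * ((n : ℝ) + 1)⁻¹ := by
      rw [← div_eq_mul_inv, inv_eq_one_div, div_le_div_iff₀ hna (by positivity)]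
      linarith
    have e3 : |Real.GammaSeq (-a) n|⁻¹ ≤ (|Real.Gamma (-a)| / 2)⁻¹ := by
      have := abs_pos.2 hG
      gcongr
    have e4 : ((n : ℝ) + 1) ^ (-(a + 1)) = ((n : ℝ) + 1) ^ (-a) * ((n : ℝ) + 1)⁻¹ := by
      rw [neg_add, Real.rpow_add (by positivity), Real.rpow_neg_one]
    rw [e4]
    calc (n : ℝ) ^ (-a) / (-a + n) * |Real.GammaSeq (-a) n|⁻¹
        ≤ (2 ^ |a| * ((n : ℝ) + 1) ^ (-a)) * (2 * ((n : ℝ) + 1)⁻¹) *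
          (|Real.Gamma (-a)| / 2)⁻¹ := by
          rw [div_eq_mul_inv]
          gcongr
      _ = _ := by ring

section Bin

variable {𝕂 : Type*} [RCLike 𝕂]

theorem coeff_bin (ζ : 𝕂) (a : ℝ) (n : ℕ) :
    PowerSeries.coeff n (bin ζ a) = (-ζ) ^ n * ((Ring.choose a n : ℝ) : 𝕂) := by
  rw [bin, PowerSeries.coeff_rescale, PowerSeries.binomialSeries_coeff, RCLike.real_smul_eq_coe_mul,
    mul_one]

theorem bin_add (ζ : 𝕂) (a b : ℝ) : bin ζ (a + b) = bin ζ a * bin ζ b := by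
  rw [bin, PowerSeries.binomialSeries_add, map_mul]; rfl

theorem bin_natCast (ζ : 𝕂) (k : ℕ) :
    bin ζ (k : ℝ) = (1 - PowerSeries.C ζ * PowerSeries.X) ^ k := by
  rw [bin, PowerSeries.binomialSeries_nat, map_pow, map_add, map_one, PowerSeries.rescale_X,
    map_neg, neg_mul, sub_eq_add_neg]

theorem bin_one_natCast (k : ℕ) : bin (1 : 𝕂) (k : ℝ) = (1 - PowerSeries.X) ^ k := by
  rw [bin_natCast, map_one, one_mul]

theorem decay_bin {ζ : 𝕂} (hζ : ‖ζ‖ ≤ 1) (a : ℝ) : Decay (bin ζ a) (a + 1) := by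
  obtain ⟨C, hC⟩ := choose_norm_bound a
  refine Decay.of_eventually (C := C) ?_
  filter_upwards [hC] with n hn
  rw [coeff_bin, norm_mul, norm_pow, norm_neg, RCLike.norm_ofReal]
  refine le_trans ?_ hn
  exact mul_le_of_le_one_left (abs_nonneg _) (pow_le_one₀ (norm_nonneg _) hζ)

/-- The geometric factor `‖ζ‖^n` beats every power of `n`: singularities outside the closed unit
disc are invisible at polynomial accuracy. -/
theorem rapid_bin {ζ : 𝕂} (hζ : ‖ζ‖ < 1) (a : ℝ) : Rapid (bin ζ a) := by
  intro b
  obtain ⟨C, hC⟩ := choose_norm_bound a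
  obtain ⟨k, hk⟩ := exists_nat_ge (b - (a + 1))
  have hz : Tendsto (fun n : ℕ => ((n : ℝ) + 1) ^ k * ‖ζ‖ ^ n) atTop (𝓝 0) := by
    rcases eq_or_lt_of_le (norm_nonneg ζ) with h0 | h0
    · refine tendsto_const_nhds.congr' ?_
      filter_upwards [eventually_gt_atTop 0] with n hn
      rw [← h0, zero_pow hn.ne', mul_zero]
    · have h1 := (tendsto_pow_const_mul_const_pow_of_lt_one k (norm_nonneg ζ) hζ).comp
        (tendsto_add_atTop_nat 1)
      have h2 := h1.const_mul (‖ζ‖⁻¹)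
      rw [mul_zero] at h2
      refine h2.congr fun n => ?_
      simp only [Function.comp, Nat.cast_add, Nat.cast_one, pow_succ]
      field_simp
  refine Decay.of_eventually (C := |C|) ?_
  filter_upwards [hC, hz.eventually_le_const one_pos] with n hn h1
  have hn1 : (1 : ℝ) ≤ (n : ℝ) + 1 := by linarith [(Nat.cast_nonneg n : (0 : ℝ) ≤ n)]
  rw [coeff_bin, norm_mul, norm_pow, norm_neg, RCLike.norm_ofReal]
  calc ‖ζ‖ ^ n * |Ring.choose a n| ≤ ‖ζ‖ ^ n * (|C| * ((n : ℝ) + 1) ^ (-(a + 1))) := by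
        gcongr
        refine hn.trans ?_
        gcongr
        exact le_abs_self C
    _ ≤ ‖ζ‖ ^ n * (|C| * (((n : ℝ) + 1) ^ (-b) * ((n : ℝ) + 1) ^ k)) := by
        gcongr
        rw [← Real.rpow_natCast, ← Real.rpow_add (by positivity)]
        exact Real.rpow_le_rpow_of_exponent_le hn1 (by linarith)
    _ = (((n : ℝ) + 1) ^ k * ‖ζ‖ ^ n) * (|C| * ((n : ℝ) + 1) ^ (-b)) := by ring
    _ ≤ 1 * (|C| * ((n : ℝ) + 1) ^ (-b)) := by gcongr
    _ = _ := one_mul _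

theorem hasSum_coeff_mul {f g : 𝕂⟦X⟧} {x a b : 𝕂}
    (hf : HasSum (fun n => PowerSeries.coeff n f * x ^ n) a)
    (hg : HasSum (fun n => PowerSeries.coeff n g * x ^ n) b) :
    HasSum (fun n => PowerSeries.coeff n (f * g) * x ^ n) (a * b) := by
  have hf' := hf.summable.norm
  have hg' := hg.summable.norm
  have h1 := tsum_mul_tsum_eq_tsum_sum_antidiagonal_of_summable_norm hf' hg'
  have h2 := (summable_norm_sum_mul_antidiagonal_of_summable_norm hf' hg').of_norm.hasSum
  rw [← h1, hf.tsum_eq, hg.tsum_eq] at h2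
  refine Eq.subst (motive := fun F => HasSum F (a * b)) (funext fun n => Eq.symm ?_) h2
  rw [PowerSeries.coeff_mul, Finset.sum_mul]
  refine Finset.sum_congr rfl fun kl hkl => ?_
  rw [← Finset.HasAntidiagonal.mem_antidiagonal.1 hkl, pow_add]
  ring

theorem hasSum_coe (q : 𝕂[X]) (x : 𝕂) :
    HasSum (fun n => PowerSeries.coeff n (q : 𝕂⟦X⟧) * x ^ n) (q.eval x) := by
  rw [Polynomial.eval_eq_sum_range]
  simp only [Polynomial.coeff_coe]
  refine hasSum_sum_of_ne_finset_zero fun n hn => ?_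
  rw [Polynomial.coeff_eq_zero_of_natDegree_lt (by simpa using hn), zero_mul]

end Bin

theorem hasSum_bin_complex {ζ : ℂ} (hζ : ‖ζ‖ ≤ 1) (a : ℝ) {x : ℂ} (hx : ‖x‖ < 1) :
    HasSum (fun n => PowerSeries.coeff n (bin ζ a) * x ^ n) ((1 - ζ * x) ^ (a : ℂ)) := by
  have h := (Complex.one_add_cpow_hasFPowerSeriesOnBall_zero (a := (a : ℂ))).hasSum
    (y := -ζ * x) (by
      simp only [Metric.mem_eball, edist_zero_right, enorm_eq_nnnorm]
      norm_cast
      rw [← NNReal.coe_lt_coe]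
      simpa using (mul_le_of_le_one_left (norm_nonneg x) hζ).trans_lt hx)
  rw [zero_add, neg_mul, ← sub_eq_add_neg] at h
  refine Eq.subst (motive := fun F => HasSum F _) (funext fun n => Eq.symm ?_) h
  rw [coeff_bin, binomialSeries_apply, List.ofFn_const, List.prod_replicate, smul_eq_mul,
    ← neg_mul, mul_pow, ← Complex.ofReal_choose]
  simp only [Complex.coe_algebraMap]
  ring

theorem hasSum_bin_real (a : ℝ) {x : ℝ} (hx : |x| < 1) :
    HasSum (fun n => PowerSeries.coeff n (bin (1 : ℝ) a) * x ^ n) ((1 - x) ^ a) := by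
  have h := (Real.one_add_rpow_hasFPowerSeriesOnBall_zero (a := a)).hasSum
    (y := - x) (by
      simp only [Metric.mem_eball, edist_zero_right, enorm_eq_nnnorm]
      norm_cast
      rw [← NNReal.coe_lt_coe]
      simpa using hx)
  rw [zero_add, ← sub_eq_add_neg] at h
  refine Eq.subst (motive := fun F => HasSum F _) (funext fun n => Eq.symm ?_) h
  rw [coeff_bin, binomialSeries_apply, List.ofFn_const, List.prod_replicate, smul_eq_mul,
    neg_pow x, neg_pow (1 : ℝ)]
  simp only [one_pow, RCLike.ofReal_real_eq_id, id]
  ring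

theorem HasSum.of_forall_eq {M : Type*} [AddCommMonoid M] [TopologicalSpace M] {f g : ℕ → M} {a : M}
    (h : HasSum g a) (e : ∀ n, f n = g n) : HasSum f a := by
  rwa [funext e]

/-! ### Taylor coefficients -/

theorem hasFPowerSeriesAt_of_hasSum {f : ℝ → ℝ} {a : ℕ → ℝ}
    (h : ∀ᶠ z in 𝓝 (0 : ℝ), HasSum (fun k : ℕ => a k * z ^ k) (f z)) :
    HasFPowerSeriesAt f (FormalMultilinearSeries.ofScalars ℝ a) 0 := by
  rw [hasFPowerSeriesAt_iff]
  filter_upwards [h] with z hz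
  simpa [FormalMultilinearSeries.coeff_ofScalars, mul_comm] using hz

theorem analyticAt_of_hasSum {f : ℝ → ℝ} {a : ℕ → ℝ}
    (h : ∀ᶠ z in 𝓝 (0 : ℝ), HasSum (fun k : ℕ => a k * z ^ k) (f z)) : AnalyticAt ℝ f 0 :=
  ⟨_, hasFPowerSeriesAt_of_hasSum h⟩

theorem taylorCoeff_eq_of_hasSum {f : ℝ → ℝ} {a : ℕ → ℝ}
    (h : ∀ᶠ z in 𝓝 (0 : ℝ), HasSum (fun k : ℕ => a k * z ^ k) (f z)) : taylorCoeff f = a := by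
  have h1 := hasFPowerSeriesAt_of_hasSum h
  have h2 := h1.analyticAt.hasFPowerSeriesAt.eq_formalMultilinearSeries h1
  funext k
  have := congrArg (fun p => FormalMultilinearSeries.coeff p k) h2
  simp only [FormalMultilinearSeries.coeff_ofScalars] at this
  exact this

theorem hasSum_taylorCoeff {f : ℝ → ℝ} (hf : AnalyticAt ℝ f 0) :
    ∀ᶠ z in 𝓝 (0 : ℝ), HasSum (fun k : ℕ => taylorCoeff f k * z ^ k) (f z) := by
  have := hasFPowerSeriesAt_iff.1 hf.hasFPowerSeriesAt
  filter_upwards [this] with z hz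
  simpa [FormalMultilinearSeries.coeff_ofScalars, mul_comm, taylorCoeff] using hz

theorem taylor_isBigO {f : ℝ → ℝ} (hf : AnalyticAt ℝ f 0) (N : ℕ) :
    (fun y => f y - ∑ l ∈ Finset.range N, taylorCoeff f l * y ^ l) =O[𝓝 0] fun y => y ^ N := by
  have h := hf.hasFPowerSeriesAt.isBigO_sub_partialSum_pow N
  refine (IsBigO.congr' h (Eventually.of_forall fun y => ?_) (Eventually.of_forall fun y => rfl)).trans
    (IsBigO.of_bound 1 (Eventually.of_forall fun y => by simp))
  simp [FormalMultilinearSeries.partialSum, taylorCoeff, mul_comm]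

theorem taylorCoeff_deriv (f : ℝ → ℝ) (k : ℕ) :
    taylorCoeff (deriv f) k = (k + 1) * taylorCoeff f (k + 1) := by
  simp only [taylorCoeff, ← iteratedDeriv_succ', Nat.factorial_succ]
  push_cast
  field_simp

/-! ### The function `-log(1-y)/y` and its powers -/

/-- The analytic function `-log(1-y)/y`. -/
def logQuot (y : ℝ) : ℝ := if y = 0 then 1 else -Real.log (1 - y) / y

/-- The Taylor coefficients of `(-log(1-y)/y)^(-s)`. -/
def logCoeff (s : ℝ) (l : ℕ) : ℝ := taylorCoeff (fun y => logQuot y ^ (-s)) l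

theorem newtonGregoryCoeff_eq (α : ℝ) (k : ℕ) : newtonGregoryCoeff α k = logCoeff (-α) k := by
  rw [newtonGregoryCoeff, logCoeff]
  congr 1
  funext y
  by_cases hy : y = 0 <;> simp [logQuot, hy]

theorem logQuot_zero : logQuot 0 = 1 := by simp [logQuot]

theorem mul_logQuot (y : ℝ) : y * logQuot y = -Real.log (1 - y) := by
  by_cases hy : y = 0
  · simp [hy]
  · rw [logQuot, if_neg hy]; field_simp

theorem logQuot_pos {y : ℝ} (hy : y < 1) : 0 < logQuot y := by
  rcases lt_trichotomy y 0 with h | h | h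
  · rw [logQuot, if_neg h.ne]
    have : 0 < Real.log (1 - y) := Real.log_pos (by linarith)
    exact div_pos_of_neg_of_neg (by linarith) h
  · rw [h, logQuot_zero]; exact one_pos
  · rw [logQuot, if_neg h.ne']
    have : Real.log (1 - y) < 0 := Real.log_neg (by linarith) (by linarith)
    exact div_pos (by linarith) h

theorem analyticAt_logQuot : AnalyticAt ℝ logQuot 0 := by
  refine analyticAt_of_hasSum (a := fun n => 1 / ((n : ℝ) + 1)) ?_
  have hev : ∀ᶠ y : ℝ in 𝓝 0, |y| < 1 := by
    have := (continuous_abs (G := ℝ)).tendsto 0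
    rw [abs_zero] at this
    exact this.eventually_lt_const one_pos
  filter_upwards [hev] with y hy
  by_cases h0 : y = 0
  · rw [h0, logQuot_zero]
    convert hasSum_single (f := fun k : ℕ => 1 / ((k : ℝ) + 1) * (0 : ℝ) ^ k) 0 ?_ using 1
    · simp
    · intro n hn; simp [hn]
  · have h := (Real.hasSum_pow_div_log_of_abs_lt_one hy).mul_left y⁻¹
    rw [logQuot, if_neg h0, div_eq_inv_mul]
    refine HasSum.of_forall_eq h fun n => ?_
    rw [pow_succ]; field_simp

theorem analyticAt_rpow_of_pos {f : ℝ → ℝ} {x : ℝ} (hf : AnalyticAt ℝ f x) (h : 0 < f x) (s : ℝ) :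
    AnalyticAt ℝ (fun y => f y ^ s) x := by
  have h1 : AnalyticAt ℝ (fun y => Real.exp (Real.log (f y) * s)) x := by
    have := hf.log h
    fun_prop
  refine h1.congr ?_
  filter_upwards [hf.continuousAt.eventually_const_lt h] with y hy
  rw [Real.rpow_def_of_pos hy]

theorem analyticAt_logQuot_rpow (s : ℝ) : AnalyticAt ℝ (fun y => logQuot y ^ s) 0 :=
  analyticAt_rpow_of_pos analyticAt_logQuot (by rw [logQuot_zero]; exact one_pos) s

theorem hasSum_logCoeff (s : ℝ) :
    ∀ᶠ y in 𝓝 (0 : ℝ), HasSum (fun l => logCoeff s l * y ^ l) (logQuot y ^ (-s)) :=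
  hasSum_taylorCoeff (analyticAt_logQuot_rpow (-s))

theorem eventually_lt_one : ∀ᶠ y : ℝ in 𝓝 0, y < 1 := eventually_lt_nhds one_pos

theorem logCoeff_zero (s : ℝ) : logCoeff s 0 = 1 := by
  simp [logCoeff, taylorCoeff, logQuot_zero]

/-- Compare coefficients in `L^(-s) L^(-t) = L^(-(s+t))` with `L = logQuot`. With `t = -α` this
turns the expansion for `s`, multiplied by that of the quadrature, into the expansion for `s - α`.
-/
theorem logCoeff_add (s t : ℝ) (m : ℕ) :
    ∑ ij ∈ Finset.HasAntidiagonal.antidiagonal m, logCoeff s ij.1 * logCoeff t ij.2 =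
      logCoeff (s + t) m := by
  have h : ∀ᶠ y in 𝓝 (0 : ℝ), HasSum (fun l => PowerSeries.coeff l
      (PowerSeries.mk (logCoeff s) * PowerSeries.mk (logCoeff t)) * y ^ l)
      (logQuot y ^ (-(s + t))) := by
    filter_upwards [hasSum_logCoeff s, hasSum_logCoeff t, eventually_lt_one] with y h1 h2 h3
    rw [neg_add, Real.rpow_add (logQuot_pos h3)]
    apply hasSum_coeff_mul <;> simpa
  have := congrFun (taylorCoeff_eq_of_hasSum h) m
  rw [PowerSeries.coeff_mul] at this
  simpa [logCoeff] using this.symm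

theorem hasSum_mul_id {a : ℕ → ℝ} {y S : ℝ} (h : HasSum (fun k => a k * y ^ k) S) :
    HasSum (fun k => (if k = 0 then 0 else a (k - 1)) * y ^ k) (y * S) := by
  rw [← hasSum_nat_add_iff' 1]
  simp only [Finset.range_one, Finset.sum_singleton, if_true, zero_mul, sub_zero]
  refine HasSum.of_forall_eq (h.mul_left y) fun k => ?_
  simp [pow_succ]; ring

/-- Differentiating `y L(y) = -log(1-y)` gives `(1-y)(L + y L') = 1`; multiply by `s L^(-(s+1))`. -/
theorem deriv_logQuot_rpow (s : ℝ) : ∀ᶠ y in 𝓝 (0 : ℝ),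
    s * logQuot y ^ (-(s + 1)) =
      (1 - y) * (s * logQuot y ^ (-s) - y * deriv (fun y => logQuot y ^ (-s)) y) := by
  have hd : ∀ᶠ y in 𝓝 (0 : ℝ), AnalyticAt ℝ logQuot y := analyticAt_logQuot.eventually_analyticAt
  filter_upwards [hd, eventually_lt_one] with y hy h1
  have hpos := logQuot_pos h1
  have hdy := hy.differentiableAt.hasDerivAt
  have e1 : HasDerivAt (fun y => y * logQuot y) (logQuot y + y * deriv logQuot y) y := by
    simpa using! (hasDerivAt_id y).mul hdy
  have e2 : HasDerivAt (fun y : ℝ => -Real.log (1 - y)) (1 / (1 - y)) y := by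
    have := (((hasDerivAt_id y).const_sub 1).log (by
      have : 1 - y ≠ 0 := by linarith
      simpa using this)).neg
    refine HasDerivAt.congr_deriv this ?_
    simp [neg_div]
  have e3 : logQuot y + y * deriv logQuot y = 1 / (1 - y) := by
    rw [show (fun y => y * logQuot y) = fun y : ℝ => -Real.log (1 - y) from funext mul_logQuot] at e1
    exact e1.unique e2
  have e4 : deriv (fun y => logQuot y ^ (-s)) y = deriv logQuot y * (-s) * logQuot y ^ (-s - 1) :=
    (hdy.rpow_const (Or.inl hpos.ne')).deriv
  rw [e4]
  have e5 : logQuot y ^ (-s) = logQuot y ^ (-(s + 1)) * logQuot y := by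
    rw [← Real.rpow_add_one hpos.ne']; ring_nf
  rw [show -s - 1 = -(s + 1) by ring, e5]
  have h1' : (1 - y) ≠ 0 := by linarith
  have e6 : (1 - y) * (logQuot y + y * deriv logQuot y) = 1 := by rw [e3]; field_simp
  linear_combination (-s * logQuot y ^ (-(s + 1))) * e6

/-- The differential equation of `deriv_logQuot_rpow`, read coefficientwise. It is what makes the
expansion of `n^(s-1)/Γ(s)` compatible with `X d/dX`, hence with the shift from `s` to `s + 1`. -/
theorem logCoeff_succ (s : ℝ) (l : ℕ) :
    s * logCoeff (s + 1) l = (s - l) * logCoeff s l -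
      (if l = 0 then 0 else (s - (l - 1 : ℕ)) * logCoeff s (l - 1)) := by
  have hs := hasSum_logCoeff s
  have hs1 := hasSum_logCoeff (s + 1)
  have hds := hasSum_taylorCoeff (analyticAt_logQuot_rpow (-s)).deriv
  have key : ∀ᶠ y in 𝓝 (0 : ℝ), HasSum (fun l => ((s - l) * logCoeff s l -
      (if l = 0 then 0 else (s - (l - 1 : ℕ)) * logCoeff s (l - 1))) * y ^ l)
      (s * logQuot y ^ (-(s + 1))) := by
    filter_upwards [hs, hds, deriv_logQuot_rpow s] with y h1 h2 h3
    rw [h3]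
    have h4 : HasSum (fun l : ℕ => ((s - l) * logCoeff s l) * y ^ l)
        (s * logQuot y ^ (-s) - y * deriv (fun y => logQuot y ^ (-s)) y) := by
      refine HasSum.of_forall_eq ((h1.mul_left s).sub (hasSum_mul_id h2)) fun l => ?_
      rcases l with _ | l
      · simp only [if_true, Nat.cast_zero]; ring
      · simp only [taylorCoeff_deriv, Nat.add_sub_cancel, logCoeff]
        push_cast
        ring
    rw [sub_mul, one_mul]
    refine HasSum.of_forall_eq (h4.sub (hasSum_mul_id h4)) fun l => ?_
    rw [sub_mul]
  have key2 : ∀ᶠ y in 𝓝 (0 : ℝ), HasSum (fun l => (s * logCoeff (s + 1) l) * y ^ l)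
      (s * logQuot y ^ (-(s + 1))) := by
    filter_upwards [hs1] with y h1
    simpa [mul_assoc] using h1.mul_left s
  rw [← congrFun (taylorCoeff_eq_of_hasSum key) l, ← congrFun (taylorCoeff_eq_of_hasSum key2) l]

/-! ### Beta integrals -/

/-- On each half of the interval only one factor is singular, and `x ↦ t - x` exchanges the halves.
-/
theorem intervalIntegrable_beta {a b t : ℝ} (ha : 0 < a) (hb : 0 < b) (ht : 0 < t) :
    IntervalIntegrable (fun x => (t - x) ^ (a - 1) * x ^ (b - 1)) volume 0 t := by
  have half : ∀ {a b : ℝ}, 0 < b →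
      IntervalIntegrable (fun x => (t - x) ^ (a - 1) * x ^ (b - 1)) volume 0 (t / 2) := by
    intro a b hb
    have h1 : IntervalIntegrable (fun x : ℝ => x ^ (b - 1)) volume 0 (t / 2) :=
      intervalIntegral.intervalIntegrable_rpow' (by linarith)
    refine h1.continuousOn_mul ?_
    intro x hx
    rw [Set.uIcc_of_le (by linarith)] at hx
    refine ContinuousAt.continuousWithinAt ?_
    exact ContinuousAt.rpow_const (by fun_prop) (Or.inl (by linarith [hx.2]))
  refine (half hb).trans ?_
  have h2 := (half (a := b) ha).comp_sub_left t
  have h3 := h2.symm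
  simp only [sub_zero] at h3
  rw [show t - t / 2 = t / 2 by ring] at h3
  refine h3.congr fun x _ => ?_
  simp only [sub_sub_cancel]
  ring

theorem integral_beta {a b t : ℝ} (ha : 0 < a) (hb : 0 < b) (ht : 0 < t) :
    ∫ x in (0 : ℝ)..t, (t - x) ^ (a - 1) * x ^ (b - 1) =
      t ^ (a + b - 1) * (Real.Gamma a * Real.Gamma b / Real.Gamma (a + b)) := by
  have h := Complex.betaIntegral_scaled (b : ℂ) (a : ℂ) ht
  have h1 : Complex.betaIntegral (b : ℂ) (a : ℂ) =
      ((Real.Gamma a * Real.Gamma b / Real.Gamma (a + b) : ℝ) : ℂ) := by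
    have h2 := Complex.Gamma_mul_Gamma_eq_betaIntegral (s := (b : ℂ)) (t := (a : ℂ))
      (by simpa) (by simpa)
    have h3 : Real.Gamma (a + b) ≠ 0 := (Real.Gamma_pos_of_pos (by linarith)).ne'
    rw [← Complex.ofReal_add, Complex.Gamma_ofReal, Complex.Gamma_ofReal, Complex.Gamma_ofReal,
      add_comm b a] at h2
    have h4 : ((Real.Gamma (a + b) : ℝ) : ℂ) ≠ 0 := by exact_mod_cast h3
    push_cast
    rw [eq_div_iff h4, mul_comm _ ((Real.Gamma (a + b) : ℝ) : ℂ), ← h2]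
    ring
  rw [h1] at h
  have h5 : ∫ x in (0 : ℝ)..t, ((x : ℂ) ^ ((b : ℂ) - 1) * ((t : ℂ) - x) ^ ((a : ℂ) - 1)) =
      ∫ x in (0 : ℝ)..t, (((t - x) ^ (a - 1) * x ^ (b - 1) : ℝ) : ℂ) := by
    refine intervalIntegral.integral_congr fun x hx => ?_
    rw [Set.uIcc_of_le ht.le] at hx
    rw [Complex.ofReal_mul, Complex.ofReal_cpow (by linarith [hx.2]), Complex.ofReal_cpow hx.1]
    push_cast
    ring
  rw [h5, intervalIntegral.integral_ofReal, ← Complex.ofReal_add, ← Complex.ofReal_one,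
    ← Complex.ofReal_sub, ← Complex.ofReal_cpow ht.le, ← Complex.ofReal_mul] at h
  rw [Complex.ofReal_injective h, add_comm b a]

theorem image_exp_neg : (fun u : ℝ => Real.exp (-u)) '' Set.Ioi 0 = Set.Ioo 0 1 := by
  ext x
  constructor
  · rintro ⟨u, hu, rfl⟩
    exact ⟨Real.exp_pos _, by simpa using hu⟩
  · rintro ⟨h0, h1⟩
    exact ⟨-Real.log x, by simpa using Real.log_neg h0 h1, by simp [Real.exp_log h0]⟩

/-- The substitution `x = e^(-u)` turns this into the Beta integral with parameters `a + 1` and `r -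
a`. -/
theorem integral_exp_sub_one {a r : ℝ} (ha : -1 < a) (hr : a < r) :
    IntegrableOn (fun u => Real.exp (-(r * u)) * (Real.exp u - 1) ^ a) (Set.Ioi 0) ∧
    ∫ u in Set.Ioi (0 : ℝ), Real.exp (-(r * u)) * (Real.exp u - 1) ^ a =
      Real.Gamma (a + 1) * Real.Gamma (r - a) / Real.Gamma (r + 1) := by
  set g : ℝ → ℝ := fun x => (1 - x) ^ ((a + 1) - 1) * x ^ ((r - a) - 1) with hg
  have hd : ∀ u ∈ Set.Ioi (0 : ℝ), HasDerivWithinAt (fun u : ℝ => Real.exp (-u))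
      (-Real.exp (-u)) (Set.Ioi 0) u := fun u _ => by
    have := ((hasDerivAt_id u).neg.exp).hasDerivWithinAt (s := Set.Ioi 0)
    simpa using! this
  have hinj : Set.InjOn (fun u : ℝ => Real.exp (-u)) (Set.Ioi 0) := fun u _ v _ h => by
    simpa using h
  have hcongr : Set.EqOn (fun u => |(-Real.exp (-u))| • g (Real.exp (-u)))
      (fun u => Real.exp (-(r * u)) * (Real.exp u - 1) ^ a) (Set.Ioi 0) := by
    intro u hu
    have hu' : 1 < Real.exp u := by simpa using hu
    have e1 : 1 - Real.exp (-u) = (Real.exp u - 1) * Real.exp (-u) := by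
      rw [sub_mul, ← Real.exp_add]; simp
    simp only [hg, abs_neg, Real.abs_exp, smul_eq_mul, add_sub_cancel_right]
    rw [e1, Real.mul_rpow (by linarith) (Real.exp_pos _).le, ← Real.exp_mul, ← Real.exp_mul]
    have e2 : Real.exp (-(r * u)) =
        Real.exp (-u) * Real.exp (-u * a) * Real.exp (-u * (r - a - 1)) := by
      rw [← Real.exp_add, ← Real.exp_add]; ring_nf
    rw [e2]; ring
  have hint := intervalIntegrable_beta (a := a + 1) (b := r - a) (by linarith) (by linarith)
    (one_pos)
  have hval := integral_beta (a := a + 1) (b := r - a) (by linarith) (by linarith) (one_pos)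
  have h1 := integrableOn_image_iff_integrableOn_abs_deriv_smul measurableSet_Ioi hd hinj g
  have h2 := integral_image_eq_integral_abs_deriv_smul measurableSet_Ioi hd hinj g
  rw [image_exp_neg] at h1 h2
  constructor
  · refine (h1.1 ?_).congr_fun hcongr measurableSet_Ioi
    rw [intervalIntegrable_iff_integrableOn_Ioo_of_le zero_le_one] at hint
    exact hint
  · rw [← setIntegral_congr_fun measurableSet_Ioi hcongr, ← h2, ← integral_Ioc_eq_integral_Ioo,
      ← intervalIntegral.integral_of_le zero_le_one, hg, hval, show a + 1 + (r - a) = r + 1 by ring]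
    simp

theorem Gamma_add_nat_eq_prod {s : ℝ} (hs : ∀ m : ℕ, s ≠ -m) (n : ℕ) :
    Real.Gamma (s + n) = Real.Gamma s * ∏ j ∈ Finset.range n, (s + j) := by
  induction n with
  | zero => simp
  | succ n ih =>
    rw [Finset.prod_range_succ, ← mul_assoc, ← ih, Nat.cast_succ, ← add_assoc,
      Real.Gamma_add_one (fun h => hs n (by linarith)), mul_comm]

theorem coeff_bin_one (a : ℝ) (n : ℕ) : PowerSeries.coeff n (bin (1 : ℝ) a) =
    (∏ j ∈ Finset.range n, (-a + j)) / n.factorial := by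
  rw [coeff_bin, choose_eq_prod_div]
  have : ∏ j ∈ Finset.range n, (-a + (j : ℝ)) = (-1) ^ n * ∏ j ∈ Finset.range n, (a - j) := by
    rw [← Finset.card_range n, ← Finset.prod_const, Finset.card_range, ← Finset.prod_mul_distrib]
    exact Finset.prod_congr rfl fun j _ => by ring
  rw [this]
  simp only [RCLike.ofReal_real_eq_id, id]
  ring

theorem coeff_bin_one_eq_Gamma {s : ℝ} (hs : ∀ m : ℕ, s ≠ -m) (n : ℕ) :
    PowerSeries.coeff n (bin (1 : ℝ) (-s)) =
      Real.Gamma (s + n) / (Real.Gamma s * n.factorial) := by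
  have h := Real.Gamma_ne_zero hs
  rw [coeff_bin_one, Gamma_add_nat_eq_prod hs, neg_neg, mul_div_mul_left _ _ h]

/-- Since `Real.Gamma` is `0` at its poles and `0⁻¹ = 0`, the inverse is the entire function `1/Γ`,
and the functional equation in this form needs no exceptions. Later identities pass through the
poles by means of it. -/
theorem one_div_Gamma (x : ℝ) : (Real.Gamma x)⁻¹ = x * (Real.Gamma (x + 1))⁻¹ := by
  by_cases h : x = 0
  · simp [h, Real.Gamma_zero]
  · rw [Real.Gamma_add_one h, mul_inv, ← mul_assoc, mul_inv_cancel₀ h, one_mul]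

/-! ### Expansion of powers of `n` in binomial coefficients -/

theorem exp_sub_one_rpow_le (a : ℝ) {u : ℝ} (hu : 0 < u) :
    (Real.exp u - 1) ^ a ≤ u ^ a * Real.exp (|a| * u) := by
  have h1 : u ≤ Real.exp u - 1 := by linarith [Real.add_one_le_exp u]
  have h2 : Real.exp u - 1 ≤ u * Real.exp u := by
    have := Real.add_one_le_exp (-u)
    have h3 : Real.exp (-u) * Real.exp u = 1 := by rw [← Real.exp_add]; simp
    nlinarith [Real.exp_pos u]
  rcases le_total 0 a with h | h
  · rw [abs_of_nonneg h]
    calc (Real.exp u - 1) ^ a ≤ (u * Real.exp u) ^ a :=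
          Real.rpow_le_rpow (by linarith) h2 h
      _ = u ^ a * Real.exp (a * u) := by
          rw [Real.mul_rpow hu.le (Real.exp_pos _).le, ← Real.exp_mul, mul_comm u a]
  · calc (Real.exp u - 1) ^ a ≤ u ^ a := Real.rpow_le_rpow_of_nonpos hu h1 h
      _ ≤ u ^ a * Real.exp (|a| * u) :=
          le_mul_of_one_le_right (by positivity) (Real.one_le_exp (by positivity))

/-- With `w = e^u - 1` one has `u = log(1+w) = w · logQuot(-w)`, so `u^(-s) = w^(-s)
logQuot(-w)^(-s)`, and the sum is the Taylor polynomial of the last factor. Taylor's estimate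
applies for small `w`; for large `w` each term is bounded separately, the exponential compensating
the growth of `w` against `u`. -/
theorem laplace_kernel_bound (s : ℝ) (N : ℕ) : ∃ C : ℝ, 0 ≤ C ∧ ∀ u : ℝ, 0 < u →
    |u ^ (-s) - ∑ l ∈ Finset.range N, (-1) ^ l * logCoeff s l * (Real.exp u - 1) ^ ((l : ℝ) - s)| ≤
      C * (u ^ ((N : ℝ) - s) * Real.exp ((N + |s|) * u)) := by
  obtain ⟨c, hc, hcb⟩ := (taylor_isBigO (analyticAt_logQuot_rpow (-s)) N).exists_nonneg
  obtain ⟨r, hr, hball⟩ := Metric.eventually_nhds_iff.1 hcb.bound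
  -- The value of `u` at which `w = e^u - 1` reaches the radius `r` of the Taylor estimate.
  set u₀ := Real.log (1 + r) with hu₀
  have hu₀pos : 0 < u₀ := Real.log_pos (by linarith)
  have hE : ∀ (a : ℝ) (u : ℝ), 0 < u → |a| ≤ N + |s| →
      (Real.exp u - 1) ^ a ≤ u ^ a * Real.exp ((N + |s|) * u) := fun a u hu ha => by
    refine (exp_sub_one_rpow_le a hu).trans ?_
    gcongr
  have hlN : ∀ l : ℕ, l ≤ N → |(l : ℝ) - s| ≤ N + |s| := fun l hl =>
    (abs_sub _ _).trans (by
      rw [abs_of_nonneg (Nat.cast_nonneg l)]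
      have : (l : ℝ) ≤ N := by exact_mod_cast hl
      linarith)
  have hS : 0 ≤ ∑ l ∈ Finset.range N, |logCoeff s l| * u₀ ^ ((l : ℝ) - N) :=
    Finset.sum_nonneg fun l _ => by positivity
  refine ⟨c + (u₀ ^ (-(N : ℝ)) + ∑ l ∈ Finset.range N, |logCoeff s l| * u₀ ^ ((l : ℝ) - N)),
    by positivity, fun u hu => ?_⟩
  have hw : 0 < Real.exp u - 1 := by linarith [Real.add_one_le_exp u]
  set w := Real.exp u - 1 with hwdef
  have hbase : 0 ≤ u ^ ((N : ℝ) - s) * Real.exp ((N + |s|) * u) := by positivity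
  rcases lt_or_ge w r with h | h
  · have hq : logQuot (-w) = u / w := by
      have : w ≠ 0 := hw.ne'
      rw [logQuot, if_neg (by simpa using this), sub_neg_eq_add, hwdef,
        add_sub_cancel, Real.log_exp, neg_div_neg_eq]
    have h1 := hball (y := -w) (by simpa [abs_of_pos hw] using h)
    have h2 : u ^ (-s) - ∑ l ∈ Finset.range N, (-1) ^ l * logCoeff s l * w ^ ((l : ℝ) - s) =
        w ^ (-s) * (logQuot (-w) ^ (-s) -
          ∑ l ∈ Finset.range N, taylorCoeff (fun y => logQuot y ^ (-s)) l * (-w) ^ l) := by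
      rw [hq, mul_sub, ← Real.mul_rpow hw.le (by positivity), mul_div_cancel₀ _ hw.ne',
        Finset.mul_sum]
      congr 1
      refine Finset.sum_congr rfl fun l _ => ?_
      rw [sub_eq_add_neg, Real.rpow_add hw, Real.rpow_natCast, neg_pow w, logCoeff]
      ring
    rw [h2, abs_mul, abs_of_pos (by positivity : (0 : ℝ) < w ^ (-s))]
    rw [Real.norm_eq_abs, Real.norm_eq_abs, abs_pow, abs_neg, abs_of_pos hw] at h1
    calc w ^ (-s) * _ ≤ w ^ (-s) * (c * w ^ N) := by gcongr
      _ = c * w ^ ((N : ℝ) - s) := by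
          rw [sub_eq_add_neg, Real.rpow_add hw, Real.rpow_natCast]; ring
      _ ≤ c * (u ^ ((N : ℝ) - s) * Real.exp ((N + |s|) * u)) := by
          gcongr
          exact hE _ u hu (hlN N le_rfl)
      _ ≤ _ := by
          gcongr
          have : 0 ≤ u₀ ^ (-(N : ℝ)) := by positivity
          linarith
  · have hu₀u : u₀ ≤ u := by
      rw [hu₀, Real.log_le_iff_le_exp (by linarith)]; linarith
    have hlow : ∀ a : ℝ, a ≤ N → u ^ (a - s) ≤ u₀ ^ (a - N) * u ^ ((N : ℝ) - s) := fun a ha => by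
      rw [show a - s = (a - N) + (N - s) by ring, Real.rpow_add hu]
      exact mul_le_mul_of_nonneg_right
        (Real.rpow_le_rpow_of_nonpos hu₀pos hu₀u (sub_nonpos.2 ha)) (by positivity)
    have h1 : |u ^ (-s)| ≤ u₀ ^ (-(N : ℝ)) * (u ^ ((N : ℝ) - s) * Real.exp ((N + |s|) * u)) := by
      rw [abs_of_nonneg (by positivity)]
      have := hlow 0 (Nat.cast_nonneg N)
      rw [zero_sub, zero_sub] at this
      refine this.trans ?_
      gcongr
      exact le_mul_of_one_le_right (by positivity) (Real.one_le_exp (by positivity))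
    have h2 : |∑ l ∈ Finset.range N, (-1) ^ l * logCoeff s l * w ^ ((l : ℝ) - s)| ≤
        (∑ l ∈ Finset.range N, |logCoeff s l| * u₀ ^ ((l : ℝ) - N)) *
          (u ^ ((N : ℝ) - s) * Real.exp ((N + |s|) * u)) := by
      rw [Finset.sum_mul]
      refine (Finset.abs_sum_le_sum_abs _ _).trans (Finset.sum_le_sum fun l hl => ?_)
      have hl' : l ≤ N := (Finset.mem_range.1 hl).le
      rw [abs_mul, abs_mul, abs_pow, abs_neg, abs_one, one_pow, one_mul,
        abs_of_nonneg (by positivity : 0 ≤ w ^ ((l : ℝ) - s)), mul_assoc]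
      gcongr
      refine (hE _ u hu (hlN l hl')).trans ?_
      rw [← mul_assoc]
      gcongr
      exact hlow l (by exact_mod_cast hl')
    refine (abs_sub _ _).trans ((add_le_add h1 h2).trans ?_)
    rw [← add_mul]
    exact mul_le_mul_of_nonneg_right (by linarith) hbase

/-- The power series `∑ n^(s-1)/Γ(s) X^n`. -/
def powSeries (s : ℝ) : ℝ⟦X⟧ := PowerSeries.mk fun n : ℕ => (n : ℝ) ^ (s - 1) / Real.Gamma s

/-- The difference between `∑ n^(s-1)/Γ(s) X^n` and the first terms of its expansion at `1`. -/
def powRem (s : ℝ) (N : ℕ) : ℝ⟦X⟧ :=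
  powSeries s - ∑ l ∈ Finset.range N, PowerSeries.C (logCoeff s l) * bin 1 ((l : ℝ) - s)

/-- Euler's reflection formula at `s` and at `s - l`, whose sines differ by the sign `(-1)^l`. -/
theorem Gamma_inv_sub_nat {s : ℝ} (hs : ∀ m : ℤ, s ≠ m) (l : ℕ) :
    (Real.Gamma (s - l))⁻¹ =
      (-1) ^ l * Real.Gamma (1 - s + l) * (Real.Gamma s * Real.Gamma (1 - s))⁻¹ := by
  have h1 := Real.Gamma_mul_Gamma_one_sub s
  have h2 := Real.Gamma_mul_Gamma_one_sub (s - l)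
  have g1 : Real.Gamma (s - l) ≠ 0 := Real.Gamma_ne_zero fun m h => hs (l - m) (by
    push_cast; linarith)
  have g2 : Real.Gamma s * Real.Gamma (1 - s) ≠ 0 := mul_ne_zero
    (Real.Gamma_ne_zero fun m h => hs (-m) (by push_cast; linarith))
    (Real.Gamma_ne_zero fun m h => hs (1 + m) (by push_cast; linarith))
  have h3 : Real.sin (Real.pi * (s - l)) = (-1) ^ l * Real.sin (Real.pi * s) := by
    rw [mul_sub, mul_comm Real.pi (l : ℝ), Real.sin_sub_nat_mul_pi]
  rw [h3, show 1 - (s - l) = 1 - s + l by ring] at h2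
  have h4 : Real.Gamma (s - l) * Real.Gamma (1 - s + l) =
      (-1) ^ l * (Real.Gamma s * Real.Gamma (1 - s)) := by
    rw [h2, h1]
    rcases neg_one_pow_eq_or ℝ l with h | h <;> rw [h]
    · simp
    · rw [neg_one_mul, neg_one_mul, div_neg]
  have h5 : ((-1 : ℝ) ^ l) * (-1) ^ l = 1 := by rw [← mul_pow]; simp
  rw [← div_eq_mul_inv, eq_div_iff g2, inv_mul_eq_iff_eq_mul₀ g1]
  linear_combination (-(-1 : ℝ) ^ l) * h4 - (Real.Gamma s * Real.Gamma (1 - s)) * h5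

/-- The coefficient `Γ(s-l+n) / (Γ(s-l) n!)` is a Beta value, by reflection. Since `n^(s-1)` is
likewise a Laplace integral, of `u^(-s)`, the remainder `powRem` becomes the Laplace integral of the
difference of kernels. Convergence at `0` needs `s < 1`, convergence at infinity `n > l - s`. -/
theorem coeff_bin_eq_integral {s : ℝ} (hs : ∀ m : ℤ, s ≠ m) (h1 : s < 1) (l n : ℕ)
    (hn : (l : ℝ) - s < n) :
    PowerSeries.coeff n (bin (1 : ℝ) ((l : ℝ) - s)) =
      (Real.Gamma s * Real.Gamma (1 - s))⁻¹ * ((-1) ^ l *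
        ∫ u in Set.Ioi (0 : ℝ), Real.exp (-(n * u)) * (Real.exp u - 1) ^ ((l : ℝ) - s)) := by
  have hl : (0 : ℝ) ≤ l := Nat.cast_nonneg l
  rw [(integral_exp_sub_one (by linarith) hn).2, show (l : ℝ) - s = -(s - l) by ring,
    coeff_bin_one_eq_Gamma (fun m h => hs (l - m) (by push_cast; linarith)),
    ← div_div, div_eq_mul_inv (Real.Gamma _), Gamma_inv_sub_nat hs, Real.Gamma_nat_eq_factorial,
    show s - l + n = n - -(s - l) by ring, show -(s - l) + 1 = 1 - s + l by ring]
  ring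

/-- Watson's lemma: the kernel is `O(u^(N-s))` up to an exponential `e^(Ku)`, so its Laplace
integral at `n` is `O((n-K)^(-(N+1-s)))`. -/
theorem decay_powRem_of_lt_one {s : ℝ} (hs : ∀ m : ℤ, s ≠ m) (h1 : s < 1) (N : ℕ) :
    Decay (powRem s N) (N + 1 - s) := by
  obtain ⟨C, hC, hb⟩ := laplace_kernel_bound s N
  set κ := (Real.Gamma s * Real.Gamma (1 - s))⁻¹ with hκ
  have hG1 : Real.Gamma (1 - s) ≠ 0 :=
    Real.Gamma_ne_zero fun m h => hs (1 + m) (by push_cast; linarith)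
  set K : ℝ := N + |s| with hK
  have hN : (0 : ℝ) ≤ N := Nat.cast_nonneg N
  have hK0 : 0 ≤ K := by positivity
  refine Decay.of_eventually
    (C := |κ| * (C * (4 ^ ((N : ℝ) + 1 - s) * Real.Gamma (N + 1 - s)))) ?_
  -- Beyond `2K + 1` all the integrals converge, and `n - K` is at least a fixed multiple of `n +
  -- 1`.
  filter_upwards [eventually_gt_atTop ⌈2 * K + 1⌉₊] with n hn
  have hn' : 2 * K + 1 < n := (Nat.le_ceil _).trans_lt (by exact_mod_cast hn)
  have hln : ∀ l ∈ Finset.range N, (l : ℝ) - s < n := fun l hl => by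
    have : (l : ℝ) ≤ N := by exact_mod_cast (Finset.mem_range.1 hl).le
    linarith [neg_abs_le s]
  have hn0 : (0 : ℝ) < n := by linarith
  have i1 : IntegrableOn (fun u : ℝ => u ^ ((1 - s) - 1) * Real.exp (-(n * u))) (Set.Ioi 0) := by
    have := integrableOn_rpow_mul_exp_neg_mul_rpow (p := 1) (s := (1 - s) - 1) (b := n)
      (by linarith) one_pos hn0
    simpa using this
  have v1 := Real.integral_rpow_mul_exp_neg_mul_Ioi (a := 1 - s) (r := n) (by linarith) hn0
  have e : PowerSeries.coeff n (powRem s N) = κ * ∫ u in Set.Ioi (0 : ℝ), Real.exp (-(n * u)) *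
      (u ^ (-s) - ∑ l ∈ Finset.range N,
        (-1) ^ l * logCoeff s l * (Real.exp u - 1) ^ ((l : ℝ) - s)) := by
    have i2 : ∀ l ∈ Finset.range N, IntegrableOn (fun u : ℝ => (-1) ^ l * logCoeff s l *
        (Real.exp (-(n * u)) * (Real.exp u - 1) ^ ((l : ℝ) - s))) (Set.Ioi 0) := fun l hl =>
      ((integral_exp_sub_one (by linarith [(Nat.cast_nonneg l : (0 : ℝ) ≤ l)])
        (hln l hl)).1).const_mul _
    have e1 : ∀ u : ℝ, Real.exp (-(n * u)) * (u ^ (-s) - ∑ l ∈ Finset.range N,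
        (-1) ^ l * logCoeff s l * (Real.exp u - 1) ^ ((l : ℝ) - s)) =
        u ^ ((1 - s) - 1) * Real.exp (-(n * u)) - ∑ l ∈ Finset.range N, (-1) ^ l * logCoeff s l *
        (Real.exp (-(n * u)) * (Real.exp u - 1) ^ ((l : ℝ) - s)) := fun u => by
      rw [mul_sub, Finset.mul_sum, show 1 - s - 1 = -s by ring]
      congr 1
      · ring
      · exact Finset.sum_congr rfl fun l _ => by ring
    simp only [e1]
    rw [integral_sub i1 (integrable_finsetSum _ i2), v1, integral_finsetSum _ i2, powRem,
      map_sub, map_sum, powSeries, PowerSeries.coeff_mk, mul_sub, Finset.mul_sum]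
    congr 1
    · rw [hκ, one_div, Real.inv_rpow hn0.le, ← Real.rpow_neg hn0.le, neg_sub]
      field_simp
    · refine Finset.sum_congr rfl fun l hl => ?_
      rw [PowerSeries.coeff_C_mul, coeff_bin_eq_integral hs h1 l n (hln l hl), integral_const_mul]
      ring
  have hnK : 0 < n - K := by linarith
  have i3 : IntegrableOn (fun u : ℝ => u ^ ((N + 1 - s) - 1) * Real.exp (-((n - K) * u)))
      (Set.Ioi 0) := by
    have := integrableOn_rpow_mul_exp_neg_mul_rpow (p := 1) (s := (N + 1 - s) - 1) (b := n - K)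
      (by linarith) one_pos hnK
    simpa only [neg_mul, Real.rpow_one] using this
  have v3 := Real.integral_rpow_mul_exp_neg_mul_Ioi (a := N + 1 - s) (r := n - K) (by linarith) hnK
  have e4 : |∫ u in Set.Ioi (0 : ℝ), Real.exp (-(n * u)) *
      (u ^ (-s) - ∑ l ∈ Finset.range N,
        (-1) ^ l * logCoeff s l * (Real.exp u - 1) ^ ((l : ℝ) - s))| ≤
      C * ((1 / (n - K)) ^ ((N : ℝ) + 1 - s) * Real.Gamma (N + 1 - s)) := by
    rw [← v3, ← integral_const_mul, ← Real.norm_eq_abs]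
    refine norm_integral_le_of_norm_le (i3.const_mul C) ?_
    refine (ae_restrict_iff' measurableSet_Ioi).2 (Eventually.of_forall fun u hu => ?_)
    rw [norm_mul, Real.norm_eq_abs, Real.norm_eq_abs, Real.abs_exp]
    refine (mul_le_mul_of_nonneg_left (hb u hu) (Real.exp_pos _).le).trans (le_of_eq ?_)
    rw [show -((n - K) * u) = -(n * u) + K * u by ring, Real.exp_add,
      show (N : ℝ) + 1 - s - 1 = N - s by ring]
    ring
  have e5 : (1 / (n - K)) ^ ((N : ℝ) + 1 - s) ≤
      4 ^ ((N : ℝ) + 1 - s) * ((n : ℝ) + 1) ^ (-((N : ℝ) + 1 - s)) := by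
    rw [Real.rpow_neg (by positivity), ← Real.inv_rpow (by positivity),
      ← Real.mul_rpow (by norm_num) (by positivity)]
    refine Real.rpow_le_rpow (by positivity) ?_ (by linarith)
    rw [← div_eq_mul_inv, div_le_div_iff₀ hnK (by positivity)]
    linarith
  have hGp : 0 < Real.Gamma (N + 1 - s) := Real.Gamma_pos_of_pos (by linarith)
  rw [e, Real.norm_eq_abs, abs_mul]
  calc |κ| * _ ≤ |κ| * (C * ((1 / (n - K)) ^ ((N : ℝ) + 1 - s) * Real.Gamma (N + 1 - s))) := by
        gcongr
    _ ≤ |κ| * (C * ((4 ^ ((N : ℝ) + 1 - s) * ((n : ℝ) + 1) ^ (-((N : ℝ) + 1 - s))) *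
          Real.Gamma (N + 1 - s))) := by gcongr
    _ = _ := by ring

/-- The operator `X d/dX` on power series. -/
def eulerOp (f : ℝ⟦X⟧) : ℝ⟦X⟧ := PowerSeries.mk fun n : ℕ => (n : ℝ) * PowerSeries.coeff n f

theorem coeff_eulerOp (f : ℝ⟦X⟧) (n : ℕ) :
    PowerSeries.coeff n (eulerOp f) = n * PowerSeries.coeff n f := PowerSeries.coeff_mk _ _

theorem Decay.eulerOp {f : ℝ⟦X⟧} {a : ℝ} (h : Decay f a) : Decay (eulerOp f) (a - 1) := by
  obtain ⟨C, hC, h⟩ := h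
  refine ⟨C, hC, fun n => ?_⟩
  have hn : (0 : ℝ) ≤ n := Nat.cast_nonneg n
  rw [coeff_eulerOp, norm_mul, Real.norm_of_nonneg hn, neg_sub,
    show 1 - a = -a + 1 by ring, Real.rpow_add_one (by positivity)]
  calc (n : ℝ) * ‖PowerSeries.coeff n f‖ ≤ ((n : ℝ) + 1) * (C * ((n : ℝ) + 1) ^ (-a)) := by
        gcongr
        · linarith
        · exact h n
    _ = _ := by ring

/-- `X d/dX (1-X)^a = -a X (1-X)^(a-1)`, and `X = 1 - (1-X)`. -/
theorem eulerOp_bin (a : ℝ) :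
    eulerOp (bin (1 : ℝ) a) = PowerSeries.C (-a) * (bin 1 (a - 1) - bin 1 a) := by
  have h1 : bin (1 : ℝ) (a - 1) - bin 1 a = PowerSeries.X * bin 1 (a - 1) := by
    have : bin (1 : ℝ) a = bin 1 (a - 1) * (1 - PowerSeries.X) := by
      have h := bin_add (1 : ℝ) (a - 1) 1
      have h2 := bin_one_natCast (𝕂 := ℝ) 1
      rw [Nat.cast_one, pow_one] at h2
      rw [← h2, ← h, sub_add_cancel]
    rw [this]; ring
  rw [h1]
  ext n
  rw [coeff_eulerOp, PowerSeries.coeff_C_mul]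
  rcases n with _ | n
  · simp
  · rw [PowerSeries.coeff_succ_X_mul, coeff_bin_one, coeff_bin_one, Finset.prod_range_succ',
      Nat.factorial_succ]
    have : ∀ j : ℕ, -a + ((j + 1 : ℕ) : ℝ) = -(a - 1) + j := fun j => by push_cast; ring
    simp only [this]
    push_cast
    field_simp
    ring

theorem eulerOp_powSeries {s : ℝ} (hs : s ≠ 0) :
    eulerOp (powSeries s) = PowerSeries.C s * powSeries (s + 1) := by
  ext n
  rw [coeff_eulerOp, PowerSeries.coeff_C_mul, powSeries, powSeries, PowerSeries.coeff_mk,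
    PowerSeries.coeff_mk, Real.Gamma_add_one hs, add_sub_cancel_right]
  rcases Nat.eq_zero_or_pos n with h | h
  · simp [h, Real.zero_rpow hs]
  · have hn : (n : ℝ) ≠ 0 := by exact_mod_cast h.ne'
    have : (n : ℝ) * (n : ℝ) ^ (s - 1) = (n : ℝ) ^ s := by
      rw [mul_comm, Real.rpow_sub_one hn]; field_simp
    rw [← mul_div_assoc, this, ← mul_div_assoc, mul_div_mul_left _ _ hs]

/-- By `eulerOp_bin` each term splits over two neighbouring exponents. Collecting equal exponents
reproduces the recurrence `logCoeff_succ`, and only the last lower-order contribution is left over.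
-/
theorem eulerOp_sum (s : ℝ) (N : ℕ) :
    eulerOp (∑ l ∈ Finset.range N, PowerSeries.C (logCoeff s l) * bin 1 ((l : ℝ) - s)) =
      PowerSeries.C s * (∑ l ∈ Finset.range N,
        PowerSeries.C (logCoeff (s + 1) l) * bin 1 ((l : ℝ) - (s + 1))) -
      (if N = 0 then 0 else PowerSeries.C ((s - (N - 1 : ℕ)) * logCoeff s (N - 1)) *
        bin 1 ((N : ℝ) - (s + 1))) := by
  have hadd : ∀ f g, eulerOp (f + g) = eulerOp f + eulerOp g := fun f g => by
    ext n; simp [coeff_eulerOp, mul_add]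
  have hC : ∀ c f, eulerOp (PowerSeries.C c * f) = PowerSeries.C c * eulerOp f := fun c f => by
    ext n; simp [coeff_eulerOp, PowerSeries.coeff_C_mul]; ring
  induction N with
  | zero => ext n; simp [coeff_eulerOp]
  | succ N ih =>
    have h := congrArg (PowerSeries.C (R := ℝ)) (logCoeff_succ s N)
    rw [Finset.sum_range_succ, hadd, ih, hC, eulerOp_bin, Finset.sum_range_succ,
      if_neg (Nat.succ_ne_zero N), Nat.add_sub_cancel,
      show (N : ℝ) - s - 1 = N - (s + 1) by ring,
      show ((N + 1 : ℕ) : ℝ) - (s + 1) = N - s by push_cast; ring,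
      show -((N : ℝ) - s) = s - N by ring]
    rw [map_sub, map_mul, map_mul] at h
    rw [map_mul (PowerSeries.C (R := ℝ)) (s - N)]
    split_ifs at h ⊢
    · rw [map_zero] at h
      linear_combination (-bin 1 ((N : ℝ) - (s + 1))) * h
    · linear_combination (-bin 1 ((N : ℝ) - (s + 1))) * h

/-- `X d/dX` costs one order of decay, which is exactly the change in the target exponent, and the
boundary term of `eulerOp_sum` has that order as well. Division by `s` requires `s ≠ 0`. -/
theorem decay_powRem_add_one {s : ℝ} (hs : s ≠ 0) {N : ℕ} (h : Decay (powRem s N) (N + 1 - s)) :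
    Decay (powRem (s + 1) N) (N + 1 - (s + 1)) := by
  have h1 := h.eulerOp
  have hsub : ∀ f g, eulerOp (f - g) = eulerOp f - eulerOp g := fun f g => by
    ext n; simp [coeff_eulerOp, mul_sub]
  rw [powRem, hsub, eulerOp_powSeries hs, eulerOp_sum] at h1
  have h2 : Decay (if N = 0 then (0 : ℝ⟦X⟧) else
      PowerSeries.C ((s - (N - 1 : ℕ)) * logCoeff s (N - 1)) * bin 1 ((N : ℝ) - (s + 1)))
      (N + 1 - s - 1) := by
    split_ifs
    · exact decay_zero _
    · refine Decay.const_mul _ ((decay_bin (by simp) _).mono (by linarith))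
  have h3 := (h1.sub h2).const_mul s⁻¹
  rw [show (N : ℝ) + 1 - (s + 1) = N + 1 - s - 1 by ring]
  convert h3 using 1
  have hC : PowerSeries.C (s⁻¹) * PowerSeries.C s = (1 : ℝ⟦X⟧) := by
    rw [← map_mul, inv_mul_cancel₀ hs, map_one]
  rw [powRem]
  linear_combination (-powSeries (s + 1) + ∑ l ∈ Finset.range N,
        PowerSeries.C (logCoeff (s + 1) l) * bin 1 ((l : ℝ) - (s + 1))) * hC

theorem rapid_bin_natCast (k : ℕ) : Rapid (bin (1 : ℝ) (k : ℝ)) := by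
  intro a
  rw [bin_one_natCast]
  convert decay_coe ((1 - Polynomial.X : ℝ[X]) ^ k) a
  simp

/-- For `s = 1` the leading term `(1-X)^(-1)` is the whole series (with `0^0 = 1` at `n = 0`), and
the terms with `l ≥ 1` are polynomials. -/
theorem decay_powRem_one (N : ℕ) : Decay (powRem 1 N) (N + 1 - 1) := by
  rcases N with _ | N
  · simp only [powRem, Finset.range_zero, Finset.sum_empty, sub_zero]
    refine Decay.of_le (C := 1) fun n => ?_
    simp [powSeries]
  · rw [powRem, Finset.sum_range_succ', ← sub_sub, sub_right_comm]
    refine Decay.sub ?_ (decay_sum _ fun l _ => Decay.const_mul _ ?_)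
    · convert decay_zero (𝕂 := ℝ) _
      ext n
      rw [logCoeff_zero, map_one, one_mul, Nat.cast_zero, zero_sub, map_sub, coeff_bin_one,
        powSeries, PowerSeries.coeff_mk]
      have : ∏ j ∈ Finset.range n, (-(-1 : ℝ) + j) = n.factorial := by
        rw [← Finset.prod_range_add_one_eq_factorial]
        push_cast
        exact Finset.prod_congr rfl fun j _ => by ring
      rw [this, div_self (by positivity)]
      simp
    · rw [Nat.cast_succ, add_sub_cancel_right]
      exact rapid_bin_natCast l _

/-- At a pole of `Γ` the series is zero by the convention `1/Γ = 0`, and all `(1-X)^(l+k)` are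
polynomials. -/
theorem decay_powRem_neg_nat (k N : ℕ) : Decay (powRem (-(k : ℝ)) N) (N + 1 - (-(k : ℝ))) := by
  have : powSeries (-(k : ℝ)) = 0 := by
    ext n
    simp [powSeries, Real.Gamma_neg_nat_eq_zero]
  rw [powRem, this, zero_sub]
  refine (decay_sum _ fun l _ => Decay.const_mul _ ?_).neg
  rw [sub_neg_eq_add, ← Nat.cast_add]
  exact rapid_bin_natCast _ _

/-- The expansion of `n^(s-1)/Γ(s)` in the coefficients of `(1-X)^(l-s)`. -/
theorem decay_powRem (s : ℝ) (N : ℕ) : Decay (powRem s N) (N + 1 - s) := by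
  by_cases hs : ∃ m : ℤ, s = m
  · obtain ⟨m, rfl⟩ := hs
    rcases le_or_gt m 0 with h | h
    · obtain ⟨k, hk⟩ := Int.eq_ofNat_of_zero_le (neg_nonneg.2 h)
      have : ((m : ℤ) : ℝ) = -(k : ℝ) := by
        have h2 : m = -(k : ℤ) := by omega
        rw [h2]; push_cast; ring
      rw [this]
      exact decay_powRem_neg_nat k N
    · obtain ⟨k, rfl⟩ : ∃ k : ℕ, m = k + 1 := ⟨(m - 1).toNat, by omega⟩
      push_cast
      clear h
      induction k with
      | zero => simpa using decay_powRem_one N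
      | succ k ih =>
        push_cast
        exact decay_powRem_add_one (by positivity) ih
  · push Not at hs
    -- `k` counts the unit steps that bring a non-integer `s` below `1`, where the Laplace
    -- representation is available.
    obtain ⟨k, hk⟩ := exists_nat_gt (s - 1)
    induction k generalizing s with
    | zero => exact decay_powRem_of_lt_one hs (by simp at hk; linarith) N
    | succ k ih =>
      have := decay_powRem_add_one (s := s - 1) (N := N)
        (fun h => hs 1 (by push_cast; linarith))
        (ih (s - 1) (fun m h => hs (m + 1) (by push_cast; linarith)) (by
          push_cast at hk; linarith))
      rwa [sub_add_cancel] at this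

/-! ### Expansion of power series at `1` -/

theorem summable_of_decay {f : ℝ⟦X⟧} {a : ℝ} (h : Decay f a) (ha : 2 ≤ a) :
    Summable fun n => ‖PowerSeries.coeff n f‖ := by
  obtain ⟨C, hC, h⟩ := h.mono ha
  have hsum : Summable fun l : ℕ => ((l : ℝ) + 1) ^ (-2 : ℝ) := by
    have := (Real.summable_one_div_nat_add_rpow 1 2).2 one_lt_two
    refine this.congr fun l => ?_
    rw [abs_of_nonneg (by positivity), Real.rpow_neg (by positivity), one_div]
  exact Summable.of_nonneg_of_le (fun _ => norm_nonneg _) h (hsum.mul_left C)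

/-- Division by `1 - X` after subtracting the value `S` at `1`: the coefficients of the quotient are
minus the tails of `∑ f_n`. Giving up two orders keeps the tail estimate elementary. -/
theorem exists_eq_const_add {f : ℝ⟦X⟧} {a : ℝ} (h : Decay f a) (ha : 2 ≤ a) :
    ∃ (c : ℝ) (g : ℝ⟦X⟧), Decay g (a - 2) ∧ f = PowerSeries.C c + (1 - PowerSeries.X) * g := by
  have hs := (summable_of_decay h ha).of_norm
  set S := ∑' n, PowerSeries.coeff n f with hS
  refine ⟨S, PowerSeries.mk fun n => ∑ k ∈ Finset.range (n + 1), PowerSeries.coeff k f - S, ?_, ?_⟩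
  · obtain ⟨C, hC, hb⟩ := h
    have hsum : Summable fun l : ℕ => ((l : ℝ) + 1) ^ (-2 : ℝ) := by
      have := (Real.summable_one_div_nat_add_rpow 1 2).2 one_lt_two
      refine this.congr fun l => ?_
      rw [abs_of_nonneg (by positivity), Real.rpow_neg (by positivity), one_div]
    refine Decay.of_le (C := C * ∑' l : ℕ, ((l : ℝ) + 1) ^ (-2 : ℝ)) fun n => ?_
    have h1 := hs.sum_add_tsum_nat_add (n + 1)
    have hsn : Summable fun l : ℕ => (((l + (n + 1) : ℕ) : ℝ) + 1) ^ (-2 : ℝ) :=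
      (summable_nat_add_iff (n + 1)).2 hsum
    rw [PowerSeries.coeff_mk, hS, ← h1, sub_add_cancel_left, norm_neg]
    have hterm : ∀ l : ℕ, ‖PowerSeries.coeff (l + (n + 1)) f‖ ≤
        C * ((n : ℝ) + 1) ^ (-(a - 2)) * (((l + (n + 1) : ℕ) : ℝ) + 1) ^ (-2 : ℝ) := fun l => by
      refine (hb _).trans ?_
      rw [mul_assoc]
      refine mul_le_mul_of_nonneg_left ?_ hC
      have hpos : (0 : ℝ) < ((l + (n + 1) : ℕ) : ℝ) + 1 := by positivity
      rw [show -a = -(a - 2) + (-2) by ring, Real.rpow_add hpos]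
      refine mul_le_mul_of_nonneg_right ?_ (by positivity)
      refine Real.rpow_le_rpow_of_nonpos (by positivity) ?_ (by linarith)
      push_cast
      linarith [(Nat.cast_nonneg l : (0 : ℝ) ≤ l)]
    refine (tsum_of_norm_bounded ((hsn.mul_left _).hasSum) hterm).trans ?_
    rw [tsum_mul_left, mul_assoc, mul_assoc, mul_comm (∑' l : ℕ, ((l : ℝ) + 1) ^ (-2 : ℝ))]
    refine mul_le_mul_of_nonneg_left ?_ hC
    refine mul_le_mul_of_nonneg_left ?_ (by positivity)
    rw [← hsum.sum_add_tsum_nat_add (n + 1)]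
    have : 0 ≤ ∑ l ∈ Finset.range (n + 1), ((l : ℝ) + 1) ^ (-2 : ℝ) :=
      Finset.sum_nonneg fun _ _ => by positivity
    linarith
  · ext n
    rw [map_add, sub_mul, one_mul, map_sub, PowerSeries.coeff_C]
    rcases n with _ | n
    · simp
    · rw [PowerSeries.coeff_succ_X_mul, PowerSeries.coeff_mk, PowerSeries.coeff_mk,
        Finset.sum_range_succ]
      simp

theorem exists_expansion_one (p : ℕ) {f : ℝ⟦X⟧} {a : ℝ} (h : Decay f a) (ha : 2 * p ≤ a) :
    ∃ (c : ℕ → ℝ) (g : ℝ⟦X⟧), Decay g (a - 2 * p) ∧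
      f = ∑ i ∈ Finset.range p, PowerSeries.C (c i) * (1 - PowerSeries.X) ^ i +
        (1 - PowerSeries.X) ^ p * g := by
  induction p with
  | zero => exact ⟨0, f, by simpa using h, by simp⟩
  | succ p ih =>
    push_cast at ha
    obtain ⟨c, g, hg, hf⟩ := ih (by linarith)
    obtain ⟨d, g', hg', hg2⟩ := exists_eq_const_add hg (by linarith)
    refine ⟨Function.update c p d, g', by convert hg' using 1; push_cast; ring, ?_⟩
    rw [Finset.sum_range_succ, Function.update_self]
    have : ∑ i ∈ Finset.range p, PowerSeries.C (Function.update c p d i) *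
        (1 - PowerSeries.X) ^ i = ∑ i ∈ Finset.range p, PowerSeries.C (c i) *
        (1 - PowerSeries.X) ^ i := Finset.sum_congr rfl fun i hi => by
      rw [Function.update_of_ne (Finset.mem_range.1 hi).ne]
    rw [this, hf, hg2]
    ring

theorem coeff_eq_zero_of_isBigO (p : ℕ) (d : ℕ → ℝ)
    (h : (fun y : ℝ => ∑ i ∈ Finset.range p, d i * y ^ i) =O[𝓝[>] 0] fun y => y ^ p) :
    ∀ i < p, d i = 0 := by
  induction p generalizing d with
  | zero => intro i hi; omega
  | succ p ih =>
    have h0 : d 0 = 0 := by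
      have t1 : Tendsto (fun y : ℝ => ∑ i ∈ Finset.range (p + 1), d i * y ^ i) (𝓝[>] 0)
          (𝓝 (∑ i ∈ Finset.range (p + 1), d i * 0 ^ i)) :=
        (Continuous.tendsto (by fun_prop) 0).mono_left nhdsWithin_le_nhds
      have t2 : Tendsto (fun y : ℝ => y ^ (p + 1)) (𝓝[>] 0) (𝓝 0) := by
        have := (continuous_pow (M := ℝ) (p + 1)).tendsto 0
        rw [zero_pow (Nat.succ_ne_zero p)] at this
        exact this.mono_left nhdsWithin_le_nhds
      have := tendsto_nhds_unique t1 (h.trans_tendsto t2)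
      rw [Finset.sum_range_succ'] at this
      simpa using this
    have h1 : (fun y : ℝ => ∑ i ∈ Finset.range p, d (i + 1) * y ^ i) =O[𝓝[>] 0] fun y => y ^ p := by
      have hinv : (fun y : ℝ => y⁻¹) =O[𝓝[>] 0] fun y : ℝ => y⁻¹ := isBigO_refl _ _
      refine (hinv.mul h).congr' ?_ ?_
      · filter_upwards [self_mem_nhdsWithin] with y hy
        have hy' : y ≠ 0 := ne_of_gt hy
        rw [Finset.sum_range_succ', h0, zero_mul, add_zero, Finset.mul_sum]
        refine Finset.sum_congr rfl fun i _ => ?_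
        rw [pow_succ]; field_simp
      · filter_upwards [self_mem_nhdsWithin] with y hy
        have hy' : y ≠ 0 := ne_of_gt hy
        rw [pow_succ]; field_simp
    intro i hi
    rcases i with _ | i
    · exact h0
    · exact ih (fun i => d (i + 1)) h1 i (by omega)

/-- Coefficients of size `(n+1)^K` are dominated by `K!` times those of `(1-x)^(-(K+1))`. This shows
that `(1-X)^M η` is negligible at the point `1` when `M` is large. -/
theorem norm_eval_le_of_decay {f : ℝ⟦X⟧} {a : ℝ} (h : Decay f a) {K : ℕ} (hK : -a ≤ K) :
    ∃ C : ℝ, 0 ≤ C ∧ ∀ y : ℝ, 0 < y → y < 1 → ∃ v : ℝ,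
      HasSum (fun n => PowerSeries.coeff n f * (1 - y) ^ n) v ∧ |v| ≤ C * (y ^ (K + 1))⁻¹ := by
  obtain ⟨C, hC, h⟩ := h
  refine ⟨C * K.factorial, by positivity, fun y hy hy1 => ?_⟩
  have hx0 : 0 ≤ 1 - y := by linarith
  have hx1 : ‖1 - y‖ < 1 := by rw [Real.norm_of_nonneg hx0]; linarith
  have hs := (hasSum_choose_mul_geometric_of_norm_lt_one K hx1).mul_left (C * K.factorial)
  have hb : ∀ n : ℕ, ‖PowerSeries.coeff n f * (1 - y) ^ n‖ ≤
      C * K.factorial * (((n + K).choose K : ℝ) * (1 - y) ^ n) := fun n => by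
    rw [norm_mul, norm_pow, Real.norm_of_nonneg hx0, ← mul_assoc]
    refine mul_le_mul_of_nonneg_right ((h n).trans ?_) (by positivity)
    rw [mul_assoc]
    refine mul_le_mul_of_nonneg_left ?_ hC
    have h1 : ((n : ℝ) + 1) ^ (-a) ≤ ((n : ℝ) + 1) ^ K := by
      rw [← Real.rpow_natCast]
      exact Real.rpow_le_rpow_of_exponent_le (by linarith [(Nat.cast_nonneg n : (0 : ℝ) ≤ n)]) hK
    refine h1.trans ?_
    have h2 : (n + 1) ^ K ≤ K.factorial * (n + K).choose K := by
      rw [← Nat.ascFactorial_eq_factorial_mul_choose]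
      exact Nat.pow_succ_le_ascFactorial (n + 1) K
    exact_mod_cast h2
  have hsum := Summable.of_norm_bounded hs.summable hb
  refine ⟨_, hsum.hasSum, ?_⟩
  have := tsum_of_norm_bounded hs hb
  rw [sub_sub_cancel, one_div] at this
  exact this

/-! ### Convolution quadratures of order `p` -/

/-- The sequence `ω` of Taylor coefficients of `g` is a convolution quadrature for the derivative
of order `α`: up to terms whose coefficients are `O(n^(-κ-1))` it is, at the point `1`,
`(1-X)^α` times a smooth factor, and it is consistent of order `p`. -/
structure IsQuad (ω : ℕ → ℝ) (g : ℝ → ℝ) (α κ : ℝ) (p : ℕ) : Prop where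
  hasSum : ∀ x : ℝ, |x| < 1 → HasSum (fun n => ω n * x ^ n) (g x)
  decomp : ∀ M : ℕ, ∃ η φ : ℝ⟦X⟧, Decay η (κ + 1) ∧ Decay φ M ∧
    PowerSeries.mk ω = (1 - PowerSeries.X) ^ M * η + bin 1 α * φ
  cons : (fun y : ℝ => g (1 - y) - (-Real.log (1 - y)) ^ α) =O[𝓝[>] 0]
    fun y : ℝ => y ^ (α + p)

theorem hasSum_one_sub_X_pow (M : ℕ) (x : ℝ) : HasSum (fun n => PowerSeries.coeff n
    ((1 - PowerSeries.X : ℝ⟦X⟧) ^ M) * x ^ n) ((1 - x) ^ M) := by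
  have h := hasSum_coe ((1 - Polynomial.X : ℝ[X]) ^ M) x
  rw [Polynomial.eval_pow, Polynomial.eval_sub, Polynomial.eval_one, Polynomial.eval_X,
    Polynomial.coe_pow, Polynomial.coe_sub, Polynomial.coe_one, Polynomial.coe_X] at h
  exact h

/-- Near `1`, `g(1-y) = y^α φ(1-y)` up to a high power of `y`, while consistency gives `g(1-y) = y^α
logQuot(y)^α + O(y^(α+p))`. Hence the first `p` coefficients of `φ` in powers of `1 - X` are the
Taylor coefficients of `logQuot^α`. -/
theorem IsQuad.exists_smooth {ω : ℕ → ℝ} {g : ℝ → ℝ} {α κ : ℝ} {p : ℕ} (h : IsQuad ω g α κ p)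
    (b : ℕ) : ∃ (M : ℕ) (η φ ψ : ℝ⟦X⟧), b ≤ M ∧ Decay η (κ + 1) ∧ Decay φ b ∧ Decay ψ b ∧
      PowerSeries.mk ω = (1 - PowerSeries.X) ^ M * η + bin 1 α * φ ∧
      φ = ∑ i ∈ Finset.range p, PowerSeries.C (logCoeff (-α) i) * (1 - PowerSeries.X) ^ i +
        (1 - PowerSeries.X) ^ p * ψ := by
  obtain ⟨K, hK⟩ := exists_nat_ge (-(κ + 1))
  obtain ⟨A, hA⟩ := exists_nat_ge (α + p)
  -- `K + 1` pays for the growth of `η` at `1`, `A` makes what remains `O(y^(α+p))`, `2p` is lost in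
  -- expanding `φ` to order `p`, and `b + 2` is left for `ψ`, the `2` making it summable.
  set M := K + 1 + A + 2 * p + b + 2 with hM
  obtain ⟨η, φ, hη, hφ, hω⟩ := h.decomp M
  have hMr : (M : ℝ) = K + 1 + A + 2 * p + b + 2 := by rw [hM]; push_cast; ring
  have nn : ∀ n : ℕ, (0 : ℝ) ≤ n := fun n => Nat.cast_nonneg n
  obtain ⟨c, ψ, hψ, hexp⟩ := exists_expansion_one p hφ (by
    rw [hMr]; linarith [nn K, nn A, nn b])
  have hψ' : Decay ψ ((b : ℝ) + 2) := hψ.mono (by rw [hMr]; linarith [nn K, nn A])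
  have hφ2 : Decay φ 2 := hφ.mono (by rw [hMr]; linarith [nn K, nn A, nn b, nn p])
  obtain ⟨Cη, hCη, hbη⟩ := norm_eval_le_of_decay hη hK
  set Cψ := ∑' n, ‖PowerSeries.coeff n ψ‖ with hCψ
  have hsψ := summable_of_decay hψ' (by linarith [nn b])
  have hmain : (fun y : ℝ => ∑ i ∈ Finset.range p, c i * y ^ i - logQuot y ^ α) =O[𝓝[>] 0]
      fun y => y ^ p := by
    obtain ⟨Cg, hCg⟩ := h.cons.bound
    refine IsBigO.of_bound (Cg + Cη + Cψ) ?_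
    have hlt : ∀ᶠ y : ℝ in 𝓝[>] 0, y < 1 := eventually_lt_one.filter_mono nhdsWithin_le_nhds
    filter_upwards [hCg, hlt, self_mem_nhdsWithin] with y h1 h2 h3
    have hy : 0 < y := h3
    have hx0 : 0 ≤ 1 - y := by linarith
    have hxabs : |1 - y| < 1 := by rw [abs_of_nonneg hx0]; linarith
    obtain ⟨vη, hvη, hvηb⟩ := hbη y hy h2
    have hsumψ : HasSum (fun n => PowerSeries.coeff n ψ * (1 - y) ^ n)
        (∑' n, PowerSeries.coeff n ψ * (1 - y) ^ n) ∧
        |∑' n, PowerSeries.coeff n ψ * (1 - y) ^ n| ≤ Cψ := by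
      have hb : ∀ n, ‖PowerSeries.coeff n ψ * (1 - y) ^ n‖ ≤ ‖PowerSeries.coeff n ψ‖ := fun n => by
        rw [norm_mul, norm_pow]
        exact mul_le_of_le_one_right (norm_nonneg _) (pow_le_one₀ (norm_nonneg _) hxabs.le)
      exact ⟨(Summable.of_norm_bounded hsψ hb).hasSum, tsum_of_norm_bounded hsψ.hasSum hb⟩
    set vψ := ∑' n, PowerSeries.coeff n ψ * (1 - y) ^ n with hvψ
    have hφv : HasSum (fun n => PowerSeries.coeff n φ * (1 - y) ^ n)
        (∑ i ∈ Finset.range p, c i * y ^ i + y ^ p * vψ) := by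
      have e1 := hasSum_coeff_mul (hasSum_one_sub_X_pow p (1 - y)) hsumψ.1
      have e2 : ∀ i ∈ Finset.range p, HasSum (fun n => PowerSeries.coeff n
          (PowerSeries.C (c i) * (1 - PowerSeries.X) ^ i) * (1 - y) ^ n) (c i * y ^ i) :=
        fun i _ => by
          have e3 := (hasSum_one_sub_X_pow i (1 - y)).mul_left (c i)
          rw [sub_sub_cancel] at e3
          refine HasSum.of_forall_eq e3 fun n => ?_
          rw [PowerSeries.coeff_C_mul]; ring
      have e4 := (hasSum_sum e2).add e1
      rw [sub_sub_cancel] at e4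
      refine HasSum.of_forall_eq e4 fun n => ?_
      rw [hexp, map_add, map_sum, add_mul, Finset.sum_mul]
    have hg := (h.hasSum (1 - y) hxabs).unique (HasSum.of_forall_eq
      ((hasSum_coeff_mul (hasSum_one_sub_X_pow M (1 - y)) hvη).add
        (hasSum_coeff_mul (hasSum_bin_real α hxabs) hφv)) fun n => by
          have := congrArg (PowerSeries.coeff n) hω
          rw [PowerSeries.coeff_mk, map_add] at this
          rw [this, add_mul])
    rw [sub_sub_cancel] at hg
    have hlog : (-Real.log (1 - y)) ^ α = y ^ α * logQuot y ^ α := by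
      rw [← mul_logQuot, Real.mul_rpow hy.le (logQuot_pos h2).le]
    have hyα : 0 < y ^ α := by positivity
    have hrew : y ^ α * (∑ i ∈ Finset.range p, c i * y ^ i - logQuot y ^ α) =
        (g (1 - y) - (-Real.log (1 - y)) ^ α) - y ^ M * vη - y ^ α * (y ^ p * vψ) := by
      rw [hlog, hg]; ring
    have hpow : y ^ (α + p) = y ^ α * y ^ p := by
      rw [Real.rpow_add hy, Real.rpow_natCast]
    have hη2 : |y ^ M * vη| ≤ Cη * (y ^ α * y ^ p) := by
      rw [abs_mul, abs_of_nonneg (by positivity : 0 ≤ y ^ M)]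
      calc y ^ M * |vη| ≤ y ^ M * (Cη * (y ^ (K + 1))⁻¹) := by gcongr
        _ = Cη * y ^ (A + 2 * p + b + 2) := by
            rw [hM, show K + 1 + A + 2 * p + b + 2 = (K + 1) + (A + 2 * p + b + 2) by ring, pow_add]
            field_simp
        _ ≤ Cη * (y ^ α * y ^ p) := by
            rw [← hpow, ← Real.rpow_natCast]
            refine mul_le_mul_of_nonneg_left ?_ hCη
            refine Real.rpow_le_rpow_of_exponent_ge hy h2.le ?_
            push_cast
            linarith [nn p, nn b]
    rw [Real.norm_eq_abs, Real.norm_eq_abs, hpow,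
      abs_of_nonneg (by positivity : 0 ≤ y ^ α * y ^ p)] at h1
    rw [Real.norm_eq_abs, Real.norm_eq_abs, abs_of_nonneg (by positivity : 0 ≤ y ^ p)]
    have h4 : |y ^ α * (y ^ p * vψ)| ≤ Cψ * (y ^ α * y ^ p) := by
      rw [← mul_assoc, abs_mul, abs_of_nonneg (by positivity : 0 ≤ y ^ α * y ^ p), mul_comm]
      exact mul_le_mul_of_nonneg_right hsumψ.2 (by positivity)
    have h5 : y ^ α * |∑ i ∈ Finset.range p, c i * y ^ i - logQuot y ^ α| ≤
        y ^ α * ((Cg + Cη + Cψ) * y ^ p) := by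
      calc _ = |y ^ α * (∑ i ∈ Finset.range p, c i * y ^ i - logQuot y ^ α)| := by
            rw [abs_mul, abs_of_pos hyα]
        _ ≤ _ := by
            rw [hrew]
            refine (abs_sub _ _).trans ?_
            have := abs_sub (g (1 - y) - (-Real.log (1 - y)) ^ α) (y ^ M * vη)
            linarith
    exact le_of_mul_le_mul_left h5 hyα
  have hc : ∀ i < p, c i - logCoeff (-α) i = 0 := by
    refine coeff_eq_zero_of_isBigO p (fun i => c i - logCoeff (-α) i) ?_
    have h2 := (taylor_isBigO (analyticAt_logQuot_rpow α) p).mono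
      (nhdsWithin_le_nhds (s := Set.Ioi (0 : ℝ)))
    refine (hmain.add h2).congr_left fun y => ?_
    simp only [sub_mul, Finset.sum_sub_distrib, logCoeff, neg_neg]
    ring
  refine ⟨M, η, φ, ψ, by omega, hη, hφ.mono (by rw [hMr]; linarith [nn K, nn A, nn p]),
    hψ'.mono (by linarith), hω, ?_⟩
  rw [hexp]
  congr 1
  exact Finset.sum_congr rfl fun i hi => by
    rw [sub_eq_zero.1 (hc i (Finset.mem_range.1 hi))]

/-- Splits a product of truncated expansions into the complete coefficients of total order below `p`
and the terms of order at least `p`. -/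
theorem sum_sum_eq_antidiagonal {M : Type*} [AddCommMonoid M] {p N : ℕ} (hN : p ≤ N)
    (f : ℕ → ℕ → M) :
    ∑ l ∈ Finset.range N, ∑ i ∈ Finset.range p, f l i =
      ∑ m ∈ Finset.range p, ∑ ij ∈ Finset.HasAntidiagonal.antidiagonal m, f ij.1 ij.2 +
      ∑ li ∈ (Finset.range N ×ˢ Finset.range p).filter (fun li => ¬ li.1 + li.2 < p),
        f li.1 li.2 := by
  rw [← Finset.sum_product', ← Finset.sum_filter_add_sum_filter_not _ (fun li => li.1 + li.2 < p)]
  congr 1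
  rw [← Finset.sum_fiberwise_of_maps_to (t := Finset.range p) (g := fun li => li.1 + li.2)]
  · refine Finset.sum_congr rfl fun m hm => Finset.sum_congr ?_ fun _ _ => rfl
    ext ⟨l, i⟩
    simp only [Finset.mem_filter, Finset.mem_product, Finset.mem_range,
      Finset.HasAntidiagonal.mem_antidiagonal] at hm ⊢
    omega
  · intro li hli
    simpa using (Finset.mem_filter.1 hli).2

/-- Multiply the expansions at `1`. By `logCoeff_add` the orders below `p` reproduce those of
`powSeries (s - α)`, and everything of order at least `p` goes into `f₁`. The remainder of the
expansion of `powSeries s`, multiplied by `(1-X)^α φ`, decays only like `(1-X)^α` and is `f₂`. In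
`f₃` the factor `(1-X)^M` removes the singularity of `powSeries s` at `1`, so the decay of `η`
survives. -/
theorem IsQuad.mul_powSeries {ω : ℕ → ℝ} {g : ℝ → ℝ} {α κ : ℝ} {p : ℕ} (h : IsQuad ω g α κ p)
    (s : ℝ) : ∃ f₁ f₂ f₃ : ℝ⟦X⟧, Decay f₁ (p + 1 + α - s) ∧ Decay f₂ (α + 1) ∧ Decay f₃ (κ + 1) ∧
      PowerSeries.mk ω * powSeries s - powSeries (s - α) = f₁ + f₂ + f₃ := by
  obtain ⟨b, hb⟩ := exists_nat_ge (|s| + |κ| + |α| + p + 10)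
  obtain ⟨M, η, φ, ψ, hbM, hη, hφ, hψ, hω, hexp⟩ := h.exists_smooth b
  have nn : ∀ n : ℕ, (0 : ℝ) ≤ n := fun n => Nat.cast_nonneg n
  have hbM' : (b : ℝ) ≤ M := by exact_mod_cast hbM
  have as := abs_nonneg s
  have aκ := abs_nonneg κ
  have aα := abs_nonneg α
  have ls := le_abs_self s
  have ls' := neg_abs_le s
  have lα := le_abs_self α
  have lα' := neg_abs_le α
  have hpb : p ≤ b := by
    have : (p : ℝ) ≤ b := by linarith
    exact_mod_cast this
  have hK : powSeries s = ∑ l ∈ Finset.range b, PowerSeries.C (logCoeff s l) * bin 1 ((l : ℝ) - s)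
      + powRem s b := by rw [powRem]; ring
  have hrem := decay_powRem s b
  have hbin : ∀ a : ℝ, Decay (bin (1 : ℝ) a) (a + 1) := fun a => decay_bin (by simp) a
  have hκ1 : |κ + 1| ≤ |κ| + 1 := (abs_add_le _ _).trans (by simp)
  have hα1 : |α + 1| ≤ |α| + 1 := (abs_add_le _ _).trans (by simp)
  -- the factor with the singularities different from `1`
  have d3 : Decay ((1 - PowerSeries.X) ^ M * η * powSeries s) (κ + 1) := by
    have e1 : Decay ((1 - PowerSeries.X) ^ M * powSeries s) (|κ + 1| + 2) := by
      rw [hK, mul_add, Finset.mul_sum]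
      refine Decay.add (decay_sum _ fun l _ => ?_) ?_
      · rw [mul_left_comm, ← bin_one_natCast, ← bin_add]
        exact Decay.const_mul _ ((hbin _).mono (by linarith [nn l]))
      · rw [mul_comm, ← bin_one_natCast]
        exact (hrem.mono (by linarith)).mul (rapid_bin_natCast M _) le_rfl
    rw [mul_comm ((1 - PowerSeries.X) ^ M) η, mul_assoc]
    exact hη.mul e1 le_rfl
  have d2 : Decay (bin 1 α * φ * powRem s b) (α + 1) := by
    rw [mul_assoc]
    have e1 : Decay (powRem s b * φ) (|α + 1| + 2) := by
      refine (hrem.mono (by linarith)).mul hφ ?_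
      rw [abs_of_nonneg (by positivity)]
      linarith
    rw [mul_comm φ]
    exact (hbin α).mul e1 le_rfl
  have hbφ : ∀ l : ℕ, bin 1 α * φ * (PowerSeries.C (logCoeff s l) * bin 1 ((l : ℝ) - s)) =
      ∑ i ∈ Finset.range p, PowerSeries.C (logCoeff s l * logCoeff (-α) i) *
        bin 1 (((l + i : ℕ) : ℝ) - (s - α)) +
      PowerSeries.C (logCoeff s l) * (bin 1 ((l : ℝ) + p - (s - α)) * ψ) := fun l => by
    have e1 : ∀ i : ℕ, bin (1 : ℝ) (((l + i : ℕ) : ℝ) - (s - α)) =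
        bin 1 α * bin 1 ((l : ℝ) - s) * (1 - PowerSeries.X) ^ i := fun i => by
      rw [← bin_one_natCast, ← bin_add, ← bin_add]
      congr 1
      push_cast; ring
    have e2 : bin (1 : ℝ) ((l : ℝ) + p - (s - α)) =
        bin 1 α * bin 1 ((l : ℝ) - s) * (1 - PowerSeries.X) ^ p := by
      rw [← e1]; push_cast; rfl
    rw [e2]
    simp only [e1]
    rw [hexp, mul_add, add_mul, Finset.mul_sum, Finset.sum_mul]
    congr 1
    · exact Finset.sum_congr rfl fun i _ => by rw [map_mul]; ring
    · ring
  -- The terms of total order at least `p` in the product of the two expansions.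
  set R : ℝ⟦X⟧ := ∑ li ∈ (Finset.range b ×ˢ Finset.range p).filter (fun li => ¬ li.1 + li.2 < p),
    PowerSeries.C (logCoeff s li.1 * logCoeff (-α) li.2) *
      bin 1 (((li.1 + li.2 : ℕ) : ℝ) - (s - α)) with hR
  have dR : Decay R (p + 1 + α - s) := by
    refine decay_sum _ fun li hli => Decay.const_mul _ ((hbin _).mono ?_)
    have h1 := (Finset.mem_filter.1 hli).2
    have h2 : (p : ℝ) ≤ ((li.1 + li.2 : ℕ) : ℝ) := by exact_mod_cast not_lt.1 h1
    linarith
  set Q : ℝ⟦X⟧ := ∑ l ∈ Finset.range b,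
    PowerSeries.C (logCoeff s l) * (bin 1 ((l : ℝ) + p - (s - α)) * ψ) with hQ
  have dQ : Decay Q (p + 1 + α - s) := by
    refine decay_sum _ fun l _ => Decay.const_mul _ ?_
    refine ((hbin _).mono (by linarith [nn l])).mul hψ ?_
    have : |(p : ℝ) + 1 + α - s| ≤ p + 1 + |α| + |s| := by
      rw [abs_le]; constructor <;> linarith [nn p]
    linarith
  have hmain : bin 1 α * φ * (∑ l ∈ Finset.range b,
      PowerSeries.C (logCoeff s l) * bin 1 ((l : ℝ) - s)) =
      (powSeries (s - α) - powRem (s - α) p) + R + Q := by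
    rw [Finset.mul_sum, Finset.sum_congr rfl fun l _ => hbφ l, Finset.sum_add_distrib,
      sum_sum_eq_antidiagonal hpb (fun l i => PowerSeries.C (logCoeff s l * logCoeff (-α) i) *
        bin 1 (((l + i : ℕ) : ℝ) - (s - α)))]
    congr 2
    rw [powRem, sub_sub_cancel]
    refine Finset.sum_congr rfl fun m _ => ?_
    rw [sub_eq_add_neg s α, ← logCoeff_add, map_sum, Finset.sum_mul]
    refine Finset.sum_congr rfl fun ij hij => ?_
    rw [Finset.HasAntidiagonal.mem_antidiagonal.1 hij]
  have dT : Decay (powRem (s - α) p) (p + 1 + α - s) :=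
    (decay_powRem (s - α) p).mono (by linarith)
  refine ⟨R + Q - powRem (s - α) p, bin 1 α * φ * powRem s b,
    (1 - PowerSeries.X) ^ M * η * powSeries s, (dR.add dQ).sub dT, d2, d3, ?_⟩
  have : bin 1 α * φ * powSeries s = (powSeries (s - α) - powRem (s - α) p) + R + Q +
      bin 1 α * φ * powRem s b := by
    rw [← hmain, ← mul_add, ← hK]
  rw [hω, add_mul, this]
  ring

/-- The error at `n` of the quadrature with step size `1` applied to `t^β`. -/
def quadErr (ω : ℕ → ℝ) (α β : ℝ) (n : ℕ) : ℝ :=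
  Real.Gamma (β + 1) / Real.Gamma (β + 1 - α) * (n : ℝ) ^ (β - α) -
    ∑ k ∈ Finset.range (n + 1), ω (n - k) * (k : ℝ) ^ β

theorem add_one_rpow_le (a : ℝ) : ∃ C : ℝ, 0 ≤ C ∧ ∀ n : ℕ, 1 ≤ n →
    ((n : ℝ) + 1) ^ a ≤ C * (n : ℝ) ^ a := by
  refine ⟨2 ^ |a|, by positivity, fun n hn => ?_⟩
  have hn' : (1 : ℝ) ≤ n := by exact_mod_cast hn
  rcases le_total 0 a with h | h
  · rw [abs_of_nonneg h, ← Real.mul_rpow (by norm_num) (by positivity)]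
    exact Real.rpow_le_rpow (by positivity) (by linarith) h
  · calc ((n : ℝ) + 1) ^ a ≤ (n : ℝ) ^ a :=
          Real.rpow_le_rpow_of_nonpos (by positivity) (by linarith) h
      _ ≤ _ := le_mul_of_one_le_left (by positivity)
          (Real.one_le_rpow (by norm_num) (abs_nonneg a))

theorem Decay.exists_bound {f : ℝ⟦X⟧} {a : ℝ} (h : Decay f a) : ∃ C : ℝ, 0 ≤ C ∧ ∀ n : ℕ, 1 ≤ n →
    |PowerSeries.coeff n f| ≤ C * (n : ℝ) ^ (-a) := by
  obtain ⟨C, hC, h⟩ := h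
  obtain ⟨D, hD, h2⟩ := add_one_rpow_le (-a)
  refine ⟨C * D, by positivity, fun n hn => (h n).trans ?_⟩
  rw [mul_assoc]
  exact mul_le_mul_of_nonneg_left (h2 n hn) hC

/-- The coefficients of `IsQuad.mul_powSeries` for `s = β + 1`. The constant depends on `β` in an
uncontrolled way, so this serves only finitely many powers. -/
theorem IsQuad.quadErr_le {ω : ℕ → ℝ} {g : ℝ → ℝ} {α κ : ℝ} {p : ℕ} (h : IsQuad ω g α κ p)
    {β : ℝ} (hβ : 0 ≤ β) : ∃ C : ℝ, 0 ≤ C ∧ ∀ n : ℕ, 1 ≤ n → |quadErr ω α β n| ≤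
      C * ((n : ℝ) ^ (β - α - p) + (n : ℝ) ^ (-α - 1) + (n : ℝ) ^ (-κ - 1)) := by
  obtain ⟨f₁, f₂, f₃, h1, h2, h3, he⟩ := h.mul_powSeries (β + 1)
  obtain ⟨C₁, hC₁, h1⟩ := h1.exists_bound
  obtain ⟨C₂, hC₂, h2⟩ := h2.exists_bound
  obtain ⟨C₃, hC₃, h3⟩ := h3.exists_bound
  have hG : 0 < Real.Gamma (β + 1) := Real.Gamma_pos_of_pos (by linarith)
  refine ⟨Real.Gamma (β + 1) * (C₁ + C₂ + C₃), by positivity, fun n hn => ?_⟩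
  have e : quadErr ω α β n =
      -(Real.Gamma (β + 1) * PowerSeries.coeff n (f₁ + f₂ + f₃)) := by
    rw [← he, map_sub, PowerSeries.coeff_mul, ← Finset.Nat.sum_antidiagonal_swap,
      Finset.Nat.sum_antidiagonal_eq_sum_range_succ_mk, powSeries, powSeries, PowerSeries.coeff_mk,
      quadErr, mul_sub, Finset.mul_sum, neg_sub]
    congr 1
    · rw [show β + 1 - α - 1 = β - α by ring]; ring
    · refine Finset.sum_congr rfl fun k _ => ?_
      simp only [Prod.fst_swap, Prod.snd_swap, PowerSeries.coeff_mk, add_sub_cancel_right]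
      field_simp
  have e1 : |PowerSeries.coeff n (f₁ + f₂ + f₃)| ≤ C₁ * (n : ℝ) ^ (β - α - p) +
      C₂ * (n : ℝ) ^ (-α - 1) + C₃ * (n : ℝ) ^ (-κ - 1) := by
    rw [map_add, map_add]
    refine (abs_add_three _ _ _).trans ?_
    have a1 := h1 n hn
    have a2 := h2 n hn
    have a3 := h3 n hn
    rw [show -((p : ℝ) + 1 + α - (β + 1)) = β - α - p by ring] at a1
    rw [show -(α + 1) = -α - 1 by ring] at a2
    rw [show -(κ + 1) = -κ - 1 by ring] at a3
    linarith
  rw [e, abs_neg, abs_mul, abs_of_pos hG, mul_assoc]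
  refine mul_le_mul_of_nonneg_left (e1.trans ?_) hG.le
  have b1 : (0 : ℝ) ≤ (n : ℝ) ^ (β - α - p) := by positivity
  have b2 : (0 : ℝ) ≤ (n : ℝ) ^ (-α - 1) := by positivity
  have b3 : (0 : ℝ) ≤ (n : ℝ) ^ (-κ - 1) := by positivity
  nlinarith [mul_nonneg hC₁ b2, mul_nonneg hC₁ b3, mul_nonneg hC₂ b1, mul_nonneg hC₂ b3,
    mul_nonneg hC₃ b1, mul_nonneg hC₃ b2]

/-! ### The quadrature error of large powers -/

theorem exists_abs_le_mul_pow {f : ℝ → ℝ} (hf : ContinuousOn f (Set.Icc 0 1)) {m : ℕ}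
    (h : f =O[𝓝 0] fun x => x ^ m) : ∃ C : ℝ, 0 ≤ C ∧ ∀ x ∈ Set.Icc (0 : ℝ) 1, |f x| ≤ C * x ^ m := by
  obtain ⟨c, hc, hcb⟩ := h.exists_nonneg
  obtain ⟨r, hr, hball⟩ := Metric.eventually_nhds_iff.1 hcb.bound
  obtain ⟨B, hB⟩ := isCompact_Icc.exists_bound_of_continuousOn hf
  have hB0 : 0 ≤ B := (norm_nonneg _).trans (hB 0 (by simp))
  refine ⟨c + B * (r ^ m)⁻¹, by positivity, fun x hx => ?_⟩
  rcases lt_or_ge x r with h | h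
  · have := hball (y := x) (by simpa [abs_of_nonneg hx.1] using h)
    rw [Real.norm_eq_abs, norm_pow, Real.norm_of_nonneg hx.1] at this
    refine this.trans (mul_le_mul_of_nonneg_right ?_ (pow_nonneg hx.1 m))
    have : 0 ≤ B * (r ^ m)⁻¹ := by positivity
    linarith
  · have h1 : 1 ≤ (r ^ m)⁻¹ * x ^ m := by
      rw [inv_mul_eq_div, one_le_div (by positivity)]
      exact pow_le_pow_left₀ hr.le h m
    calc |f x| ≤ B := hB x hx
      _ ≤ B * ((r ^ m)⁻¹ * x ^ m) := le_mul_of_one_le_right hB0 h1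
      _ = (B * (r ^ m)⁻¹) * x ^ m := by ring
      _ ≤ _ := mul_le_mul_of_nonneg_right (by linarith) (pow_nonneg hx.1 m)

theorem one_add_rpow_taylor (a : ℝ) (m : ℕ) : ∃ C : ℝ, 0 ≤ C ∧ ∀ x ∈ Set.Icc (0 : ℝ) 1,
    |(1 + x) ^ a - ∑ j ∈ Finset.range m, Ring.choose a j * x ^ j| ≤ C * x ^ m := by
  refine exists_abs_le_mul_pow ?_ ?_
  · refine ContinuousOn.sub ?_ (by fun_prop)
    exact ContinuousOn.rpow_const (by fun_prop) fun x hx => Or.inl (by linarith [hx.1])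
  · have h := (Real.one_add_rpow_hasFPowerSeriesAt_zero (a := a)).isBigO_sub_partialSum_pow m
    refine (IsBigO.congr' h (Eventually.of_forall fun y => ?_)
      (Eventually.of_forall fun y => rfl)).trans
      (IsBigO.of_bound 1 (Eventually.of_forall fun y => by simp))
    simp [FormalMultilinearSeries.partialSum, binomialSeries, mul_comm]

theorem Gamma_inv_mul_prod (x : ℝ) (j : ℕ) :
    (Real.Gamma (x + 1))⁻¹ * ∏ m ∈ Finset.range j, (x - m) = (Real.Gamma (x + 1 - j))⁻¹ := by
  induction j with
  | zero => simp
  | succ j ih =>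
    rw [Finset.prod_range_succ, ← mul_assoc, ih, one_div_Gamma (x + 1 - ((j + 1 : ℕ) : ℝ))]
    push_cast
    rw [show x + 1 - (j + 1) + 1 = x + 1 - (j : ℝ) by ring]
    ring

/-- Identifies the term of degree `q - i` in the Taylor expansion of the exact derivative of
`(t+θ)^q` with the exact derivative of the `i`-th term of the binomial expansion. -/
theorem factorial_div_Gamma_mul_choose (α : ℝ) {q i : ℕ} (hi : i ≤ q) :
    (q.factorial : ℝ) / Real.Gamma (q + 1 - α) * Ring.choose ((q : ℝ) - α) (q - i) =
      q.choose i * (Real.Gamma (i + 1) / Real.Gamma (i + 1 - α)) := by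
  rw [choose_eq_prod_div, Real.Gamma_nat_eq_factorial]
  have h := Gamma_inv_mul_prod ((q : ℝ) - α) (q - i)
  rw [Nat.cast_sub hi, show (q : ℝ) - α + 1 = q + 1 - α by ring,
    show (q : ℝ) + 1 - α - (q - i) = i + 1 - α by ring] at h
  have hc : (q.choose i : ℝ) * i.factorial * (q - i).factorial = q.factorial := by
    exact_mod_cast Nat.choose_mul_factorial_mul_factorial hi
  have h2 : ((q - i).factorial : ℝ) ≠ 0 := by exact_mod_cast (q - i).factorial_ne_zero
  calc _ = (q.factorial : ℝ) / (q - i).factorial *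
        ((Real.Gamma (q + 1 - α))⁻¹ * ∏ j ∈ Finset.range (q - i), ((q : ℝ) - α - j)) := by
        rw [div_eq_mul_inv, div_eq_mul_inv, div_eq_mul_inv]; ring
    _ = _ := by
        rw [h, ← hc, mul_div_assoc, div_self h2]
        ring

/-- The error of the quadrature for the truncated power `(t+θ)^q`. -/
def truncErr (ω : ℕ → ℝ) (α : ℝ) (q : ℕ) (N : ℕ) (θ : ℝ) : ℝ :=
  (q.factorial : ℝ) / Real.Gamma (q + 1 - α) * ((N : ℝ) + θ) ^ ((q : ℝ) - α) -
    ∑ j ∈ Finset.range (N + 1), ω (N - j) * ((j : ℝ) + θ) ^ q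

/-- Expand `(j+θ)^q` by the binomial theorem and `(N+θ)^(q-α)` by Taylor's formula in `θ/N`. The two
match term by term into errors for the integer powers `t^i`, leaving the Taylor remainder. -/
theorem truncErr_eq (ω : ℕ → ℝ) (α : ℝ) (q : ℕ) {N : ℕ} (hN : 1 ≤ N) {θ : ℝ} (hθ : 0 ≤ θ) :
    truncErr ω α q N θ = (q.factorial : ℝ) / Real.Gamma (q + 1 - α) * (N : ℝ) ^ ((q : ℝ) - α) *
      ((1 + θ / N) ^ ((q : ℝ) - α) -
        ∑ j ∈ Finset.range (q + 1), Ring.choose ((q : ℝ) - α) j * (θ / N) ^ j) +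
      ∑ i ∈ Finset.range (q + 1), q.choose i * θ ^ (q - i) * quadErr ω α i N := by
  have hN' : (0 : ℝ) < N := by exact_mod_cast hN
  have e1 : ((N : ℝ) + θ) ^ ((q : ℝ) - α) =
      (N : ℝ) ^ ((q : ℝ) - α) * (1 + θ / N) ^ ((q : ℝ) - α) := by
    rw [← Real.mul_rpow hN'.le (by positivity)]
    congr 1; field_simp
  have e2 : ∑ j ∈ Finset.range (N + 1), ω (N - j) * ((j : ℝ) + θ) ^ q =
      ∑ i ∈ Finset.range (q + 1), q.choose i * θ ^ (q - i) *
        ∑ j ∈ Finset.range (N + 1), ω (N - j) * (j : ℝ) ^ (i : ℝ) := by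
    simp only [Finset.mul_sum]
    rw [Finset.sum_comm]
    refine Finset.sum_congr rfl fun j _ => ?_
    rw [add_pow, Finset.mul_sum]
    refine Finset.sum_congr rfl fun i _ => ?_
    rw [Real.rpow_natCast]; ring
  have e3 : (q.factorial : ℝ) / Real.Gamma (q + 1 - α) * (N : ℝ) ^ ((q : ℝ) - α) *
      ∑ j ∈ Finset.range (q + 1), Ring.choose ((q : ℝ) - α) j * (θ / N) ^ j =
      ∑ i ∈ Finset.range (q + 1), q.choose i * θ ^ (q - i) *
        (Real.Gamma (i + 1) / Real.Gamma (i + 1 - α) * (N : ℝ) ^ ((i : ℝ) - α)) := by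
    rw [← Finset.sum_range_reflect, Finset.mul_sum]
    refine Finset.sum_congr rfl fun i hi => ?_
    have hi' : i ≤ q := by have := Finset.mem_range.1 hi; omega
    rw [show q + 1 - 1 - i = q - i by omega]
    have h := factorial_div_Gamma_mul_choose α hi'
    have h2 : (N : ℝ) ^ ((q : ℝ) - α) * (θ / N) ^ (q - i) =
        θ ^ (q - i) * (N : ℝ) ^ ((i : ℝ) - α) := by
      rw [div_pow, ← Real.rpow_natCast (N : ℝ) (q - i), Nat.cast_sub hi',
        show (i : ℝ) - α = (q - α) - (q - i) by ring, Real.rpow_sub hN' ((q : ℝ) - α)]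
      ring
    calc _ = ((q.factorial : ℝ) / Real.Gamma (q + 1 - α) * Ring.choose ((q : ℝ) - α) (q - i)) *
          ((N : ℝ) ^ ((q : ℝ) - α) * (θ / N) ^ (q - i)) := by ring
      _ = _ := by rw [h, h2]; ring
  rw [truncErr, e1, e2, mul_sub, e3]
  simp only [quadErr, mul_sub, Finset.sum_sub_distrib]
  ring

/-- The Taylor remainder is `O(N^(-α-1))` and the powers `t^i`, `i ≤ q`, are handled by
`IsQuad.quadErr_le`. The conditions on `q` make `q - α - p` the largest exponent present and
nonnegative, so the bound is increasing in `N`; `N = 0` is estimated directly. -/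
theorem IsQuad.truncErr_le {ω : ℕ → ℝ} {g : ℝ → ℝ} {α κ : ℝ} {p : ℕ} (h : IsQuad ω g α κ p)
    {q : ℕ} (hq0 : α + p ≤ q) (hqp : p ≤ q) (hqκ : α + p - κ - 1 ≤ q) :
    ∃ C : ℝ, 0 ≤ C ∧ ∀ N : ℕ, ∀ θ ∈ Set.Icc (0 : ℝ) 1,
      |truncErr ω α q N θ| ≤ C * ((N : ℝ) + 1) ^ ((q : ℝ) - α - p) := by
  obtain ⟨Ct, hCt, ht⟩ := one_add_rpow_taylor ((q : ℝ) - α) (q + 1)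
  choose Ce hCe he using fun i : ℕ => h.quadErr_le (β := i) (Nat.cast_nonneg i)
  have hp : (0 : ℝ) ≤ p := Nat.cast_nonneg p
  have hqp' : (p : ℝ) ≤ q := by exact_mod_cast hqp
  set A := |(q.factorial : ℝ) / Real.Gamma (q + 1 - α)| with hA
  refine ⟨(A + |ω 0|) + (A * Ct + ∑ i ∈ Finset.range (q + 1), q.choose i * (Ce i * 3)), ?_,
    fun N θ hθ => ?_⟩
  · have : 0 ≤ ∑ i ∈ Finset.range (q + 1), q.choose i * (Ce i * 3) :=
      Finset.sum_nonneg fun i _ => by have := hCe i; positivity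
    positivity
  have hS : 0 ≤ ∑ i ∈ Finset.range (q + 1), q.choose i * (Ce i * 3) :=
      Finset.sum_nonneg fun i _ => by have := hCe i; positivity
  have hA0 : 0 ≤ A := abs_nonneg _
  rcases Nat.eq_zero_or_pos N with h0 | h0
  · subst h0
    rw [truncErr]
    simp only [Nat.cast_zero, zero_add, Finset.range_one, Finset.sum_singleton, Nat.sub_zero,
      Real.one_rpow, mul_one]
    have e1 : θ ^ ((q : ℝ) - α) ≤ 1 := Real.rpow_le_one hθ.1 hθ.2 (by linarith)
    have e2 : θ ^ q ≤ 1 := pow_le_one₀ hθ.1 hθ.2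
    have e3 : 0 ≤ θ ^ ((q : ℝ) - α) := Real.rpow_nonneg hθ.1 _
    have e4 : 0 ≤ θ ^ q := pow_nonneg hθ.1 _
    refine (abs_sub _ _).trans ?_
    rw [abs_mul, abs_mul, abs_of_nonneg e3, abs_of_nonneg e4]
    have i1 : A * θ ^ ((q : ℝ) - α) ≤ A := mul_le_of_le_one_right hA0 e1
    have i2 : |ω 0| * θ ^ q ≤ |ω 0| := mul_le_of_le_one_right (abs_nonneg _) e2
    have i3 : 0 ≤ A * Ct := by positivity
    linarith
  · have hN' : (1 : ℝ) ≤ N := by exact_mod_cast h0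
    have hNp : (0 : ℝ) < N := by linarith
    set P := (N : ℝ) ^ ((q : ℝ) - α - p) with hP
    have hP0 : 0 ≤ P := by positivity
    have hmono : ∀ b : ℝ, b ≤ (q : ℝ) - α - p → (N : ℝ) ^ b ≤ P := fun b hb =>
      Real.rpow_le_rpow_of_exponent_le hN' hb
    have hPle : P ≤ ((N : ℝ) + 1) ^ ((q : ℝ) - α - p) :=
      Real.rpow_le_rpow hNp.le (by linarith) (by linarith)
    have hx : θ / N ∈ Set.Icc (0 : ℝ) 1 :=
      ⟨div_nonneg hθ.1 hNp.le, (div_le_one hNp).2 (hθ.2.trans hN')⟩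
    have b1 : |(q.factorial : ℝ) / Real.Gamma (q + 1 - α) * (N : ℝ) ^ ((q : ℝ) - α) *
      ((1 + θ / N) ^ ((q : ℝ) - α) -
        ∑ j ∈ Finset.range (q + 1), Ring.choose ((q : ℝ) - α) j * (θ / N) ^ j)| ≤ A * Ct * P := by
      rw [abs_mul, abs_mul, abs_of_nonneg (by positivity : 0 ≤ (N : ℝ) ^ ((q : ℝ) - α))]
      have e1 := ht _ hx
      have e2 : (N : ℝ) ^ ((q : ℝ) - α) * (θ / N) ^ (q + 1) ≤ P := by
        calc (N : ℝ) ^ ((q : ℝ) - α) * (θ / N) ^ (q + 1)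
            ≤ (N : ℝ) ^ ((q : ℝ) - α) * (1 / N) ^ (q + 1) := by
              have := hθ.1
              gcongr
              exact hθ.2
          _ = (N : ℝ) ^ (-α - 1) := by
              rw [one_div, inv_pow, ← Real.rpow_natCast (N : ℝ) (q + 1), ← Real.rpow_neg hNp.le,
                ← Real.rpow_add hNp]
              congr 1; push_cast; ring
          _ ≤ P := hmono _ (by linarith)
      calc _ ≤ A * (N : ℝ) ^ ((q : ℝ) - α) * (Ct * (θ / N) ^ (q + 1)) := by gcongr
        _ = A * Ct * ((N : ℝ) ^ ((q : ℝ) - α) * (θ / N) ^ (q + 1)) := by ring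
        _ ≤ _ := by gcongr
    have b2 : |∑ i ∈ Finset.range (q + 1), q.choose i * θ ^ (q - i) * quadErr ω α i N| ≤
        (∑ i ∈ Finset.range (q + 1), q.choose i * (Ce i * 3)) * P := by
      rw [Finset.sum_mul]
      refine (Finset.abs_sum_le_sum_abs _ _).trans (Finset.sum_le_sum fun i hi => ?_)
      have hi' : (i : ℝ) ≤ q := by
        have := Finset.mem_range.1 hi
        exact_mod_cast Nat.lt_succ_iff.1 this
      rw [abs_mul, abs_mul, abs_of_nonneg (pow_nonneg hθ.1 _), Nat.abs_cast]
      have f1 := he i N h0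
      have f2 := hmono ((i : ℝ) - α - p) (by linarith)
      have f3 := hmono (-α - 1) (by linarith)
      have f4 := hmono (-κ - 1) (by linarith)
      have f5 : |quadErr ω α i N| ≤ Ce i * 3 * P := f1.trans (by
        rw [mul_assoc]; exact mul_le_mul_of_nonneg_left (by linarith) (hCe i))
      have f6 : θ ^ (q - i) ≤ 1 := pow_le_one₀ hθ.1 hθ.2
      calc (q.choose i : ℝ) * θ ^ (q - i) * |quadErr ω α i N|
          ≤ (q.choose i : ℝ) * 1 * (Ce i * 3 * P) := by gcongr
        _ = _ := by ring
    rw [truncErr_eq ω α q h0 hθ.1]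
    refine (abs_add_le _ _).trans ((add_le_add b1 b2).trans ?_)
    rw [← add_mul]
    have hcoef : 0 ≤ A * Ct + ∑ i ∈ Finset.range (q + 1), q.choose i * (Ce i * 3) := by positivity
    refine (mul_le_mul_of_nonneg_left hPle hcoef).trans ?_
    refine mul_le_mul_of_nonneg_right ?_ (by positivity)
    have := abs_nonneg (ω 0)
    linarith

/-- The truncated power vanishes at the nodes below `⌈y⌉`. Shifting by `⌈y⌉` leaves `N = n - ⌈y⌉`
and `θ = ⌈y⌉ - y`; `y > 0` gives `N + 1 ≤ n`. -/
theorem kernel_eq_truncErr (ω : ℕ → ℝ) (α : ℝ) {q n : ℕ} (hq : q ≠ 0) {y : ℝ} (hy : 0 < y)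
    (hyn : y ≤ n) : ∃ N : ℕ, N + 1 ≤ n ∧ ∃ θ ∈ Set.Icc (0 : ℝ) 1,
    (q.factorial : ℝ) / Real.Gamma (q + 1 - α) * ((n : ℝ) - y) ^ ((q : ℝ) - α) -
      ∑ k ∈ Finset.range (n + 1), ω (n - k) * (max ((k : ℝ) - y) 0) ^ q = truncErr ω α q N θ := by
  have hm1 : 0 < ⌈y⌉₊ := Nat.ceil_pos.2 hy
  have hmn : ⌈y⌉₊ ≤ n := Nat.ceil_le.2 hyn
  have hm2 := Nat.le_ceil y
  have hm3 := Nat.ceil_lt_add_one hy.le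
  set m := ⌈y⌉₊ with hm
  obtain ⟨N, rfl⟩ := Nat.exists_eq_add_of_le hmn
  refine ⟨N, by omega, m - y, ⟨by linarith, by linarith⟩, ?_⟩
  rw [truncErr, show m + N + 1 = m + (N + 1) by ring, Finset.sum_range_add]
  have z : ∑ k ∈ Finset.range m, ω (m + N - k) * (max ((k : ℝ) - y) 0) ^ q = 0 := by
    refine Finset.sum_eq_zero fun k hk => ?_
    have : (k : ℝ) < y := Nat.lt_ceil.1 (Finset.mem_range.1 hk)
    rw [max_eq_right (by linarith), zero_pow hq, mul_zero]
  rw [z, zero_add]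
  congr 1
  · rw [show ((m + N : ℕ) : ℝ) - y = N + (m - y) by push_cast; ring]
  · refine Finset.sum_congr rfl fun j _ => ?_
    rw [show m + N - (m + j) = N - j by omega, max_eq_left]
    · congr 2; push_cast; ring
    · push_cast; linarith [(Nat.cast_nonneg j : (0 : ℝ) ≤ j)]

/-- A Beta integral, writing `k^β` as a superposition of truncated powers of the fixed degree `q`.
The upper limit is `n` for all `k ≤ n`, so that the nodes share one integral. -/
theorem integral_max_pow_mul_rpow {q k n : ℕ} (hkn : k ≤ n) {β : ℝ} (hβ : (q : ℝ) < β) (hq : q ≠ 0) :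
    IntervalIntegrable (fun y : ℝ => (max ((k : ℝ) - y) 0) ^ q * y ^ (β - q - 1)) volume 0 n ∧
    ∫ y in (0 : ℝ)..n, (max ((k : ℝ) - y) 0) ^ q * y ^ (β - q - 1) =
      (k : ℝ) ^ β * (q.factorial * Real.Gamma (β - q) / Real.Gamma (β + 1)) := by
  have hint : ∀ a b : ℝ, IntervalIntegrable
      (fun y : ℝ => (max ((k : ℝ) - y) 0) ^ q * y ^ (β - q - 1)) volume a b := fun a b =>
    (intervalIntegral.intervalIntegrable_rpow' (by linarith)).continuousOn_mul
      (Continuous.continuousOn (by fun_prop))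
  refine ⟨hint _ _, ?_⟩
  have hq0 : (0 : ℝ) ≤ q := Nat.cast_nonneg q
  rw [← intervalIntegral.integral_add_adjacent_intervals (hint 0 k) (hint k n)]
  have z : ∫ y in (k : ℝ)..n, (max ((k : ℝ) - y) 0) ^ q * y ^ (β - q - 1) = 0 := by
    have hz : Set.EqOn (fun y : ℝ => (max ((k : ℝ) - y) 0) ^ q * y ^ (β - q - 1))
        (fun _ => (0 : ℝ)) (Set.uIcc (k : ℝ) n) := by
      intro y hy
      rw [Set.uIcc_of_le (by exact_mod_cast hkn)] at hy
      simp only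
      rw [max_eq_right (by linarith [hy.1]), zero_pow hq, zero_mul]
    rw [intervalIntegral.integral_congr hz]
    simp
  rw [z, add_zero]
  rcases Nat.eq_zero_or_pos k with h | h
  · subst h
    have : β ≠ 0 := by linarith
    simp [Real.zero_rpow this]
  · have hb := integral_beta (a := (q : ℝ) + 1) (b := β - q) (t := k) (by positivity)
      (by linarith) (by exact_mod_cast h)
    rw [show (q : ℝ) + 1 + (β - q) - 1 = β by ring, show (q : ℝ) + 1 + (β - q) = β + 1 by ring,
      Real.Gamma_nat_eq_factorial] at hb
    rw [← hb]
    refine intervalIntegral.integral_congr fun y hy => ?_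
    rw [Set.uIcc_of_le (by positivity)] at hy
    rw [max_eq_left (by linarith [hy.2]), add_sub_cancel_right, Real.rpow_natCast]

/-- Peano kernel representation: the exact term `n^(β-α)` and the nodal values `k^β` are
superpositions with the same density `y^(β-q-1)`, so the error is the superposition of the errors
for truncated powers. -/
theorem quadErr_eq_integral (ω : ℕ → ℝ) {α β : ℝ} {q n : ℕ} (hq : q ≠ 0) (hqα : α < q + 1)
    (hβ : (q : ℝ) < β) (hn : 1 ≤ n) :
    quadErr ω α β n = Real.Gamma (β + 1) / (q.factorial * Real.Gamma (β - q)) *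
      ∫ y in (0 : ℝ)..n, ((q.factorial : ℝ) / Real.Gamma (q + 1 - α) *
        ((n : ℝ) - y) ^ ((q : ℝ) - α) -
        ∑ k ∈ Finset.range (n + 1), ω (n - k) * (max ((k : ℝ) - y) 0) ^ q) * y ^ (β - q - 1) := by
  have hn' : (0 : ℝ) < n := by exact_mod_cast hn
  have hq0 : (0 : ℝ) ≤ q := Nat.cast_nonneg q
  have g1 : Real.Gamma (β + 1) ≠ 0 := (Real.Gamma_pos_of_pos (by linarith)).ne'
  have g2 : Real.Gamma (β - q) ≠ 0 := (Real.Gamma_pos_of_pos (by linarith)).ne'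
  have g3 : Real.Gamma (q + 1 - α) ≠ 0 := (Real.Gamma_pos_of_pos (by linarith)).ne'
  have g4 : (q.factorial : ℝ) ≠ 0 := by exact_mod_cast q.factorial_ne_zero
  have hb := integral_beta (a := (q : ℝ) + 1 - α) (b := β - q) (t := n) (by linarith)
      (by linarith) hn'
  have hbi := intervalIntegrable_beta (a := (q : ℝ) + 1 - α) (b := β - q) (t := n) (by linarith)
      (by linarith) hn'
  rw [show (q : ℝ) + 1 - α + (β - q) - 1 = β - α by ring,
    show (q : ℝ) + 1 - α + (β - q) = β + 1 - α by ring,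
    show (q : ℝ) + 1 - α - 1 = q - α by ring] at hb
  rw [show (q : ℝ) + 1 - α - 1 = q - α by ring] at hbi
  have e : ∀ y : ℝ, ((q.factorial : ℝ) / Real.Gamma (q + 1 - α) * ((n : ℝ) - y) ^ ((q : ℝ) - α) -
        ∑ k ∈ Finset.range (n + 1), ω (n - k) * (max ((k : ℝ) - y) 0) ^ q) * y ^ (β - q - 1) =
      (q.factorial : ℝ) / Real.Gamma (q + 1 - α) *
        (((n : ℝ) - y) ^ ((q : ℝ) - α) * y ^ (β - q - 1)) -
      ∑ k ∈ Finset.range (n + 1), ω (n - k) *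
        ((max ((k : ℝ) - y) 0) ^ q * y ^ (β - q - 1)) := fun y => by
    rw [sub_mul, Finset.sum_mul]
    congr 1
    · ring
    · exact Finset.sum_congr rfl fun k _ => by ring
  simp only [e]
  have hki : ∀ k ∈ Finset.range (n + 1), IntervalIntegrable (fun y : ℝ => ω (n - k) *
      ((max ((k : ℝ) - y) 0) ^ q * y ^ (β - q - 1))) volume 0 n := fun k hk =>
    ((integral_max_pow_mul_rpow (by have := Finset.mem_range.1 hk; omega) hβ hq).1).const_mul _
  rw [intervalIntegral.integral_sub (hbi.const_mul _) (by
      simpa [Finset.sum_fn] using IntervalIntegrable.sum (Finset.range (n + 1)) hki),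
    intervalIntegral.integral_const_mul, hb, intervalIntegral.integral_finsetSum hki, quadErr,
    mul_sub, Finset.mul_sum]
  congr 1
  · by_cases g5 : Real.Gamma (β + 1 - α) = 0
    · simp [g5]
    · field_simp
  · refine Finset.sum_congr rfl fun k hk => ?_
    rw [intervalIntegral.integral_const_mul,
      (integral_max_pow_mul_rpow (by have := Finset.mem_range.1 hk; omega) hβ hq).2]
    field_simp

/-- The degree `q` is fixed by the method, so the kernel bound does not depend on `β`; the
dependence enters only through `Γ(β+1)/Γ(β+1-q)`. -/
theorem IsQuad.quadErr_le_uniform {ω : ℕ → ℝ} {g : ℝ → ℝ} {α κ : ℝ} {p : ℕ}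
    (h : IsQuad ω g α κ p) : ∃ (q : ℕ) (C : ℝ), 0 ≤ C ∧ ∀ β : ℝ, (q : ℝ) < β → ∀ n : ℕ, 1 ≤ n →
      |quadErr ω α β n| ≤ C * β ^ q * (n : ℝ) ^ (β - α - p) := by
  obtain ⟨q, hq⟩ := exists_nat_ge (1 + p + |α| + |κ|)
  have hp : (0 : ℝ) ≤ p := Nat.cast_nonneg p
  have aκ := abs_nonneg κ
  have aα := abs_nonneg α
  have lα := le_abs_self α
  have lκ := neg_abs_le κ
  have hqp : p ≤ q := by
    have : (p : ℝ) ≤ q := by linarith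
    exact_mod_cast this
  have hq1 : (1 : ℝ) ≤ q := by linarith
  have hq0 : q ≠ 0 := by rintro rfl; norm_num at hq1
  obtain ⟨C, hC, hb⟩ := h.truncErr_le (q := q) (by linarith) hqp (by linarith)
  refine ⟨q, C, hC, fun β hβ n hn => ?_⟩
  have hn' : (1 : ℝ) ≤ n := by exact_mod_cast hn
  have g1 : 0 < Real.Gamma (β + 1) := Real.Gamma_pos_of_pos (by linarith)
  have g2 : 0 < Real.Gamma (β - q) := Real.Gamma_pos_of_pos (by linarith)
  have g4 : (1 : ℝ) ≤ q.factorial := by exact_mod_cast q.factorial_pos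
  rw [quadErr_eq_integral ω hq0 (by linarith) hβ hn, abs_mul, abs_of_pos (by positivity)]
  have e1 : |∫ y in (0 : ℝ)..n, ((q.factorial : ℝ) / Real.Gamma (q + 1 - α) *
        ((n : ℝ) - y) ^ ((q : ℝ) - α) -
        ∑ k ∈ Finset.range (n + 1), ω (n - k) * (max ((k : ℝ) - y) 0) ^ q) * y ^ (β - q - 1)| ≤
      C * (n : ℝ) ^ ((q : ℝ) - α - p) * ((n : ℝ) ^ (β - q) / (β - q)) := by
    have hval : ∫ y in (0 : ℝ)..n, C * (n : ℝ) ^ ((q : ℝ) - α - p) * y ^ (β - q - 1) =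
        C * (n : ℝ) ^ ((q : ℝ) - α - p) * ((n : ℝ) ^ (β - q) / (β - q)) := by
      rw [intervalIntegral.integral_const_mul, integral_rpow (Or.inl (by linarith)),
        sub_add_cancel, Real.zero_rpow (by linarith), sub_zero]
    rw [← hval, ← Real.norm_eq_abs]
    refine intervalIntegral.norm_integral_le_of_norm_le (by positivity) ?_
      ((intervalIntegral.intervalIntegrable_rpow' (by linarith)).const_mul _)
    refine Eventually.of_forall fun y hy => ?_
    obtain ⟨N, hN, θ, hθ, he⟩ := kernel_eq_truncErr ω α hq0 hy.1 hy.2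
    rw [he, norm_mul, Real.norm_eq_abs, Real.norm_of_nonneg (Real.rpow_nonneg hy.1.le _)]
    refine mul_le_mul_of_nonneg_right ((hb N θ hθ).trans ?_) (Real.rpow_nonneg hy.1.le _)
    refine mul_le_mul_of_nonneg_left ?_ hC
    exact Real.rpow_le_rpow (by positivity) (by exact_mod_cast hN) (by linarith)
  -- The quotient `Γ(β+1)/Γ(β+1-q)` is a product of `q` factors, each at most `β`.
  have e2 : Real.Gamma (β + 1) ≤ Real.Gamma (β + 1 - q) * β ^ q := by
    have h1 := Gamma_add_nat_eq_prod (s := β + 1 - q)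
      (fun m h => by linarith [(Nat.cast_nonneg m : (0 : ℝ) ≤ m)]) q
    rw [sub_add_cancel] at h1
    rw [h1]
    refine mul_le_mul_of_nonneg_left ?_ (Real.Gamma_pos_of_pos (by linarith)).le
    calc ∏ j ∈ Finset.range q, (β + 1 - q + (j : ℝ)) ≤ ∏ _j ∈ Finset.range q, β := by
          refine Finset.prod_le_prod (fun j _ => ?_) fun j hj => ?_
          · linarith [(Nat.cast_nonneg j : (0 : ℝ) ≤ j)]
          · have : (j : ℝ) + 1 ≤ q := by exact_mod_cast Finset.mem_range.1 hj
            linarith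
      _ = β ^ q := by simp
  have e3 : Real.Gamma (β + 1 - q) = (β - q) * Real.Gamma (β - q) := by
    rw [← Real.Gamma_add_one (by linarith)]; ring_nf
  have hβq : 0 < β - q := by linarith
  calc Real.Gamma (β + 1) / (q.factorial * Real.Gamma (β - q)) * _
      ≤ Real.Gamma (β + 1) / (1 * Real.Gamma (β - q)) *
        (C * (n : ℝ) ^ ((q : ℝ) - α - p) * ((n : ℝ) ^ (β - q) / (β - q))) := by gcongr
    _ ≤ ((β - q) * Real.Gamma (β - q) * β ^ q) / (1 * Real.Gamma (β - q)) *
        (C * (n : ℝ) ^ ((q : ℝ) - α - p) * ((n : ℝ) ^ (β - q) / (β - q))) := by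
        rw [← e3]; gcongr
    _ = C * β ^ q * ((n : ℝ) ^ ((q : ℝ) - α - p) * (n : ℝ) ^ (β - q)) := by field_simp
    _ = _ := by
        rw [← Real.rpow_add (by positivity)]
        congr 2; ring

/-! ### The tempered derivative of a power -/

/-- The ratio `Γ(δ+j+1)/Γ(δ+j+1+μ)`. -/
def gammaRatio (δ μ : ℝ) (j : ℕ) : ℝ := Real.Gamma (δ + j + 1) / Real.Gamma (δ + j + 1 + μ)

/-- The fractional integral of order `μ` of `e^(σt) t^δ`. -/
def expPowIntegral (σ δ μ : ℝ) (t : ℝ) : ℝ :=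
  ∑' j : ℕ, σ ^ j / j.factorial * gammaRatio δ μ j * t ^ (δ + j + μ)

/-- Consecutive ratios are `x/(x+μ)`, at most `2` once `j ≥ 2|μ|`. Any geometric bound is enough
beside the `1/j!` of the series. -/
theorem gammaRatio_bound {δ : ℝ} (hδ : 0 < δ) (μ : ℝ) :
    ∃ C : ℝ, 0 ≤ C ∧ ∀ j : ℕ, |gammaRatio δ μ j| ≤ C * 2 ^ j := by
  obtain ⟨J, hJ⟩ := exists_nat_ge (2 * |μ|)
  have hstep : ∀ j : ℕ, J ≤ j → |gammaRatio δ μ (j + 1)| ≤ 2 * |gammaRatio δ μ j| := fun j hj => by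
    have hj' : (J : ℝ) ≤ j := by exact_mod_cast hj
    have h1 := neg_abs_le μ
    have h0 := abs_nonneg μ
    have hx : 0 < δ + j + 1 := by linarith
    have hy : 0 < δ + j + 1 + μ := by linarith
    have e : gammaRatio δ μ (j + 1) = (δ + j + 1) / (δ + j + 1 + μ) * gammaRatio δ μ j := by
      rw [gammaRatio, gammaRatio]
      push_cast
      rw [show δ + (j + 1) + 1 + μ = (δ + j + 1 + μ) + 1 by ring,
        show δ + ((j : ℝ) + 1) + 1 = (δ + j + 1) + 1 by ring, Real.Gamma_add_one hx.ne',
        Real.Gamma_add_one hy.ne', mul_div_mul_comm]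
    rw [e, abs_mul, abs_of_pos (div_pos hx hy)]
    refine mul_le_mul_of_nonneg_right ?_ (abs_nonneg _)
    rw [div_le_iff₀ hy]
    linarith
  refine ⟨∑ i ∈ Finset.range (J + 1), |gammaRatio δ μ i|,
    Finset.sum_nonneg fun _ _ => abs_nonneg _, fun j => ?_⟩
  have hS : 0 ≤ ∑ i ∈ Finset.range (J + 1), |gammaRatio δ μ i| :=
    Finset.sum_nonneg fun _ _ => abs_nonneg _
  induction j with
  | zero =>
    rw [pow_zero, mul_one]
    exact Finset.single_le_sum (f := fun i => |gammaRatio δ μ i|) (fun _ _ => abs_nonneg _)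
      (by simp)
  | succ j ih =>
    rcases lt_or_ge j J with h | h
    · have h1 : |gammaRatio δ μ (j + 1)| ≤ ∑ i ∈ Finset.range (J + 1), |gammaRatio δ μ i| :=
        Finset.single_le_sum (f := fun i => |gammaRatio δ μ i|) (fun _ _ => abs_nonneg _)
          (Finset.mem_range.2 (by omega))
      exact h1.trans (le_mul_of_one_le_right hS (one_le_pow₀ (by norm_num)))
    · refine (hstep j h).trans ?_
      rw [pow_succ]
      linarith

theorem summable_gammaRatio {δ : ℝ} (hδ : 0 < δ) (σ μ T : ℝ) :
    Summable fun j : ℕ => |σ ^ j / j.factorial * gammaRatio δ μ j| * T ^ j := by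
  obtain ⟨C, hC, h⟩ := gammaRatio_bound hδ μ
  refine Summable.of_norm_bounded
    ((Real.summable_pow_div_factorial (2 * |σ| * |T|)).mul_left C) fun j => ?_
  rw [norm_mul, norm_pow, Real.norm_eq_abs, Real.norm_eq_abs, abs_abs, abs_mul, abs_div, abs_pow,
    Nat.abs_cast]
  calc |σ| ^ j / j.factorial * |gammaRatio δ μ j| * |T| ^ j
      ≤ |σ| ^ j / j.factorial * (C * 2 ^ j) * |T| ^ j := by
        gcongr
        exact h j
    _ = _ := by rw [mul_pow, mul_pow]; ring

theorem hasSum_expPowIntegral {δ : ℝ} (hδ : 0 < δ) (σ μ : ℝ) {t : ℝ} (ht : 0 < t) :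
    HasSum (fun j : ℕ => σ ^ j / j.factorial * gammaRatio δ μ j * t ^ (δ + j + μ))
      (expPowIntegral σ δ μ t) := by
  refine Summable.hasSum ?_
  refine Summable.of_norm ((summable_gammaRatio hδ σ μ t).mul_left (t ^ (δ + μ)) |>.congr ?_)
  intro j
  rw [norm_mul, Real.norm_eq_abs, Real.norm_of_nonneg (Real.rpow_nonneg ht.le _),
    show δ + j + μ = (δ + μ) + j by ring, Real.rpow_add ht (δ + μ), Real.rpow_natCast]
  ring

/-- Termwise differentiation lowers `μ` by one. By `one_div_Gamma` this stays correct across the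
poles of `Γ`, so the same series serves for integrals and for derivatives. -/
theorem hasDerivAt_expPowIntegral {δ : ℝ} (hδ : 0 < δ) (σ μ : ℝ) {t : ℝ} (ht : 0 < t) :
    HasDerivAt (expPowIntegral σ δ μ) (expPowIntegral σ δ (μ - 1) t) t := by
  -- Dominates `y^(δ+μ-1)` on `(t/2, 2t)` whatever the sign of the exponent.
  set B := (t / 2) ^ (δ + μ - 1) + (2 * t) ^ (δ + μ - 1) with hB
  have hmem : t ∈ Set.Ioo (t / 2) (2 * t) := ⟨by linarith, by linarith⟩
  refine hasDerivAt_tsum_of_isPreconnected (t := Set.Ioo (t / 2) (2 * t))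
    (g := fun (j : ℕ) y => σ ^ j / j.factorial * gammaRatio δ μ j * y ^ (δ + j + μ))
    (g' := fun (j : ℕ) y => σ ^ j / j.factorial * gammaRatio δ (μ - 1) j * y ^ (δ + j + (μ - 1)))
    ((summable_gammaRatio hδ σ (μ - 1) (2 * t)).mul_left B) isOpen_Ioo isPreconnected_Ioo
    ?_ ?_ hmem (hasSum_expPowIntegral hδ σ μ ht).summable hmem
  · intro j y hy
    have hy0 : 0 < y := by linarith [hy.1]
    have h := (Real.hasDerivAt_rpow_const (x := y) (p := δ + j + μ) (Or.inl hy0.ne')).const_mul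
      (σ ^ j / j.factorial * gammaRatio δ μ j)
    refine h.congr_deriv ?_
    have hg : gammaRatio δ (μ - 1) j = gammaRatio δ μ j * (δ + j + μ) := by
      rw [gammaRatio, gammaRatio, div_eq_mul_inv, show δ + j + 1 + (μ - 1) = δ + j + μ by ring,
        one_div_Gamma, show δ + j + μ + 1 = δ + j + 1 + μ by ring]
      ring
    rw [hg, show δ + j + (μ - 1) = δ + j + μ - 1 by ring]
    ring
  · intro j y hy
    have hy0 : 0 < y := by linarith [hy.1]
    rw [norm_mul, Real.norm_eq_abs, Real.norm_of_nonneg (Real.rpow_nonneg hy0.le _),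
      show δ + j + (μ - 1) = (δ + μ - 1) + j by ring, Real.rpow_add hy0, Real.rpow_natCast]
    have h1 : y ^ (δ + μ - 1) ≤ B := by
      have p1 : 0 < (t / 2) ^ (δ + μ - 1) := by positivity
      have p2 : 0 < (2 * t) ^ (δ + μ - 1) := by positivity
      rcases le_total 0 (δ + μ - 1) with h | h
      · have := Real.rpow_le_rpow hy0.le hy.2.le h
        linarith
      · have := Real.rpow_le_rpow_of_nonpos (by positivity) hy.1.le h
        linarith
    have h2 : y ^ j ≤ (2 * t) ^ j := pow_le_pow_left₀ hy0.le hy.2.le j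
    have hB0 : 0 ≤ B := by positivity
    calc |σ ^ j / j.factorial * gammaRatio δ (μ - 1) j| * (y ^ (δ + μ - 1) * y ^ j)
        ≤ |σ ^ j / j.factorial * gammaRatio δ (μ - 1) j| * (B * (2 * t) ^ j) := by gcongr
      _ = _ := by ring

theorem contDiffOn_expPowIntegral {δ : ℝ} (hδ : 0 < δ) (σ μ : ℝ) (n : ℕ) :
    ContDiffOn ℝ n (expPowIntegral σ δ μ) (Set.Ioi 0) := by
  induction n generalizing μ with
  | zero =>
    rw [Nat.cast_zero, contDiffOn_zero]
    exact fun t ht => (hasDerivAt_expPowIntegral hδ σ μ ht).continuousAt.continuousWithinAt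
  | succ n ih =>
    rw [Nat.cast_succ, contDiffOn_succ_iff_deriv_of_isOpen isOpen_Ioi]
    refine ⟨fun t ht => (hasDerivAt_expPowIntegral hδ σ μ ht).differentiableAt.differentiableWithinAt,
      fun h => by simp at h, ?_⟩
    exact (ih (μ - 1)).congr fun t ht => (hasDerivAt_expPowIntegral hδ σ μ ht).deriv

theorem hasSum_exp_mul (σ s : ℝ) :
    HasSum (fun j : ℕ => σ ^ j / j.factorial * s ^ j) (Real.exp (σ * s)) := by
  have h := NormedSpace.expSeries_div_hasSum_exp (σ * s)
  rw [← Real.exp_eq_exp_ℝ] at h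
  refine HasSum.of_forall_eq h fun j => ?_
  rw [mul_pow]; ring

theorem intervalIntegrable_kernel {σ δ β x : ℝ} (hδ : 0 < δ) (hβ : 0 < β) (hx : 0 < x) :
    IntervalIntegrable (fun s => (x - s) ^ (β - 1) * Real.exp (-σ * (x - s)) * s ^ δ)
      volume 0 x := by
  have h := (intervalIntegrable_beta (a := β) (b := δ + 1) hβ (by linarith) hx).mul_continuousOn
    (g := fun s => Real.exp (-σ * (x - s))) (Continuous.continuousOn (by fun_prop))
  refine h.congr fun s _ => ?_
  simp only [add_sub_cancel_right]
  ring

/-- Write the kernel's exponential as `e^(-σt) e^(σs)` and expand `e^(σs)`. For `σ ≥ 0` every term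
is nonnegative on `(0,t]`, so sum and integral may be exchanged, each term being a Beta integral. -/
theorem temperedIntegral_rpow {σ δ β : ℝ} (hσ : 0 ≤ σ) (hδ : 0 < δ) (hβ : 0 ≤ β) {t : ℝ}
    (ht : 0 < t) : temperedIntegral σ β (fun x => x ^ δ) t =
      Real.exp (-σ * t) * expPowIntegral σ δ β t := by
  rcases eq_or_lt_of_le hβ with h | h
  · subst h
    rw [temperedIntegral, if_pos rfl]
    have h1 : HasSum (fun j : ℕ => σ ^ j / j.factorial * gammaRatio δ 0 j * t ^ (δ + j + 0))
        (t ^ δ * Real.exp (σ * t)) := by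
      refine HasSum.of_forall_eq ((hasSum_exp_mul σ t).mul_left (t ^ δ)) fun j => ?_
      have : Real.Gamma (δ + j + 1) ≠ 0 := (Real.Gamma_pos_of_pos (by positivity)).ne'
      rw [gammaRatio, add_zero, div_self this, add_zero, Real.rpow_add ht, Real.rpow_natCast]
      ring
    rw [(hasSum_expPowIntegral hδ σ 0 ht).unique h1]
    rw [mul_left_comm, ← Real.exp_add]
    simp
  · rw [temperedIntegral, if_neg h.ne']
    have hΓ : Real.Gamma β ≠ 0 := (Real.Gamma_pos_of_pos h).ne'
    set F : ℕ → ℝ → ℝ := fun j s => σ ^ j / j.factorial * ((t - s) ^ (β - 1) * s ^ (δ + j)) with hF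
    have hFi : ∀ j : ℕ, IntervalIntegrable (fun s => (t - s) ^ (β - 1) * s ^ (δ + j)) volume 0 t :=
      fun j => by
        have := intervalIntegrable_beta (a := β) (b := δ + j + 1) h (by positivity) ht
        simpa using this
    have hFv : ∀ j : ℕ, ∫ s in (0 : ℝ)..t, F j s =
        Real.Gamma β * (σ ^ j / j.factorial * gammaRatio δ β j * t ^ (δ + j + β)) := fun j => by
      have := integral_beta (a := β) (b := δ + j + 1) h (by positivity) ht
      rw [add_sub_cancel_right, show β + (δ + j + 1) - 1 = δ + j + β by ring,
        show β + (δ + j + 1) = δ + j + 1 + β by ring] at this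
      rw [hF, intervalIntegral.integral_const_mul, this, gammaRatio]
      ring
    have hnn : ∀ j : ℕ, ∀ s ∈ Set.Ioc 0 t, ‖F j s‖ = F j s := fun j s hs => by
      refine Real.norm_of_nonneg ?_
      have h1 : 0 ≤ t - s := by linarith [hs.2]
      have h2 := hs.1
      positivity
    have hmain := hasSum_integral_of_summable_integral_norm
      (μ := volume.restrict (Set.Ioc 0 t)) (F := F)
      (fun j => ((intervalIntegrable_iff_integrableOn_Ioc_of_le ht.le).1
        ((hFi j).const_mul (σ ^ j / j.factorial)))) (by
        have e : ∀ j, ∫ s in Set.Ioc 0 t, ‖F j s‖ =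
            Real.Gamma β * (σ ^ j / j.factorial * gammaRatio δ β j * t ^ (δ + j + β)) := fun j => by
          rw [setIntegral_congr_fun measurableSet_Ioc (hnn j), ← intervalIntegral.integral_of_le ht.le,
            hFv]
        simp only [e]
        exact ((hasSum_expPowIntegral hδ σ β ht).summable.mul_left _))
    have e2 : ∀ j, ∫ s in Set.Ioc 0 t, F j s =
        Real.Gamma β * (σ ^ j / j.factorial * gammaRatio δ β j * t ^ (δ + j + β)) := fun j => by
      rw [← intervalIntegral.integral_of_le ht.le, hFv]
    simp only [e2] at hmain
    have h3 := hmain.unique ((hasSum_expPowIntegral hδ σ β ht).mul_left (Real.Gamma β))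
    have h4 : ∫ s in (0 : ℝ)..t, (t - s) ^ (β - 1) * Real.exp (-σ * (t - s)) * s ^ δ =
        Real.exp (-σ * t) * ∫ s in Set.Ioc 0 t, ∑' j, F j s := by
      rw [intervalIntegral.integral_of_le ht.le, ← integral_const_mul]
      refine setIntegral_congr_fun measurableSet_Ioc fun s hs => ?_
      have h5 : HasSum (fun j => F j s) ((t - s) ^ (β - 1) * s ^ δ * Real.exp (σ * s)) := by
        refine HasSum.of_forall_eq
          ((hasSum_exp_mul σ s).mul_left ((t - s) ^ (β - 1) * s ^ δ)) fun j => ?_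
        change σ ^ j / j.factorial * ((t - s) ^ (β - 1) * s ^ (δ + j)) = _
        rw [Real.rpow_add hs.1, Real.rpow_natCast]
        ring
      rw [h5.tsum_eq, show -σ * (t - s) = -σ * t + σ * s by ring, Real.exp_add]
      ring
    rw [h4, h3, mul_left_comm, inv_mul_cancel_left₀ hΓ]

/-- Pascal's rule in the form `(D + σ)^(m+1) = (D + σ)^m (D + σ)`, with `a k` standing for the
`k`-th derivative. -/
theorem sum_choose_succ (σ : ℝ) (m : ℕ) (a : ℕ → ℝ) :
    ∑ k ∈ Finset.range (m + 1 + 1), ((m + 1).choose k : ℝ) * σ ^ (m + 1 - k) * a k =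
      ∑ k ∈ Finset.range (m + 1), (m.choose k : ℝ) * σ ^ (m - k) * a (k + 1) +
      σ * ∑ k ∈ Finset.range (m + 1), (m.choose k : ℝ) * σ ^ (m - k) * a k := by
  rw [Finset.sum_range_succ']
  have e1 : ∀ k ∈ Finset.range (m + 1), ((m + 1).choose (k + 1) : ℝ) * σ ^ (m + 1 - (k + 1)) *
      a (k + 1) = (m.choose k : ℝ) * σ ^ (m - k) * a (k + 1) +
        (m.choose (k + 1) : ℝ) * σ ^ (m - k) * a (k + 1) := fun k _ => by
    rw [Nat.choose_succ_succ, Nat.add_sub_add_right]; push_cast; ring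
  rw [Finset.sum_congr rfl e1, Finset.sum_add_distrib, add_assoc]
  congr 1
  rw [Finset.sum_range_succ, Nat.choose_succ_self, Finset.sum_range_succ' _ m, mul_add,
    Finset.mul_sum]
  simp only [Nat.cast_zero, zero_mul, add_zero, Nat.choose_zero_right, Nat.cast_one, one_mul,
    Nat.sub_zero]
  congr 1
  · refine Finset.sum_congr rfl fun k hk => ?_
    rw [show m - k = (m - (k + 1)) + 1 by have := Finset.mem_range.1 hk; omega, pow_succ]
    ring
  · rw [pow_succ]; ring

/-- `(d/dx + σ)(e^(-σx) F) = e^(-σx) F'`, applied `m` times. Equality near `t` is all that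
derivatives at `t` require, and the formula for the tempered integral is available only on `x > 0`.
-/
theorem sum_choose_iteratedDeriv {σ δ : ℝ} (hδ : 0 < δ) (m : ℕ) {μ t : ℝ} (ht : 0 < t) {f : ℝ → ℝ}
    (hf : f =ᶠ[𝓝 t] fun x => Real.exp (-σ * x) * expPowIntegral σ δ μ x) :
    ∑ k ∈ Finset.range (m + 1), (m.choose k : ℝ) * σ ^ (m - k) * iteratedDeriv k f t =
      Real.exp (-σ * t) * expPowIntegral σ δ (μ - m) t := by
  induction m generalizing μ f with
  | zero => simpa using hf.eq_of_nhds
  | succ m ih =>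
    have hsm : ∀ n : ℕ, ContDiffAt ℝ n f t := fun n => by
      refine ContDiffAt.congr_of_eventuallyEq ?_ hf
      exact ContDiffAt.mul (by fun_prop)
        ((contDiffOn_expPowIntegral hδ σ μ n).contDiffAt (Ioi_mem_nhds ht))
    have hd : (fun x => deriv f x + σ * f x) =ᶠ[𝓝 t]
        fun x => Real.exp (-σ * x) * expPowIntegral σ δ (μ - 1) x := by
      filter_upwards [hf.eventuallyEq_nhds, Ioi_mem_nhds ht] with x hx hx0
      have h1 : HasDerivAt (fun x => Real.exp (-σ * x) * expPowIntegral σ δ μ x)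
          (-σ * Real.exp (-σ * x) * expPowIntegral σ δ μ x +
            Real.exp (-σ * x) * expPowIntegral σ δ (μ - 1) x) x := by
        have h2 : HasDerivAt (fun x => Real.exp (-σ * x)) (-σ * Real.exp (-σ * x)) x := by
          have := ((hasDerivAt_id x).const_mul (-σ)).exp
          refine this.congr_deriv ?_
          simp; ring
        exact h2.mul (hasDerivAt_expPowIntegral hδ σ μ hx0)
      rw [hx.deriv_eq, h1.deriv, hx.eq_of_nhds]
      ring
    have h := ih (μ := μ - 1) hd
    rw [show μ - 1 - (m : ℝ) = μ - ((m + 1 : ℕ) : ℝ) by push_cast; ring] at h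
    rw [← h, sum_choose_succ, Finset.mul_sum, ← Finset.sum_add_distrib]
    refine Finset.sum_congr rfl fun k _ => ?_
    have hdf : ContDiffAt ℝ k (deriv f) t := by
      refine ContDiffAt.congr_of_eventuallyEq (f := fun x =>
        Real.exp (-σ * x) * expPowIntegral σ δ (μ - 1) x - σ * f x) ?_ ?_
      · exact (ContDiffAt.mul (by fun_prop)
          ((contDiffOn_expPowIntegral hδ σ _ k).contDiffAt (Ioi_mem_nhds ht))).sub
          (contDiffAt_const.mul (hsm k))
      · filter_upwards [hd] with x hx
        rw [← hx]; ring
    have : iteratedDeriv k (fun x => deriv f x + σ * f x) t =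
        iteratedDeriv (k + 1) f t + σ * iteratedDeriv k f t := by
      have h1 := iteratedDeriv_add hdf (contDiffAt_const.mul (hsm k) :
        ContDiffAt ℝ k (fun x => σ * f x) t)
      rw [iteratedDeriv_const_mul σ (hsm k)] at h1
      rw [iteratedDeriv_succ']
      exact h1
    rw [this]
    ring

theorem temperedIntegral_eventuallyEq {σ δ β : ℝ} (hσ : 0 ≤ σ) (hδ : 0 < δ) (hβ : 0 ≤ β) {t : ℝ}
    (ht : 0 < t) : temperedIntegral σ β (fun x => x ^ δ) =ᶠ[𝓝 t]
      fun x => Real.exp (-σ * x) * expPowIntegral σ δ β x := by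
  filter_upwards [Ioi_mem_nhds ht] with x hx
  exact temperedIntegral_rpow hσ hδ hβ hx

theorem temperedDeriv_rpow {σ δ : ℝ} (hσ : 0 ≤ σ) (hδ : 0 < δ) (α : ℝ) {t : ℝ} (ht : 0 < t) :
    temperedDeriv σ α (fun x => x ^ δ) t = Real.exp (-σ * t) * expPowIntegral σ δ (-α) t := by
  have hβ : 0 ≤ (⌈α⌉₊ : ℝ) - α := by linarith [Nat.le_ceil α]
  rw [temperedDeriv, sum_choose_iteratedDeriv hδ ⌈α⌉₊ ht
    (temperedIntegral_eventuallyEq hσ hδ hβ ht)]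
  congr 2; ring

theorem temperedDerivExistsAt_rpow {σ δ : ℝ} (hσ : 0 ≤ σ) (hδ : 0 < δ) (α : ℝ) {t : ℝ}
    (ht : 0 < t) : TemperedDerivExistsAt σ α (fun x => x ^ δ) t := by
  have hβ : 0 ≤ (⌈α⌉₊ : ℝ) - α := by linarith [Nat.le_ceil α]
  refine ⟨fun h => ?_, ?_⟩
  · filter_upwards [Ioi_mem_nhds ht] with x hx
    exact intervalIntegrable_kernel hδ (lt_of_le_of_ne hβ (Ne.symm h)) hx
  · refine ContDiffAt.congr_of_eventuallyEq ?_ (temperedIntegral_eventuallyEq hσ hδ hβ ht)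
    exact ContDiffAt.mul (by fun_prop)
      ((contDiffOn_expPowIntegral hδ σ _ ⌈α⌉₊).contDiffAt (Ioi_mem_nhds ht))

/-! ### The tempered quadrature -/

theorem IsQuad.hasSum_weight {S : Scheme} {α κ : ℝ} {p : ℕ}
    (h : IsQuad (taylorCoeff (S.gen α)) (S.gen α) α κ p) (σ τ : ℝ) :
    (∀ᶠ z in 𝓝 (0 : ℝ), HasSum (fun k : ℕ => S.weight α σ τ k * z ^ k)
        (S.gen α (z * Real.exp (-σ * τ)))) ∧
      ∀ k : ℕ, S.weight α σ τ k = Real.exp (-(k * σ * τ)) * taylorCoeff (S.gen α) k := by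
  have h1 : ∀ᶠ z in 𝓝 (0 : ℝ), HasSum (fun k : ℕ =>
      (Real.exp (-(k * σ * τ)) * taylorCoeff (S.gen α) k) * z ^ k)
      (S.gen α (z * Real.exp (-σ * τ))) := by
    have hev : ∀ᶠ z : ℝ in 𝓝 0, |z * Real.exp (-σ * τ)| < 1 := by
      have : Tendsto (fun z : ℝ => |z * Real.exp (-σ * τ)|) (𝓝 0) (𝓝 |0 * Real.exp (-σ * τ)|) :=
        Continuous.tendsto (by fun_prop) 0
      rw [zero_mul, abs_zero] at this
      exact this.eventually_lt_const one_pos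
    filter_upwards [hev] with z hz
    refine HasSum.of_forall_eq (h.hasSum _ hz) fun k => ?_
    rw [mul_pow, ← Real.exp_nat_mul, show (k : ℝ) * (-σ * τ) = -(k * σ * τ) by ring]
    ring
  have h2 : ∀ k, S.weight α σ τ k = Real.exp (-(k * σ * τ)) * taylorCoeff (S.gen α) k :=
    fun k => congrFun (taylorCoeff_eq_of_hasSum h1) k
  exact ⟨by simpa only [h2] using h1, h2⟩

theorem IsQuad.weight_eq {S : Scheme} {α κ : ℝ} {p : ℕ}
    (h : IsQuad (taylorCoeff (S.gen α)) (S.gen α) α κ p) (σ τ : ℝ) (k : ℕ) :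
    S.weight α σ τ k = Real.exp (-(k * σ * τ)) * S.weight α 0 τ k := by
  rw [(h.hasSum_weight σ τ).2, (h.hasSum_weight 0 τ).2]
  simp

/-- For `j ≤ q` there are finitely many constants; for `j > q` the uniform bound applies. The
condition on `κ` absorbs `n^(-κ-1)` into one of the two other terms. -/
theorem IsQuad.exists_quadErr_bound {ω : ℕ → ℝ} {g : ℝ → ℝ} {α κ δ : ℝ} {p : ℕ}
    (h : IsQuad ω g α κ p) (hδ : 0 < δ) (hκ : α ≤ κ ∨ -κ - 1 ≤ δ - α - p) :
    ∃ (q : ℕ) (A : ℝ), 0 ≤ A ∧ ∀ j n : ℕ, 1 ≤ n → |quadErr ω α (δ + j) n| ≤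
      A * (1 + (δ + j) ^ q) * ((n : ℝ) ^ (δ + j - α - p) + (n : ℝ) ^ (-α - 1)) := by
  obtain ⟨q, C, hC, hu⟩ := h.quadErr_le_uniform
  choose Ce hCe he using fun j : ℕ => h.quadErr_le (β := δ + j) (by positivity)
  have hS : 0 ≤ ∑ i ∈ Finset.range (q + 1), 2 * Ce i :=
    Finset.sum_nonneg fun i _ => by have := hCe i; positivity
  refine ⟨q, C + ∑ i ∈ Finset.range (q + 1), 2 * Ce i, by positivity, fun j n hn => ?_⟩
  have hn' : (1 : ℝ) ≤ n := by exact_mod_cast hn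
  have b1 : (0 : ℝ) ≤ (n : ℝ) ^ (δ + j - α - p) := by positivity
  have b2 : (0 : ℝ) ≤ (n : ℝ) ^ (-α - 1) := by positivity
  have hj : (0 : ℝ) ≤ j := Nat.cast_nonneg j
  have bq : (0 : ℝ) ≤ (δ + j) ^ q := by positivity
  rcases le_or_gt j q with hjq | hjq
  · have h3 : (n : ℝ) ^ (-κ - 1) ≤ (n : ℝ) ^ (δ + j - α - p) + (n : ℝ) ^ (-α - 1) := by
      rcases hκ with h | h
      · have := Real.rpow_le_rpow_of_exponent_le hn' (show -κ - 1 ≤ -α - 1 by linarith)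
        linarith
      · have := Real.rpow_le_rpow_of_exponent_le hn' (show -κ - 1 ≤ δ + j - α - p by linarith)
        linarith
    have h4 : 2 * Ce j ≤ ∑ i ∈ Finset.range (q + 1), 2 * Ce i :=
      Finset.single_le_sum (f := fun i => 2 * Ce i) (fun i _ => by have := hCe i; positivity)
        (Finset.mem_range.2 (by omega))
    calc _ ≤ Ce j * ((n : ℝ) ^ (δ + j - α - p) + (n : ℝ) ^ (-α - 1) + (n : ℝ) ^ (-κ - 1)) :=
          he j n hn
      _ ≤ Ce j * (2 * ((n : ℝ) ^ (δ + j - α - p) + (n : ℝ) ^ (-α - 1))) :=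
          mul_le_mul_of_nonneg_left (by linarith) (hCe j)
      _ = 2 * Ce j * 1 * ((n : ℝ) ^ (δ + j - α - p) + (n : ℝ) ^ (-α - 1)) := by ring
      _ ≤ _ := by
          gcongr
          · linarith
          · linarith
  · have h5 : (q : ℝ) < δ + j := by
      have : (q : ℝ) < j := by exact_mod_cast hjq
      linarith
    calc _ ≤ C * (δ + j) ^ q * (n : ℝ) ^ (δ + j - α - p) := hu _ h5 n hn
      _ ≤ _ := by
          gcongr
          · linarith
          · linarith
          · linarith

/-- `(δ+j)^q ≤ q! e^(δ+j)`, so the polynomial factor only rescales the argument of the exponential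
series. -/
theorem summable_pow_mul (δ σ T A : ℝ) (hδ : 0 < δ) (hσ : 0 ≤ σ) (hT : 0 < T) (q : ℕ) :
    Summable fun j : ℕ => σ ^ j / j.factorial * (A * (1 + (δ + j) ^ q)) * T ^ j := by
  have h1 := (Real.summable_pow_div_factorial (σ * T)).mul_left A
  have h2 : Summable fun j : ℕ => (δ + j) ^ q * ((σ * T) ^ j / j.factorial) := by
    refine Summable.of_nonneg_of_le (fun j => by positivity) (fun j => ?_)
      ((Real.summable_pow_div_factorial (Real.exp 1 * (σ * T))).mul_left
        (q.factorial * Real.exp δ))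
    have h3 := Real.pow_div_factorial_le_exp (δ + j) (by positivity) q
    rw [div_le_iff₀ (by positivity), Real.exp_add, ← mul_one (j : ℝ), Real.exp_nat_mul,
      mul_one] at h3
    calc (δ + j) ^ q * ((σ * T) ^ j / j.factorial)
        ≤ (Real.exp δ * Real.exp 1 ^ j * q.factorial) * ((σ * T) ^ j / j.factorial) := by gcongr
      _ = _ := by rw [mul_pow (Real.exp 1)]; ring
  refine (h1.add (h2.mul_left A)).congr fun j => ?_
  rw [mul_pow]; ring

/-- Both sides carry the factor `e^(-σ t_n)`: the derivative by `temperedDeriv_rpow`, the quadrature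
because the weight factor `e^(-(n-k)στ)` equals `e^(-σ t_n) e^(σ t_k)`. Then expand the remaining
exponential in powers of `σ`. -/
theorem IsQuad.hasSum_error {S : Scheme} {α κ δ σ τ : ℝ} {p : ℕ}
    (h : IsQuad (taylorCoeff (S.gen α)) (S.gen α) α κ p) (hδ : 0 < δ) (hσ : 0 ≤ σ) (hτ : 0 < τ)
    {n : ℕ} (hn : 1 ≤ n) :
    HasSum (fun j : ℕ => Real.exp (-σ * (n * τ)) * (σ ^ j / j.factorial * (τ ^ (δ + j - α) *
      quadErr (taylorCoeff (S.gen α)) α (δ + j) n)))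
      (temperedDeriv σ α (fun x => x ^ δ) (n * τ) - S.flmm α σ τ n (fun x => x ^ δ)) := by
  set ω := taylorCoeff (S.gen α) with hω
  have hn' : (0 : ℝ) < n := by exact_mod_cast hn
  have ht : 0 < n * τ := by positivity
  rw [temperedDeriv_rpow hσ hδ α ht]
  have h1 := (hasSum_expPowIntegral hδ σ (-α) ht).mul_left (Real.exp (-σ * (n * τ)))
  have h2 : HasSum (fun j : ℕ => Real.exp (-σ * (n * τ)) * (σ ^ j / j.factorial * (τ ^ (δ + j - α) *
      ∑ k ∈ Finset.range (n + 1), ω (n - k) * (k : ℝ) ^ (δ + j))))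
      (S.flmm α σ τ n (fun x => x ^ δ)) := by
    -- Inserts `1 = e^(-σ t_k) e^(σ t_k)` and expands only the second factor.
    have h3 : HasSum (fun j : ℕ => ∑ k ∈ Finset.range (n + 1), τ ^ (-α) * (S.weight α σ τ (n - k) *
        (((k : ℝ) * τ) ^ δ * Real.exp (-(σ * (k * τ))) *
          (σ ^ j / j.factorial * (k * τ) ^ j))))
        (∑ k ∈ Finset.range (n + 1), τ ^ (-α) * (S.weight α σ τ (n - k) *
          (((k : ℝ) * τ) ^ δ * Real.exp (-(σ * (k * τ))) * Real.exp (σ * (k * τ))))) :=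
      hasSum_sum fun k _ => (((hasSum_exp_mul σ (k * τ)).mul_left _).mul_left _).mul_left _
    convert h3 using 1
    · funext j
      rw [Finset.mul_sum, Finset.mul_sum, Finset.mul_sum]
      refine Finset.sum_congr rfl fun k hk => ?_
      have hk' : k ≤ n := by have := Finset.mem_range.1 hk; omega
      rw [(h.hasSum_weight σ τ).2, Nat.cast_sub hk']
      have hk0 : (0 : ℝ) ≤ k := Nat.cast_nonneg k
      have e1 : (k : ℝ) ^ (δ + j) = (k : ℝ) ^ δ * (k : ℝ) ^ j := by
        rw [Real.rpow_add' hk0 (by positivity), Real.rpow_natCast]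
      have e2 : τ ^ (δ + j - α) = τ ^ δ * τ ^ j * τ ^ (-α) := by
        rw [sub_eq_add_neg, Real.rpow_add hτ, Real.rpow_add hτ, Real.rpow_natCast]
      have e3 : Real.exp (-σ * (n * τ)) =
          Real.exp (-(((n : ℝ) - k) * σ * τ)) * Real.exp (-(σ * (k * τ))) := by
        rw [← Real.exp_add]; congr 1; ring
      rw [e1, e2, e3, Real.mul_rpow hk0 hτ.le, mul_pow]
      ring
    · rw [Scheme.flmm, Finset.mul_sum]
      refine Finset.sum_congr rfl fun k _ => ?_
      rw [Real.zero_rpow hδ.ne', sub_zero, mul_assoc ((k * τ : ℝ) ^ δ), ← Real.exp_add,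
        neg_add_cancel, Real.exp_zero, mul_one]
  refine HasSum.of_forall_eq (h1.sub h2) fun j => ?_
  rw [quadErr, gammaRatio, Real.mul_rpow hn'.le hτ.le]
  simp only [← sub_eq_add_neg]
  ring

/-- Restoring the step size turns `n^(δ+j-α-p)` and `n^(-α-1)` into the claimed terms times `t_n^j`
and `τ^j`, both at most `T^j`. The resulting series in `j` is independent of `τ` and `n`. -/
theorem IsQuad.error_bound {S : Scheme} {α κ δ σ : ℝ} {p : ℕ}
    (h : IsQuad (taylorCoeff (S.gen α)) (S.gen α) α κ p) (hδ : 0 < δ) (hσ : 0 ≤ σ)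
    (hκ : α ≤ κ ∨ -κ - 1 ≤ δ - α - p) {T : ℝ} (hT : 0 < T) :
    ∃ C : ℝ, ∀ τ : ℝ, 0 < τ → ∀ n : ℕ, 1 ≤ n → n * τ ≤ T →
      |temperedDeriv σ α (fun x => x ^ δ) (n * τ) - S.flmm α σ τ n (fun x => x ^ δ)|
        ≤ C * ((n * τ) ^ (δ - α - p) * τ ^ p + (n * τ) ^ (-α - 1) * τ ^ (δ + 1)) := by
  obtain ⟨q, A, hA, hb⟩ := h.exists_quadErr_bound hδ hκ
  have hs := summable_pow_mul δ σ T A hδ hσ hT q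
  refine ⟨∑' j : ℕ, σ ^ j / j.factorial * (A * (1 + (δ + j) ^ q)) * T ^ j,
    fun τ hτ n hn hnT => ?_⟩
  have hn' : (1 : ℝ) ≤ n := by exact_mod_cast hn
  have hn0 : (0 : ℝ) < n := by linarith
  have ht : 0 < n * τ := by positivity
  have hτT : τ ≤ T := (le_mul_of_one_le_left hτ.le hn').trans hnT
  set R := ((n : ℝ) * τ) ^ (δ - α - p) * τ ^ p + ((n : ℝ) * τ) ^ (-α - 1) * τ ^ (δ + 1) with hR
  have hterm : ∀ j : ℕ, ‖Real.exp (-σ * (n * τ)) * (σ ^ j / j.factorial * (τ ^ (δ + j - α) *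
      quadErr (taylorCoeff (S.gen α)) α (δ + j) n))‖ ≤
      σ ^ j / j.factorial * (A * (1 + (δ + j) ^ q)) * T ^ j * R := fun j => by
    have e0 : Real.exp (-σ * (n * τ)) ≤ 1 := by
      rw [Real.exp_le_one_iff]
      nlinarith [mul_nonneg hσ ht.le]
    have hτp : 0 < τ ^ (δ + j - α) := by positivity
    have e1 : τ ^ (δ + j - α) * ((n : ℝ) ^ (δ + j - α - p) + (n : ℝ) ^ (-α - 1)) ≤ T ^ j * R := by
      have i1 : τ ^ (δ + j - α) * (n : ℝ) ^ (δ + j - α - p) =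
          (n * τ) ^ j * ((n * τ) ^ (δ - α - p) * τ ^ p) := by
        rw [← Real.rpow_natCast (n * τ) j, ← mul_assoc, ← Real.rpow_add ht,
          show (j : ℝ) + (δ - α - p) = δ + j - α - p by ring, Real.mul_rpow hn0.le hτ.le,
          ← Real.rpow_natCast τ p, mul_assoc, ← Real.rpow_add hτ, sub_add_cancel, mul_comm]
      have i2 : τ ^ (δ + j - α) * (n : ℝ) ^ (-α - 1) =
          τ ^ j * ((n * τ) ^ (-α - 1) * τ ^ (δ + 1)) := by
        rw [← Real.rpow_natCast τ j, Real.mul_rpow hn0.le hτ.le,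
          show δ + j - α = j + ((-α - 1) + (δ + 1)) by ring, Real.rpow_add hτ, Real.rpow_add hτ]
        ring
      have i3 : ((n : ℝ) * τ) ^ j ≤ T ^ j := pow_le_pow_left₀ ht.le hnT j
      have i4 : τ ^ j ≤ T ^ j := pow_le_pow_left₀ hτ.le hτT j
      rw [mul_add, i1, i2, hR, mul_add]
      gcongr
    have hj : (0 : ℝ) ≤ σ ^ j / j.factorial := by positivity
    have hA' : 0 ≤ A * (1 + (δ + j) ^ q) := by positivity
    rw [norm_mul, norm_mul, norm_mul, Real.norm_eq_abs, Real.abs_exp, Real.norm_of_nonneg hj,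
      Real.norm_of_nonneg hτp.le, Real.norm_eq_abs]
    calc _ ≤ 1 * (σ ^ j / j.factorial * (τ ^ (δ + j - α) *
          (A * (1 + (δ + j) ^ q) * ((n : ℝ) ^ (δ + j - α - p) + (n : ℝ) ^ (-α - 1))))) := by
          gcongr
          exact hb j n hn
      _ = σ ^ j / j.factorial * (A * (1 + (δ + j) ^ q)) *
          (τ ^ (δ + j - α) * ((n : ℝ) ^ (δ + j - α - p) + (n : ℝ) ^ (-α - 1))) := by ring
      _ ≤ σ ^ j / j.factorial * (A * (1 + (δ + j) ^ q)) * (T ^ j * R) := by gcongr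
      _ = _ := by ring
  have := tsum_of_norm_bounded (hs.hasSum.mul_right R) hterm
  rwa [(h.hasSum_error hδ hσ hτ hn).tsum_eq] at this

/-! ### Passage to complex series and separation of singularities on the circle -/

/-- The coefficientwise real part of a complex power series. -/
def rePart (f : ℂ⟦X⟧) : ℝ⟦X⟧ := PowerSeries.mk fun n => (PowerSeries.coeff n f).re

theorem rePart_add (f g : ℂ⟦X⟧) : rePart (f + g) = rePart f + rePart g := by
  ext n; simp [rePart]

theorem rePart_map_mul (f : ℝ⟦X⟧) (g : ℂ⟦X⟧) :
    rePart (PowerSeries.map Complex.ofRealHom f * g) = f * rePart g := by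
  ext n
  simp [rePart, PowerSeries.coeff_mul]

theorem Decay.rePart {f : ℂ⟦X⟧} {a : ℝ} (hf : Decay f a) : Decay (rePart f) a := by
  obtain ⟨C, hC, hf⟩ := hf
  refine ⟨C, hC, fun n => le_trans ?_ (hf n)⟩
  simpa [TemperedFLMM.rePart] using Complex.abs_re_le_norm (PowerSeries.coeff n f)

theorem map_bin_one (a : ℝ) :
    PowerSeries.map Complex.ofRealHom (bin (1 : ℝ) a) = bin (1 : ℂ) a := by
  ext n
  simp [coeff_bin]

/-- The singularities are complex but the weights are real: taking real parts coefficientwise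
commutes with multiplication by the real series `(1-X)^M` and `(1-X)^α`, so a complex decomposition
gives a real one. -/
theorem IsQuad.of_complex {W : ℂ⟦X⟧} {g : ℝ → ℝ} {α κ : ℝ} {p : ℕ}
    (hsum : ∀ x : ℝ, |x| < 1 →
      HasSum (fun n => PowerSeries.coeff n W * (x : ℂ) ^ n) ((g x : ℝ) : ℂ))
    (hdec : ∀ M : ℕ, ∃ η φ : ℂ⟦X⟧, Decay η (κ + 1) ∧ Decay φ M ∧
      W = (1 - PowerSeries.X) ^ M * η + bin 1 α * φ)
    (hcons : (fun y => g (1 - y) - (-Real.log (1 - y)) ^ α) =O[𝓝[>] 0] fun y => y ^ (α + p)) :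
    IsQuad (taylorCoeff g) g α κ p := by
  have hs : ∀ x : ℝ, |x| < 1 →
      HasSum (fun n => (PowerSeries.coeff n W).re * x ^ n) (g x) := by
    intro x hx
    refine HasSum.of_forall_eq (Complex.hasSum_re (hsum x hx)) fun n => ?_
    rw [← Complex.ofReal_pow, Complex.re_mul_ofReal]
  have hω : taylorCoeff g = fun n => (PowerSeries.coeff n W).re := by
    refine taylorCoeff_eq_of_hasSum ?_
    filter_upwards [(continuous_abs.tendsto' (0 : ℝ) 0 abs_zero).eventually_lt_const one_pos]
      with x hx using hs x hx
  refine ⟨hω ▸ hs, fun M => ?_, hcons⟩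
  obtain ⟨η, φ, hη, hφ, h⟩ := hdec M
  refine ⟨rePart η, rePart φ, hη.rePart, hφ.rePart, ?_⟩
  rw [hω]
  change rePart W = _
  have e : ((1 - PowerSeries.X) ^ M : ℂ⟦X⟧) =
      PowerSeries.map Complex.ofRealHom ((1 - PowerSeries.X) ^ M) := by simp
  rw [h, rePart_add, e, rePart_map_mul, ← map_bin_one, rePart_map_mul]

theorem isCoprime_one_sub {ζ ξ : ℂ} (h : ζ ≠ ξ) :
    IsCoprime (1 - C ζ * X : ℂ[X]) (1 - C ξ * X) := by
  have h' : ζ - ξ ≠ 0 := sub_ne_zero.2 h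
  refine ⟨-C (ξ / (ζ - ξ)), C (ζ / (ζ - ξ)), ?_⟩
  have e : ζ / (ζ - ξ) - ξ / (ζ - ξ) = 1 := by field_simp
  have e2 : ζ / (ζ - ξ) * ξ = ξ / (ζ - ξ) * ζ := by ring
  have e' := congrArg C e
  have e2' := congrArg C e2
  simp only [C_sub, C_mul, C_1] at e' e2'
  linear_combination e' - X * e2'

/-- A product of algebraic singularities on the unit circle is, modulo smoother terms, the sum of
its localizations at the singularity `1` and away from `1`. -/
theorem exists_decomp_prod (s : Finset ℂ) (h1 : 1 ∈ s) (hs : ∀ ζ ∈ s, ‖ζ‖ ≤ 1) (γ : ℂ → ℝ)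
    (κ : ℝ) (hκ : ∀ ζ ∈ s, κ ≤ γ ζ) {G : ℂ⟦X⟧} (hG : Rapid G) (M : ℕ) :
    ∃ η φ : ℂ⟦X⟧, Decay η (κ + 1) ∧ Decay φ M ∧
      (∏ ζ ∈ s, bin ζ (γ ζ)) * G = (1 - PowerSeries.X) ^ M * η + bin 1 (γ 1) * φ := by
  classical
  set a : ℝ := |κ + 1| + 2 + M with ha
  -- `L` extra powers raise every exponent `γ ξ` to at least `a + 1`, so each factor has the decay
  -- `a + 2` needed in a product.
  obtain ⟨L, hL⟩ := exists_nat_ge (a + 1 - κ)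
  -- A partition of unity: the term of `ζ` carries `(1-ξX)^(L+M)` at every other point `ξ`. Of
  -- these, `L` powers smooth the singularity at `ξ`, and at `ξ = 1` the other `M` supply the factor
  -- `(1-X)^M`.
  obtain ⟨A, hA⟩ := (exists_sum_eq_one_iff_pairwise_coprime
    (s := fun ζ : ℂ => ((1 - C ζ * X) ^ (L + M) : ℂ[X])) ⟨1, h1⟩).2
    (fun ζ ξ hne => ((isCoprime_one_sub fun e => hne (Subtype.ext e)).pow))
  have hbinc : ∀ (ζ : ℂ) (k : ℕ), (((1 - C ζ * X) ^ k : ℂ[X]) : ℂ⟦X⟧) = bin ζ (k : ℝ) := by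
    intro ζ k; rw [bin_natCast]; simp
  have hA' : ∑ ζ ∈ s, (A ζ : ℂ⟦X⟧) * ∏ ξ ∈ s \ {ζ}, bin ξ ((L + M : ℕ) : ℝ) = 1 := by
    have := congrArg (fun q : ℂ[X] => (q : ℂ⟦X⟧)) hA
    simp only [Polynomial.coe_one] at this
    rw [← this, ← Polynomial.coeToPowerSeries.ringHom_apply, map_sum]
    refine Finset.sum_congr rfl fun ζ _ => ?_
    rw [map_mul, map_prod]
    simp only [Polynomial.coeToPowerSeries.ringHom_apply, hbinc]
  have ha0 : 0 ≤ a := by positivity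
  -- the regularized products
  set Q : ℂ → ℂ⟦X⟧ := fun ζ => ∏ ξ ∈ s \ {ζ}, bin ξ (γ ξ + L) with hQ
  have hQd : ∀ ζ, Decay (Q ζ) a := fun ζ => by
    refine decay_finset_prod _ ha0 fun ξ hξ => ?_
    have hξ' := (Finset.mem_sdiff.1 hξ).1
    refine (decay_bin (hs ξ hξ') _).mono ?_
    linarith [hκ ξ hξ']
  have hbinr : ∀ (ζ : ℂ) (k : ℕ), Rapid (bin ζ (k : ℝ)) := fun ζ k => hbinc ζ k ▸ rapid_coe _
  set N : ℂ → ℂ⟦X⟧ := fun ζ => ∏ ξ ∈ (s \ {ζ}).erase 1, bin ξ (M : ℝ) with hN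
  have hNr : ∀ ζ, Rapid (N ζ) := fun ζ => by
    simp only [hN, Finset.prod]
    exact Rapid.multiset_prod _ fun ξ _ => hbinr ξ M
  have hterm : ∀ ζ ∈ s, ((A ζ : ℂ⟦X⟧) * ∏ ξ ∈ s \ {ζ}, bin ξ ((L + M : ℕ) : ℝ)) *
      ((∏ ξ ∈ s, bin ξ (γ ξ)) * G) =
      bin ζ (γ ζ) * (Q ζ * ((A ζ : ℂ⟦X⟧) * ((∏ ξ ∈ s \ {ζ}, bin ξ (M : ℝ)) * G))) := by
    intro ζ hζ
    have e1 : ∏ ξ ∈ s, bin ξ (γ ξ) = bin ζ (γ ζ) * ∏ ξ ∈ s \ {ζ}, bin ξ (γ ξ) := by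
      rw [Finset.sdiff_singleton_eq_erase, Finset.mul_prod_erase s (fun ξ => bin ξ (γ ξ)) hζ]
    have e2 : (∏ ξ ∈ s \ {ζ}, bin ξ ((L + M : ℕ) : ℝ)) * ∏ ξ ∈ s \ {ζ}, bin ξ (γ ξ) =
        Q ζ * ∏ ξ ∈ s \ {ζ}, bin ξ (M : ℝ) := by
      rw [hQ, ← Finset.prod_mul_distrib, ← Finset.prod_mul_distrib]
      refine Finset.prod_congr rfl fun ξ _ => ?_
      rw [← bin_add, ← bin_add]
      push_cast; ring_nf
    rw [e1]
    linear_combination ((A ζ : ℂ⟦X⟧) * bin ζ (γ ζ) * G) * e2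
  have hMr : Rapid (∏ ξ ∈ s \ {1}, bin ξ (M : ℝ)) := by
    simp only [Finset.prod]
    exact Rapid.multiset_prod _ fun ξ _ => hbinr ξ M
  refine ⟨∑ ζ ∈ s.erase 1, bin ζ (γ ζ) * (Q ζ * ((A ζ : ℂ⟦X⟧) * (N ζ * G))),
    Q 1 * ((A 1 : ℂ⟦X⟧) * ((∏ ξ ∈ s \ {1}, bin ξ (M : ℝ)) * G)), ?_, ?_, ?_⟩
  · refine decay_sum _ fun ζ hζ => ?_
    have hζ' := Finset.mem_of_mem_erase hζ
    refine ((decay_bin (hs ζ hζ') _).mono (by linarith [hκ ζ hζ'] : κ + 1 ≤ γ ζ + 1)).mul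
      (b := |κ + 1| + 2) ?_ le_rfl
    refine ((hQd ζ).mul (((rapid_coe (A ζ)).mul ((hNr ζ).mul hG)) _) le_rfl).mono ?_
    rw [ha]; linarith [(Nat.cast_nonneg M : (0 : ℝ) ≤ M)]
  · refine ((hQd 1).mul (((rapid_coe (A 1)).mul (hMr.mul hG)) _) le_rfl).mono ?_
    rw [ha]; linarith [abs_nonneg (κ + 1)]
  · calc (∏ ζ ∈ s, bin ζ (γ ζ)) * G
        = ∑ ζ ∈ s, bin ζ (γ ζ) *
            (Q ζ * ((A ζ : ℂ⟦X⟧) * ((∏ ξ ∈ s \ {ζ}, bin ξ (M : ℝ)) * G))) := by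
          rw [← Finset.sum_congr rfl hterm, ← Finset.sum_mul, hA', one_mul]
      _ = _ := by
          rw [← Finset.add_sum_erase s _ h1, add_comm, Finset.mul_sum]
          congr 1
          refine Finset.sum_congr rfl fun ζ hζ => ?_
          have hm : (1 : ℂ) ∈ s \ {ζ} := by
            simp [h1, (Finset.ne_of_mem_erase hζ).symm]
          rw [← Finset.mul_prod_erase (s \ {ζ}) _ hm, bin_one_natCast]
          ring

/-! ### Factorization of multistep generating functions over the complex roots -/

theorem hasSum_multiset_prod_bin (R : Multiset ℂ) (hR : ∀ ζ ∈ R, ‖ζ‖ ≤ 1) (a : ℝ) {x : ℂ}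
    (hx : ‖x‖ < 1) : HasSum (fun n => PowerSeries.coeff n (R.map fun ζ => bin ζ a).prod * x ^ n)
      (R.map fun ζ : ℂ => (1 - ζ * (x : ℂ)) ^ (a : ℂ)).prod := by
  induction R using Multiset.induction_on with
  | empty => simpa using hasSum_coe (1 : ℂ[X]) x
  | cons ζ R ih =>
    simp only [Multiset.map_cons, Multiset.prod_cons]
    exact hasSum_coeff_mul (hasSum_bin_complex (hR ζ (by simp)) a hx)
      (ih fun ξ hξ => hR ξ (by simp [hξ]))

theorem one_sub_mul_mem_slitPlane {ζ : ℂ} (hζ : ‖ζ‖ ≤ 1) {x : ℝ} (hx : |x| < 1) :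
    1 - ζ * x ∈ Complex.slitPlane := by
  have h : ‖-(ζ * x)‖ < 1 := by
    rw [norm_neg, norm_mul, Complex.norm_real, Real.norm_eq_abs]
    exact (mul_le_of_le_one_left (abs_nonneg x) hζ).trans_lt hx
  simpa [sub_eq_add_neg] using Complex.mem_slitPlane_of_norm_lt_one h

theorem reverse_multiset_prod (R : Multiset ℂ) :
    (R.map fun ζ => X - C ζ).prod.reverse = (R.map fun ζ => 1 - C ζ * X).prod := by
  induction R using Multiset.induction_on with
  | empty => simp [show (1 : ℂ[X]) = C 1 from rfl, -map_one]
  | cons ζ R ih =>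
    simp only [Multiset.map_cons, Multiset.prod_cons]
    rw [reverse_mul_of_domain, ih]
    congr 1
    rw [sub_eq_add_neg, ← C_neg, add_comm, reverse_C_add]
    have h1 : (X : ℂ[X]).reverse = 1 := by
      simpa [show (1 : ℂ[X]) = C 1 from rfl, -map_one] using reverse_mul_X (1 : ℂ[X])
    rw [h1]
    rw [natDegree_X, pow_one, C_neg]
    ring

theorem map_conj_roots (q : ℝ[X]) :
    (q.map (algebraMap ℝ ℂ)).roots.map (starRingEnd ℂ) = (q.map (algebraMap ℝ ℂ)).roots := by
  have h := (IsAlgClosed.splits (q.map (algebraMap ℝ ℂ))).roots_map (starRingEnd ℂ)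
  rw [← h, Polynomial.map_map]
  congr 2
  ext x
  simp [Complex.conj_ofReal]

/-- The value at a real point of a product `∏ (1 - ζ x)` over the complex roots of a real
polynomial is positive, and its real powers are computed factorwise. -/
theorem exists_reverse_eval_eq (q : ℝ[X]) (hq : ∀ z : ℂ, aeval z q = 0 → ‖z‖ ≤ 1)
    {x : ℝ} (hx : |x| < 1) :
    ∃ P : ℝ, 0 < P ∧ q.reverse.eval x = q.leadingCoeff * P ∧
      ∀ a : ℝ, ((q.map (algebraMap ℝ ℂ)).roots.map fun ζ : ℂ => (1 - ζ * (x : ℂ)) ^ (a : ℂ)).prod =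
        ((P ^ a : ℝ) : ℂ) := by
  set R := (q.map (algebraMap ℝ ℂ)).roots with hR
  have hR1 : ∀ ζ ∈ R, ‖ζ‖ ≤ 1 := by
    intro ζ hζ
    refine hq ζ ?_
    have := isRoot_of_mem_roots hζ
    rwa [IsRoot, eval_map, ← aeval_def] at this
  -- The sum of principal logarithms is real, since the roots are stable under conjugation and the
  -- factors lie in the slit plane. Its exponential is `P`, and multiplying it by `a` before
  -- exponentiating gives the product of the principal powers, with no branch correction.
  set ℓ : ℂ := (R.map fun ζ : ℂ => Complex.log (1 - ζ * (x : ℂ))).sum with hℓ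
  have hconj : starRingEnd ℂ ℓ = ℓ := by
    rw [hℓ, map_multiset_sum, Multiset.map_map]
    conv_rhs => rw [hR, ← map_conj_roots, ← hR, Multiset.map_map]
    congr 1
    refine Multiset.map_congr rfl fun ζ hζ => ?_
    have := Complex.mem_slitPlane_iff_arg.1 (one_sub_mul_mem_slitPlane (hR1 ζ hζ) hx)
    simp only [Function.comp]
    rw [← Complex.log_conj _ this.1]
    simp
  have hre : ((ℓ.re : ℝ) : ℂ) = ℓ := Complex.conj_eq_iff_re.1 hconj
  have hprod : ∀ a : ℝ, (R.map fun ζ : ℂ => (1 - ζ * (x : ℂ)) ^ (a : ℂ)).prod =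
      ((Real.exp ℓ.re ^ a : ℝ) : ℂ) := by
    intro a
    have h : (R.map fun ζ : ℂ => (1 - ζ * (x : ℂ)) ^ (a : ℂ)).prod = Complex.exp (ℓ * a) := by
      rw [hℓ, ← Multiset.sum_map_mul_right, Complex.exp_multiset_sum, Multiset.map_map]
      congr 1
      refine Multiset.map_congr rfl fun ζ hζ => ?_
      rw [Complex.cpow_def_of_ne_zero
        (Complex.slitPlane_ne_zero (one_sub_mul_mem_slitPlane (hR1 ζ hζ) hx))]
      rfl
    rw [h, ← Real.exp_mul, Complex.ofReal_exp, Complex.ofReal_mul, hre]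
  refine ⟨Real.exp ℓ.re, Real.exp_pos _, ?_, hprod⟩
  have h1 := hprod 1
  simp only [Complex.ofReal_one, Complex.cpow_one, Real.rpow_one] at h1
  have h2 : q.map (algebraMap ℝ ℂ) =
      C (q.leadingCoeff : ℂ) * (R.map fun ζ => X - C ζ).prod := by
    have := (IsAlgClosed.splits (q.map (algebraMap ℝ ℂ))).eq_prod_roots
    rwa [leadingCoeff_map_of_injective (algebraMap ℝ ℂ).injective] at this
  have h3 : (q.map (algebraMap ℝ ℂ)).reverse = q.reverse.map (algebraMap ℝ ℂ) := by
    ext n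
    simp [coeff_reverse, natDegree_map_eq_of_injective (algebraMap ℝ ℂ).injective]
  have h4 := congrArg (fun r : ℂ[X] => r.reverse.eval (x : ℂ)) h2
  simp only [h3, reverse_mul_of_domain, reverse_C, reverse_multiset_prod, eval_mul, eval_C,
    eval_multiset_prod, Multiset.map_map, Function.comp_def, eval_sub, eval_one, eval_X, h1] at h4
  rw [show (x : ℂ) = algebraMap ℝ ℂ x from rfl, eval_map_apply] at h4
  simp only [Complex.coe_algebraMap] at h4
  exact_mod_cast h4

theorem LMMStable.ne_zero {q : ℝ[X]} (hq : LMMStable q) : q ≠ 0 := by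
  rintro rfl
  have := (hq 2 (by simp)).1
  norm_num at this

theorem LMMStable.norm_root_le {q : ℝ[X]} (hq : LMMStable q) {ζ : ℂ}
    (hζ : ζ ∈ (q.map (algebraMap ℝ ℂ)).roots) : aeval ζ q = 0 ∧ ‖ζ‖ ≤ 1 := by
  have h0 : aeval ζ q = 0 := by
    have := isRoot_of_mem_roots hζ
    rwa [IsRoot, eval_map, ← aeval_def] at this
  exact ⟨h0, (hq ζ h0).1⟩

/-- The roots of a polynomial on the unit circle. -/
def circleRoots (q : ℝ[X]) : Finset ℂ :=
  {ζ ∈ (q.map (algebraMap ℝ ℂ)).roots.toFinset | ‖ζ‖ = 1}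

theorem mem_circleRoots {q : ℝ[X]} (hq : q ≠ 0) {ζ : ℂ} :
    ζ ∈ circleRoots q ↔ aeval ζ q = 0 ∧ ‖ζ‖ = 1 := by
  have h : q.map (algebraMap ℝ ℂ) ≠ 0 := (Polynomial.map_ne_zero_iff (algebraMap ℝ ℂ).injective).2 hq
  simp [circleRoots, mem_roots h, IsRoot, eval_map, aeval_def]

/-- Roots inside the disc give rapidly decaying factors. Stability makes the roots on the circle
simple, so their multiset is a finite set and each contributes exactly one factor. -/
theorem LMMStable.prod_roots_bin {q : ℝ[X]} (hq : LMMStable q) (a : ℝ) :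
    ∃ G : ℂ⟦X⟧, Rapid G ∧ ((q.map (algebraMap ℝ ℂ)).roots.map fun ζ : ℂ => bin ζ a).prod =
      (∏ ζ ∈ circleRoots q, bin ζ a) * G := by
  classical
  set R := (q.map (algebraMap ℝ ℂ)).roots with hR
  refine ⟨((R.filter fun ζ => ¬ ‖ζ‖ = 1).map fun ζ => bin ζ a).prod, ?_, ?_⟩
  · refine Rapid.multiset_prod _ fun ζ hζ => ?_
    obtain ⟨h1, h2⟩ := Multiset.mem_filter.1 hζ
    exact rapid_bin (lt_of_le_of_ne (hq.norm_root_le h1).2 h2) a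
  · have hnd : (R.filter fun ζ => ‖ζ‖ = 1).Nodup := by
      rw [Multiset.nodup_iff_count_le_one]
      intro ζ
      rw [Multiset.count_filter]
      split_ifs with h
      · rw [hR, count_roots]
        by_contra hlt
        rw [not_le] at hlt
        obtain ⟨h1, h2⟩ := (one_lt_rootMultiplicity_iff_isRoot
          ((Polynomial.map_ne_zero_iff (algebraMap ℝ ℂ).injective).2 hq.ne_zero)).1 hlt
        rw [derivative_map] at h2
        rw [IsRoot, eval_map, ← aeval_def] at h1 h2
        exact (hq ζ h1).2 h h2
      · exact zero_le_one
    have hval : (circleRoots q).val = R.filter fun ζ => ‖ζ‖ = 1 := by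
      rw [← hnd.dedup, ← Multiset.toFinset_val, Multiset.toFinset_filter, circleRoots, ← hR]
    rw [Finset.prod, hval, ← Multiset.prod_add, ← Multiset.map_add, Multiset.filter_add_not]

/-! ### Consistency of multistep methods, transported to the point `1` -/

theorem tendsto_neg_log_one_sub :
    Tendsto (fun y : ℝ => -Real.log (1 - y)) (𝓝[>] 0) (𝓝[>] 0) := by
  refine tendsto_nhdsWithin_iff.2 ⟨?_, ?_⟩
  · have h : ContinuousAt (fun y : ℝ => -Real.log (1 - y)) 0 := by
      have : (1 : ℝ) - 0 ≠ 0 := by norm_num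
      fun_prop (disch := assumption)
    have := h.tendsto
    simp only [sub_zero, Real.log_one, neg_zero] at this
    exact this.mono_left nhdsWithin_le_nhds
  · filter_upwards [Ioo_mem_nhdsGT (one_pos : (0 : ℝ) < 1)] with y hy
    have := Real.log_neg (x := 1 - y) (by linarith [hy.2]) (by linarith [hy.1])
    simpa using this

theorem isBigO_neg_log_rpow (a : ℝ) :
    (fun y : ℝ => (-Real.log (1 - y)) ^ a) =O[𝓝[>] 0] fun y => y ^ a := by
  have h1 : (fun y => logQuot y ^ a) =O[𝓝[>] 0] fun _ => (1 : ℝ) :=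
    ((analyticAt_logQuot_rpow a).continuousAt.tendsto.mono_left nhdsWithin_le_nhds).isBigO_one ℝ
  have h2 := (isBigO_refl (fun y : ℝ => y ^ a) (𝓝[>] 0)).mul h1
  simp only [mul_one] at h2
  refine h2.congr' ?_ EventuallyEq.rfl
  filter_upwards [Ioo_mem_nhdsGT (one_pos : (0 : ℝ) < 1)] with y hy
  rw [← Real.mul_rpow hy.1.le (logQuot_pos hy.2).le, mul_logQuot]

section Consistency

variable {ρ s : ℝ[X]} {p : ℕ}

theorem LMMConsistent.eval_one (hc : LMMConsistent ρ s p) : ρ.eval 1 = 0 := by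
  obtain ⟨C, hC⟩ := hc.bound
  have := hC.self_of_nhds
  simpa using this

theorem LMMConsistent.isBigO_sub (hc : LMMConsistent ρ s p) (hs : s.eval 1 ≠ 0) :
    (fun h : ℝ => ρ.eval (Real.exp h) / s.eval (Real.exp h) - h) =O[𝓝 0]
      fun h => h ^ (p + 1) := by
  have hcont : ContinuousAt (fun h : ℝ => s.eval (Real.exp h)) 0 := by fun_prop
  have hs0 : (fun h : ℝ => s.eval (Real.exp h)) 0 ≠ 0 := by simpa using hs
  have h1 : (fun h : ℝ => (s.eval (Real.exp h))⁻¹) =O[𝓝 0] fun _ => (1 : ℝ) :=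
    (hcont.inv₀ hs0).tendsto.isBigO_one ℝ
  have h2 := IsBigO.mul hc h1
  simp only [mul_one] at h2
  refine h2.congr' ?_ EventuallyEq.rfl
  filter_upwards [hcont.eventually_ne hs0] with h hh
  field_simp

theorem LMMConsistent.isBigO_quot (hc : LMMConsistent ρ s p) (hs : s.eval 1 ≠ 0) :
    (fun h : ℝ => ρ.eval (Real.exp h) / s.eval (Real.exp h) / h - 1) =O[𝓝[>] 0]
      fun h => h ^ p := by
  have h1 := ((hc.isBigO_sub hs).mono (nhdsWithin_le_nhds (s := Set.Ioi 0))).mul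
    (isBigO_refl (fun h : ℝ => h⁻¹) (𝓝[>] 0))
  refine h1.congr' ?_ ?_
  · filter_upwards [self_mem_nhdsWithin] with h hh
    have : h ≠ 0 := (Set.mem_Ioi.1 hh).ne'
    field_simp
  · filter_upwards [self_mem_nhdsWithin] with h hh
    have : h ≠ 0 := (Set.mem_Ioi.1 hh).ne'
    rw [pow_succ]
    field_simp

theorem LMMConsistent.tendsto_quot (hp : 1 ≤ p) (hc : LMMConsistent ρ s p) (hs : s.eval 1 ≠ 0) :
    Tendsto (fun h : ℝ => ρ.eval (Real.exp h) / s.eval (Real.exp h) / h) (𝓝[>] 0) (𝓝 1) := by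
  have h0 : Tendsto (fun h : ℝ => h ^ p) (𝓝[>] 0) (𝓝 0) := by
    have : ContinuousAt (fun h : ℝ => h ^ p) 0 := by fun_prop
    have := this.tendsto
    rw [zero_pow (by omega)] at this
    exact this.mono_left nhdsWithin_le_nhds
  have := ((hc.isBigO_quot hs).trans_tendsto h0).add_const 1
  simpa using this

/-- Divide by `h^α`: the quotient `ρ/(s h)` is `1 + O(h^p)`, and `x ↦ x^α` is differentiable at `1`.
-/
theorem LMMConsistent.isBigO_rpow_sub (hp : 1 ≤ p) (hc : LMMConsistent ρ s p)
    (hs : s.eval 1 ≠ 0) (α : ℝ) :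
    (fun h : ℝ => (ρ.eval (Real.exp h) / s.eval (Real.exp h)) ^ α - h ^ α) =O[𝓝[>] 0]
      fun h => h ^ (α + p) := by
  have ht := hc.tendsto_quot hp hs
  have h1 := ((Real.hasDerivAt_rpow_const (x := 1) (p := α) (Or.inl one_ne_zero)).isBigO_sub).comp_tendsto ht
  have h2 := (isBigO_refl (fun h : ℝ => h ^ α) (𝓝[>] 0)).mul (h1.trans (hc.isBigO_quot hs))
  refine h2.congr' ?_ ?_
  · filter_upwards [self_mem_nhdsWithin, ht.eventually_const_lt one_pos] with h hh hq
    have hh' : 0 < h := hh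
    simp only [Function.comp, Real.one_rpow]
    rw [mul_sub, ← Real.mul_rpow hh'.le hq.le, mul_div_cancel₀ _ hh'.ne', mul_one]
  · filter_upwards [self_mem_nhdsWithin] with h hh
    rw [Real.rpow_add hh, Real.rpow_natCast]

theorem reverse_eval_exp_neg (q : ℝ[X]) (h : ℝ) :
    q.reverse.eval (Real.exp (-h)) * Real.exp h ^ q.natDegree = q.eval (Real.exp h) := by
  let inst : Invertible (Real.exp h) := invertibleOfNonzero (Real.exp_pos h).ne'
  have := eval₂_reverse_mul_pow (RingHom.id ℝ) (Real.exp h) q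
  rw [invOf_eq_inv, ← Real.exp_neg] at this
  simpa [eval₂_id] using this

/-- With `1 - y = e^(-h)`, reversing a polynomial is evaluation at `e^h` up to a power of `e^h`;
equal degrees make these powers cancel. -/
theorem reverse_quot_eq (hdeg : s.natDegree = ρ.natDegree) {y : ℝ} (hy : y < 1) :
    ρ.reverse.eval (1 - y) / s.reverse.eval (1 - y) =
      ρ.eval (Real.exp (-Real.log (1 - y))) / s.eval (Real.exp (-Real.log (1 - y))) := by
  have h1 := reverse_eval_exp_neg ρ (-Real.log (1 - y))
  have h2 := reverse_eval_exp_neg s (-Real.log (1 - y))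
  rw [neg_neg, Real.exp_log (by linarith)] at h1 h2
  rw [← h1, ← h2, hdeg, mul_div_mul_right _ _ (pow_ne_zero _ (Real.exp_pos _).ne')]

theorem LMMConsistent.reverse_quot_pos (hp : 1 ≤ p) (hdeg : s.natDegree = ρ.natDegree)
    (hc : LMMConsistent ρ s p) (hs : s.eval 1 ≠ 0) :
    ∀ᶠ y in 𝓝[>] (0 : ℝ), 0 < ρ.reverse.eval (1 - y) / s.reverse.eval (1 - y) := by
  filter_upwards [Ioo_mem_nhdsGT (one_pos : (0 : ℝ) < 1), tendsto_neg_log_one_sub.eventually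
    (((hc.tendsto_quot hp hs).eventually_const_lt one_pos).and self_mem_nhdsWithin)] with y hy h
  rw [reverse_quot_eq hdeg hy.2]
  have := mul_pos h.1 h.2
  rwa [div_mul_cancel₀ _ (ne_of_gt h.2)] at this

theorem LMMConsistent.cons (hp : 1 ≤ p) (hdeg : s.natDegree = ρ.natDegree)
    (hc : LMMConsistent ρ s p) (hs : s.eval 1 ≠ 0) {g : ℝ → ℝ} {α : ℝ}
    (hg : ∀ x, |x| < 1 → g x = (s.reverse.eval x / ρ.reverse.eval x) ^ (-α)) :
    (fun y => g (1 - y) - (-Real.log (1 - y)) ^ α) =O[𝓝[>] 0] fun y => y ^ (α + p) := by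
  have h1 := ((hc.isBigO_rpow_sub hp hs α).comp_tendsto tendsto_neg_log_one_sub).trans
    (isBigO_neg_log_rpow (α + p))
  refine h1.congr' ?_ EventuallyEq.rfl
  filter_upwards [Ioo_mem_nhdsGT (one_pos : (0 : ℝ) < 1), hc.reverse_quot_pos hp hdeg hs]
    with y hy hpos
  simp only [Function.comp]
  rw [← reverse_quot_eq hdeg hy.2, hg _ (abs_lt.2 ⟨by linarith [hy.2], by linarith [hy.1]⟩),
    ← inv_div (ρ.reverse.eval (1 - y)), Real.inv_rpow hpos.le, Real.rpow_neg hpos.le, inv_inv]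

end Consistency

/-- The generating function of a stable and consistent linear multistep method, raised to the
power `α`, is a convolution quadrature. -/
theorem isQuad_of_lmm {ρ s : ℝ[X]} {g : ℝ → ℝ} {α κ : ℝ} {p : ℕ} (hp : 1 ≤ p)
    (hdeg : s.natDegree = ρ.natDegree) (hρ : LMMStable ρ) (hs : LMMStable s)
    (hc : LMMConsistent ρ s p)
    (hsep : ∀ z : ℂ, ‖z‖ = 1 → aeval z s = 0 → aeval z ρ ≠ 0 ∧ κ ≤ -α) (hκ : κ ≤ α)
    (hg : ∀ x, |x| < 1 → g x = (s.reverse.eval x / ρ.reverse.eval x) ^ (-α)) :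
    IsQuad (taylorCoeff g) g α κ p := by
  classical
  have hρ1 : aeval (1 : ℂ) ρ = 0 := by
    have := congrArg (algebraMap ℝ ℂ) hc.eval_one
    rwa [← aeval_algebraMap_apply_eq_algebraMap_eval, map_one, map_zero] at this
  have hs1 : s.eval 1 ≠ 0 := by
    intro h
    refine (hsep 1 (by simp) ?_).1 hρ1
    have := congrArg (algebraMap ℝ ℂ) h
    rwa [← aeval_algebraMap_apply_eq_algebraMap_eval, map_one, map_zero] at this
  have hcons := hc.cons hp hdeg hs1 hg
  -- the value of the generating function
  set K : ℝ := ρ.leadingCoeff / s.leadingCoeff with hKdef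
  have hrev : ∀ x : ℝ, |x| < 1 → ∃ P Q : ℝ, 0 < P ∧ 0 < Q ∧
      ρ.reverse.eval x / s.reverse.eval x = K * (P / Q) ∧
      (∀ a : ℝ, ((ρ.map (algebraMap ℝ ℂ)).roots.map fun ζ : ℂ => (1 - ζ * (x : ℂ)) ^ (a : ℂ)).prod =
        ((P ^ a : ℝ) : ℂ)) ∧
      (∀ a : ℝ, ((s.map (algebraMap ℝ ℂ)).roots.map fun ζ : ℂ => (1 - ζ * (x : ℂ)) ^ (a : ℂ)).prod =
        ((Q ^ a : ℝ) : ℂ)) := by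
    intro x hx
    obtain ⟨P, hP, hP1, hP2⟩ := exists_reverse_eval_eq ρ (fun z hz => (hρ z hz).1) hx
    obtain ⟨Q, hQ, hQ1, hQ2⟩ := exists_reverse_eval_eq s (fun z hz => (hs z hz).1) hx
    refine ⟨P, Q, hP, hQ, ?_, hP2, hQ2⟩
    rw [hP1, hQ1, hKdef, mul_div_mul_comm]
  -- The sign of the ratio of leading coefficients is read off near `x = 1`, where the quotient is
  -- close to `-log x > 0`.
  have hK : 0 < K := by
    obtain ⟨y, hpos, hy⟩ := ((hc.reverse_quot_pos hp hdeg hs1).and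
      (Ioo_mem_nhdsGT (one_pos : (0 : ℝ) < 1))).exists
    obtain ⟨P, Q, hP, hQ, e, -⟩ := hrev (1 - y) (abs_lt.2 ⟨by linarith [hy.2], by linarith [hy.1]⟩)
    rw [e] at hpos
    exact pos_of_mul_pos_left hpos (by positivity)
  obtain ⟨G₁, hG₁, e₁⟩ := hρ.prod_roots_bin α
  obtain ⟨G₂, hG₂, e₂⟩ := hs.prod_roots_bin (-α)
  refine IsQuad.of_complex (W := PowerSeries.C ((K ^ α : ℝ) : ℂ) *
    (((ρ.map (algebraMap ℝ ℂ)).roots.map fun ζ : ℂ => bin ζ α).prod *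
      ((s.map (algebraMap ℝ ℂ)).roots.map fun ζ : ℂ => bin ζ (-α)).prod)) ?_ ?_ hcons
  · intro x hx
    obtain ⟨P, Q, hP, hQ, e, hPa, hQa⟩ := hrev x hx
    have hx' : ‖(x : ℂ)‖ < 1 := by simpa using hx
    have e3 : g x = K ^ α * (P ^ α * Q ^ (-α)) := by
      rw [hg x hx, ← inv_div, e, Real.inv_rpow (by positivity), Real.rpow_neg (by positivity),
        inv_inv, Real.mul_rpow hK.le (by positivity), Real.div_rpow hP.le hQ.le,
        Real.rpow_neg hQ.le, div_eq_mul_inv]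
    rw [e3, Complex.ofReal_mul, Complex.ofReal_mul, ← hPa, ← hQa]
    refine hasSum_coeff_mul ?_ (hasSum_coeff_mul
      (hasSum_multiset_prod_bin _ (fun ζ h => (hρ.norm_root_le h).2) α hx')
      (hasSum_multiset_prod_bin _ (fun ζ h => (hs.norm_root_le h).2) (-α) hx'))
    simpa using hasSum_coe (C ((K ^ α : ℝ) : ℂ)) (x : ℂ)
  · intro M
    have hd : Disjoint (circleRoots ρ) (circleRoots s) := by
      rw [Finset.disjoint_left]
      intro ζ h1 h2
      rw [mem_circleRoots hρ.ne_zero] at h1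
      rw [mem_circleRoots hs.ne_zero] at h2
      exact (hsep ζ h2.2 h2.1).1 h1.1
    -- The exponent of the singularity at `ζ`: `α` at the circle roots of `ρ`, `-α` at those of `s`,
    -- the two sets being disjoint.
    set γ : ℂ → ℝ := fun ζ => if ζ ∈ circleRoots ρ then α else -α with hγ
    have h1 : (1 : ℂ) ∈ circleRoots ρ := (mem_circleRoots hρ.ne_zero).2 ⟨hρ1, by simp⟩
    obtain ⟨η, φ, hη, hφ, e⟩ := exists_decomp_prod (circleRoots ρ ∪ circleRoots s)
      (Finset.mem_union_left _ h1) (fun ζ hζ => by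
        rcases Finset.mem_union.1 hζ with h | h
        · exact ((mem_circleRoots hρ.ne_zero).1 h).2.le
        · exact ((mem_circleRoots hs.ne_zero).1 h).2.le) γ κ (fun ζ hζ => by
        simp only [hγ]
        split_ifs with h
        · exact hκ
        · have := (mem_circleRoots hs.ne_zero).1 ((Finset.mem_union.1 hζ).resolve_left h)
          exact (hsep ζ this.2 this.1).2)
      ((rapid_C ((K ^ α : ℝ) : ℂ)).mul (hG₁.mul hG₂)) M
    refine ⟨η, φ, hη, hφ, ?_⟩
    have hγ1 : γ 1 = α := if_pos h1
    rw [hγ1] at e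
    rw [← e, e₁, e₂, Finset.prod_union hd,
      Finset.prod_congr rfl (fun ζ hζ => by rw [hγ]; simp only [if_pos hζ] :
        ∀ ζ ∈ circleRoots ρ, bin ζ (γ ζ) = bin ζ α),
      Finset.prod_congr rfl (fun ζ hζ => by
        rw [hγ]; simp only [if_neg (Finset.disjoint_right.1 hd hζ)] :
        ∀ ζ ∈ circleRoots s, bin ζ (γ ζ) = bin ζ (-α))]
    ring

/-! ### Backward difference formulas -/

/-- The value `Q` of a polynomial at a point dominates the value `Q'` of its reciprocal
polynomial. -/
def SchurDominates (Q Q' : ℂ) : Prop := Q ≠ 0 ∧ ‖Q'‖ ≤ ‖Q‖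

theorem schurDominates_one : SchurDominates 1 1 := ⟨one_ne_zero, le_rfl⟩

/-- One step of the Schur-Cohn recursion, at a point outside the open unit disc. -/
theorem SchurDominates.step {R R' Q Q' z c : ℂ} {a b : ℝ} (h : SchurDominates R R')
    (hz : 1 ≤ ‖z‖) (hab : |b| < |a|) (hc : c ≠ 0) (hQ : c * Q = a * (z * R) + b * R')
    (hQ' : c * Q' = a * R' + b * (z * R)) : SchurDominates Q Q' := by
  have hw : ‖R'‖ ≤ ‖z * R‖ := by
    rw [norm_mul]
    exact h.2.trans (le_mul_of_one_le_left (norm_nonneg _) hz)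
  have hw0 : 0 < ‖z * R‖ := by
    rw [norm_mul]
    exact mul_pos (one_pos.trans_le hz) (norm_pos_iff.2 h.1)
  -- The difference of the squared norms is `(a² - b²)(‖zR‖² - ‖R'‖²)`, the mixed terms being equal
  -- because `a` and `b` are real.
  have key : ‖a * R' + b * (z * R)‖ ≤ ‖a * (z * R) + b * R'‖ := by
    refine le_of_sq_le_sq ?_ (norm_nonneg _)
    have h1 : ‖R'‖ ^ 2 ≤ ‖z * R‖ ^ 2 := by gcongr
    have h2 : b ^ 2 ≤ a ^ 2 := sq_le_sq.2 hab.le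
    generalize z * R = w at *
    rw [Complex.sq_norm, Complex.sq_norm, Complex.normSq_apply, Complex.normSq_apply] at h1 ⊢
    simp only [Complex.add_re, Complex.add_im, Complex.re_ofReal_mul, Complex.im_ofReal_mul]
    nlinarith [mul_nonneg (sub_nonneg.2 h2) (sub_nonneg.2 h1)]
  have hpos : 0 < ‖a * (z * R) + b * R'‖ := by
    have h1 : ‖(b : ℂ) * R'‖ < ‖(a : ℂ) * (z * R)‖ := by
      rw [norm_mul _ R', norm_mul _ (z * R), Complex.norm_real, Complex.norm_real,
        Real.norm_eq_abs, Real.norm_eq_abs]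
      calc |b| * ‖R'‖ ≤ |b| * ‖z * R‖ := by gcongr
        _ < |a| * ‖z * R‖ := by gcongr
    have h2 := norm_sub_le_norm_add ((a : ℂ) * (z * R)) (b * R')
    linarith
  rw [← hQ, ← hQ', norm_mul, norm_mul] at key
  rw [← hQ] at hpos
  exact ⟨right_ne_zero_of_mul (norm_pos_iff.1 hpos),
    le_of_mul_le_mul_left key (norm_pos_iff.2 hc)⟩

/-- In this and the next four proofs the polynomials come from the Schur-Cohn reduction read
backwards. With `a` the leading and `b` the constant coefficient of `Q`, and `Q*` its reciprocal,
the preceding polynomial is `(a Q - b Q*) / z`, cleared of common factors; `c` is the resulting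
scalar. -/
theorem bdf2_factor_ne_zero {z : ℂ} (hz : 1 ≤ ‖z‖) : 3 * z - 1 ≠ 0 :=
  (by
    have h0 := schurDominates_one
    have h1 : SchurDominates (3 * z - 1) (-1 * z + 3) :=
      h0.step (a := 3) (b := -1) (c := 1) hz (by norm_num) (by norm_num)
        (by push_cast; ring) (by push_cast; ring)
    exact h1.1)

theorem bdf3_factor_ne_zero {z : ℂ} (hz : 1 ≤ ‖z‖) : 11 * z ^ 2 - 7 * z + 2 ≠ 0 :=
  (by
    have h0 := schurDominates_one
    have h1 : SchurDominates (13 * z - 7) (-7 * z + 13) :=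
      h0.step (a := 13) (b := -7) (c := 1) hz (by norm_num) (by norm_num)
        (by push_cast; ring) (by push_cast; ring)
    have h2 : SchurDominates (11 * z ^ 2 - 7 * z + 2) (2 * z ^ 2 - 7 * z + 11) :=
      h1.step (a := 11) (b := 2) (c := 13) hz (by norm_num) (by norm_num)
        (by push_cast; ring) (by push_cast; ring)
    exact h2.1)

theorem bdf4_factor_ne_zero {z : ℂ} (hz : 1 ≤ ‖z‖) : 25 * z ^ 3 - 23 * z ^ 2 + 13 * z - 3 ≠ 0 :=
  (by
    have h0 := schurDominates_one
    have h1 : SchurDominates (109 * z - 67) (-67 * z + 109) :=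
      h0.step (a := 109) (b := -67) (c := 1) hz (by norm_num) (by norm_num)
        (by push_cast; ring) (by push_cast; ring)
    have h2 : SchurDominates (77 * z ^ 2 - 67 * z + 32) (32 * z ^ 2 - 67 * z + 77) :=
      h1.step (a := 77) (b := 32) (c := 109) hz (by norm_num) (by norm_num)
        (by push_cast; ring) (by push_cast; ring)
    have h3 : SchurDominates (25 * z ^ 3 - 23 * z ^ 2 + 13 * z - 3) (-3 * z ^ 3 + 13 * z ^ 2 - 23 * z + 25) :=
      h2.step (a := 25) (b := -3) (c := 77) hz (by norm_num) (by norm_num)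
        (by push_cast; ring) (by push_cast; ring)
    exact h3.1)

theorem bdf5_factor_ne_zero {z : ℂ} (hz : 1 ≤ ‖z‖) : 137 * z ^ 4 - 163 * z ^ 3 + 137 * z ^ 2 - 63 * z + 12 ≠ 0 :=
  (by
    have h0 := schurDominates_one
    have h1 : SchurDominates (19091 * z - 11501) (-11501 * z + 19091) :=
      h0.step (a := 19091) (b := -11501) (c := 1) hz (by norm_num) (by norm_num)
        (by push_cast; ring) (by push_cast; ring)
    have h2 : SchurDominates (60467 * z ^ 2 - 57505 * z + 34988) (34988 * z ^ 2 - 57505 * z + 60467) :=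
      h1.step (a := 60467) (b := 34988) (c := 19091) hz (by norm_num) (by norm_num)
        (by push_cast; ring) (by push_cast; ring)
    have h3 : SchurDominates (745 * z ^ 3 - 863 * z ^ 2 + 685 * z - 267) (-267 * z ^ 3 + 685 * z ^ 2 - 863 * z + 745) :=
      h2.step (a := 745) (b := -267) (c := 60467) hz (by norm_num) (by norm_num)
        (by push_cast; ring) (by push_cast; ring)
    have h4 : SchurDominates (137 * z ^ 4 - 163 * z ^ 3 + 137 * z ^ 2 - 63 * z + 12) (12 * z ^ 4 - 63 * z ^ 3 + 137 * z ^ 2 - 163 * z + 137) :=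
      h3.step (a := 137) (b := 12) (c := 745) hz (by norm_num) (by norm_num)
        (by push_cast; ring) (by push_cast; ring)
    exact h4.1)

theorem bdf6_factor_ne_zero {z : ℂ} (hz : 1 ≤ ‖z‖) : 147 * z ^ 5 - 213 * z ^ 4 + 237 * z ^ 3 - 163 * z ^ 2 + 62 * z - 10 ≠ 0 :=
  (by
    have h0 := schurDominates_one
    have h1 : SchurDominates (413869 * z - 206179) (-206179 * z + 413869) :=
      h0.step (a := 413869) (b := -206179) (c := 1) hz (by norm_num) (by norm_num)
        (by push_cast; ring) (by push_cast; ring)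
    have h2 : SchurDominates (20637463 * z ^ 2 - 17112857 * z + 13713664) (13713664 * z ^ 2 - 17112857 * z + 20637463) :=
      h1.step (a := 20637463) (b := 13713664) (c := 413869) hz (by norm_num) (by norm_num)
        (by push_cast; ring) (by push_cast; ring)
    have h3 : SchurDominates (2364919 * z ^ 3 - 2910521 * z ^ 2 + 2756347 * z - 1428885) (-1428885 * z ^ 3 + 2756347 * z ^ 2 - 2910521 * z + 2364919) :=
      h2.step (a := 2364919) (b := -1428885) (c := 20637463) hz (by norm_num) (by norm_num)
        (by push_cast; ring) (by push_cast; ring)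
    have h4 : SchurDominates (21509 * z ^ 4 - 30691 * z ^ 3 + 33209 * z ^ 2 - 21591 * z + 6984) (6984 * z ^ 4 - 21591 * z ^ 3 + 33209 * z ^ 2 - 30691 * z + 21509) :=
      h3.step (a := 21509) (b := 6984) (c := 2364919) hz (by norm_num) (by norm_num)
        (by push_cast; ring) (by push_cast; ring)
    have h5 : SchurDominates (147 * z ^ 5 - 213 * z ^ 4 + 237 * z ^ 3 - 163 * z ^ 2 + 62 * z - 10) (-10 * z ^ 5 + 62 * z ^ 4 - 163 * z ^ 3 + 237 * z ^ 2 - 213 * z + 147) :=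
      h4.step (a := 147) (b := -10) (c := 21509) hz (by norm_num) (by norm_num)
        (by push_cast; ring) (by push_cast; ring)
    exact h5.1)

/-- The first characteristic polynomial of the backward difference formula of order `p`. -/
def bdfPoly (p : ℕ) : ℝ[X] := ∑ k ∈ Finset.Icc 1 p, C (1 / (k : ℝ)) * (X ^ (p - k) * (X - 1) ^ k)

theorem aeval_bdfPoly (p : ℕ) (z : ℂ) :
    aeval z (bdfPoly p) = ∑ k ∈ Finset.Icc 1 p, (1 / (k : ℂ)) * (z ^ (p - k) * (z - 1) ^ k) := by
  simp [bdfPoly, map_sum]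

/-- `bdfPoly p` times the least common multiple of `1, …, p` is `z - 1` times the polynomial shown
above to have no zero with `‖z‖ ≥ 1`. -/
theorem aeval_bdfPoly_ne_zero {p : ℕ} (hp : 1 ≤ p) (hp6 : p ≤ 6) {z : ℂ} (hz : 1 ≤ ‖z‖)
    (hz1 : z ≠ 1) : aeval z (bdfPoly p) ≠ 0 := by
  have h1 := sub_ne_zero.2 hz1
  rw [aeval_bdfPoly]
  interval_cases p
  · simpa using h1
  · have h := mul_ne_zero h1 (bdf2_factor_ne_zero hz)
    contrapose! h
    simp [Finset.sum_Icc_succ_top] at h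
    linear_combination 2 * h
  · have h := mul_ne_zero h1 (bdf3_factor_ne_zero hz)
    contrapose! h
    simp [Finset.sum_Icc_succ_top] at h
    linear_combination 6 * h
  · have h := mul_ne_zero h1 (bdf4_factor_ne_zero hz)
    contrapose! h
    simp [Finset.sum_Icc_succ_top] at h
    linear_combination 12 * h
  · have h := mul_ne_zero h1 (bdf5_factor_ne_zero hz)
    contrapose! h
    simp [Finset.sum_Icc_succ_top] at h
    linear_combination 60 * h
  · have h := mul_ne_zero h1 (bdf6_factor_ne_zero hz)
    contrapose! h
    simp [Finset.sum_Icc_succ_top] at h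
    linear_combination 60 * h

theorem lmmStable_bdfPoly {p : ℕ} (hp : 1 ≤ p) (hp6 : p ≤ 6) : LMMStable (bdfPoly p) := by
  intro z hz
  have hz1 : 1 ≤ ‖z‖ → z = 1 := fun h => by
    by_contra hne
    exact aeval_bdfPoly_ne_zero hp hp6 h hne hz
  refine ⟨?_, fun h => ?_⟩
  · by_contra hlt
    rw [not_le] at hlt
    rw [hz1 hlt.le, norm_one] at hlt
    exact lt_irrefl _ hlt
  · rw [hz1 h.ge, bdfPoly]
    simp only [derivative_mul, map_sum]
    -- The terms with `k ≥ 2` vanish to second order at `1`, so the derivative there comes from `k =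
    -- 1` alone and equals `1`.
    rw [Finset.sum_eq_single_of_mem 1 (Finset.mem_Icc.2 ⟨le_rfl, hp⟩)]
    · simp
    · intro k hk hk1
      have hk2 : k ≠ 0 := by have := (Finset.mem_Icc.1 hk).1; omega
      have hk3 : k - 1 ≠ 0 := by have := (Finset.mem_Icc.1 hk).1; omega
      simp [derivative_pow, hk2, hk3]

theorem natDegree_bdfPoly_term_le {p k : ℕ} (hk : k ≤ p) :
    (C (1 / (k : ℝ)) * (X ^ (p - k) * (X - 1) ^ k)).natDegree ≤ p := by
  refine (natDegree_C_mul_le _ _).trans (natDegree_mul_le.trans ?_)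
  have h1 : ((X - 1 : ℝ[X]) ^ k).natDegree ≤ k := by
    have := natDegree_pow_le (p := (X - C 1 : ℝ[X])) (n := k)
    rwa [natDegree_X_sub_C, mul_one, C_1] at this
  rw [natDegree_X_pow]
  omega

theorem coeff_bdfPoly (p : ℕ) : (bdfPoly p).coeff p = ∑ k ∈ Finset.Icc 1 p, 1 / (k : ℝ) := by
  rw [bdfPoly, finsetSum_coeff]
  refine Finset.sum_congr rfl fun k hk => ?_
  have hk' := (Finset.mem_Icc.1 hk).2
  have h1 : ((X - 1 : ℝ[X]) ^ k).coeff k = 1 := by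
    have hm : (X - C 1 : ℝ[X]) ^ k |>.Monic := (monic_X_sub_C 1).pow k
    have := hm.coeff_natDegree
    rwa [natDegree_pow, natDegree_X_sub_C, mul_one, C_1] at this
  rw [coeff_C_mul, coeff_X_pow_mul', if_pos (Nat.sub_le _ _), Nat.sub_sub_self hk', h1, mul_one]

theorem natDegree_bdfPoly {p : ℕ} (hp : 1 ≤ p) : (bdfPoly p).natDegree = p := by
  refine natDegree_eq_of_le_of_coeff_ne_zero (natDegree_sum_le_of_forall_le _ _ fun k hk =>
    natDegree_bdfPoly_term_le (Finset.mem_Icc.1 hk).2) ?_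
  rw [coeff_bdfPoly]
  refine (Finset.sum_pos (fun k hk => ?_) ⟨1, Finset.mem_Icc.2 ⟨le_rfl, hp⟩⟩).ne'
  have : 0 < k := (Finset.mem_Icc.1 hk).1
  positivity

theorem reverse_bdfPoly_eval {p : ℕ} (hp : 1 ≤ p) (x : ℝ) :
    (bdfPoly p).reverse.eval x = ∑ k ∈ Finset.Icc 1 p, (1 / (k : ℝ)) * (1 - x) ^ k := by
  by_cases hx : x = 0
  · have h : (bdfPoly p).leadingCoeff = ∑ k ∈ Finset.Icc 1 p, 1 / (k : ℝ) := by
      rw [leadingCoeff, natDegree_bdfPoly hp, coeff_bdfPoly]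
    rw [hx, ← coeff_zero_eq_eval_zero, coeff_zero_reverse, h]
    simp
  · let inst : Invertible x⁻¹ := invertibleOfNonzero (inv_ne_zero hx)
    have h := eval₂_reverse_mul_pow (RingHom.id ℝ) x⁻¹ (bdfPoly p)
    rw [invOf_eq_inv, inv_inv, eval₂_id, eval₂_id, natDegree_bdfPoly hp] at h
    have h2 : (bdfPoly p).reverse.eval x = (bdfPoly p).eval x⁻¹ * x ^ p := by
      rw [← h, mul_assoc, ← mul_pow, inv_mul_cancel₀ hx, one_pow, mul_one]
    rw [h2, bdfPoly, eval_finsetSum, Finset.sum_mul]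
    refine Finset.sum_congr rfl fun k hk => ?_
    have e : x ^ p = x ^ (p - k) * x ^ k := by
      rw [← pow_add, Nat.sub_add_cancel (Finset.mem_Icc.1 hk).2]
    simp only [eval_mul, eval_C, eval_pow, eval_X, eval_sub, eval_one]
    rw [e, mul_assoc, show x⁻¹ ^ (p - k) * (x⁻¹ - 1) ^ k * (x ^ (p - k) * x ^ k) =
      (x⁻¹ * x) ^ (p - k) * ((x⁻¹ - 1) * x) ^ k by rw [mul_pow, mul_pow]; ring,
      inv_mul_cancel₀ hx, one_pow, one_mul, sub_mul, inv_mul_cancel₀ hx, one_mul]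

/-- After division by `e^(ph)`, with `y = 1 - e^(-h)`, the first polynomial becomes `∑_{k ≤ p}
y^k/k`, the truncation of `-log(1-y) = h`. -/
theorem bdfPoly_consistent {p : ℕ} (hp : 1 ≤ p) : LMMConsistent (bdfPoly p) (X ^ p) p := by
  have hy : (fun h : ℝ => 1 - Real.exp (-h)) =O[𝓝 0] fun h => h := by
    have h1 : HasDerivAt (fun h : ℝ => 1 - Real.exp (-h)) (- (Real.exp (-0) * (-1))) 0 :=
      (((hasDerivAt_neg (0 : ℝ)).exp).const_sub 1)
    have := h1.isBigO_sub
    simpa using this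
  have hlog : (fun y : ℝ => (∑ i ∈ Finset.range p, y ^ (i + 1) / (i + 1)) + Real.log (1 - y))
      =O[𝓝 0] fun y => y ^ (p + 1) := by
    refine IsBigO.of_bound 2 ?_
    filter_upwards [(continuous_abs.tendsto' (0 : ℝ) 0 abs_zero).eventually_lt_const
      (by norm_num : (0 : ℝ) < 1 / 2)] with y hy
    refine (Real.abs_log_sub_add_sum_range_le (by linarith) p).trans ?_
    rw [div_le_iff₀ (by linarith), norm_pow, Real.norm_eq_abs]
    nlinarith [pow_nonneg (abs_nonneg y) (p + 1)]
  have ht : Tendsto (fun h : ℝ => 1 - Real.exp (-h)) (𝓝 0) (𝓝 0) :=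
    Continuous.tendsto' (by fun_prop) _ _ (by simp)
  have hexp : (fun h : ℝ => Real.exp h ^ p) =O[𝓝 0] fun _ => (1 : ℝ) := by
    have : ContinuousAt (fun h : ℝ => Real.exp h ^ p) 0 := by fun_prop
    exact this.tendsto.isBigO_one ℝ
  have h1 := ((hlog.comp_tendsto ht).trans (hy.pow (p + 1))).mul hexp
  simp only [mul_one] at h1
  refine h1.congr_left fun h => ?_
  have h2 := reverse_eval_exp_neg (bdfPoly p) h
  rw [natDegree_bdfPoly hp, reverse_bdfPoly_eval hp] at h2
  simp only [Function.comp, sub_sub_cancel, Real.log_exp, eval_pow, eval_X]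
  rw [← h2, add_mul]
  have e : ∑ i ∈ Finset.range p, (1 - Real.exp (-h)) ^ (i + 1) / ((i : ℝ) + 1) =
      ∑ k ∈ Finset.Icc 1 p, (1 / (k : ℝ)) * (1 - Real.exp (-h)) ^ k := by
    rw [← Finset.Ico_succ_right_eq_Icc, Finset.sum_Ico_eq_sum_range]
    refine Finset.sum_congr (by simp) fun i _ => ?_
    rw [add_comm 1 i]
    push_cast
    ring
  rw [e]
  ring

/-! ### The admissible schemes -/

theorem lmmStable_of_norm_lt_one {q : ℝ[X]} (h : ∀ z : ℂ, aeval z q = 0 → ‖z‖ < 1) :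
    LMMStable q := fun z hz => ⟨(h z hz).le, fun h1 => absurd h1 (h z hz).ne⟩

theorem isQuad_fbdf {p : ℕ} (hp : 1 ≤ p) (hp6 : p ≤ 6) (α : ℝ) :
    IsQuad (taylorCoeff ((Scheme.fbdf p).gen α)) ((Scheme.fbdf p).gen α) α α p := by
  have hs : ∀ z : ℂ, aeval z (X ^ p : ℝ[X]) = 0 → ‖z‖ < 1 := fun z hz => by
    rw [map_pow, aeval_X] at hz
    rw [eq_zero_of_pow_eq_zero hz, norm_zero]
    exact one_pos
  refine isQuad_of_lmm (ρ := bdfPoly p) (s := X ^ p) hp ?_ (lmmStable_bdfPoly hp hp6)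
    (lmmStable_of_norm_lt_one hs) (bdfPoly_consistent hp)
    (fun z h1 h2 => absurd h1 (hs z h2).ne) le_rfl fun x hx => ?_
  · rw [natDegree_X_pow, natDegree_bdfPoly hp]
  · have h1 : ((X : ℝ[X]) ^ p).reverse = 1 := by
      have := reverse_X_pow_mul (1 : ℝ[X]) p
      rwa [mul_one, ← C_1, reverse_C, C_1] at this
    have h2 : 0 < ∑ k ∈ Finset.Icc 1 p, (1 / (k : ℝ)) * (1 - x) ^ k := by
      refine Finset.sum_pos (fun k hk => ?_) ⟨1, Finset.mem_Icc.2 ⟨le_rfl, hp⟩⟩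
      have : 0 < k := (Finset.mem_Icc.1 hk).1
      have : 0 < 1 - x := by linarith [(abs_lt.1 hx).2]
      positivity
    rw [h1, reverse_bdfPoly_eval hp, eval_one, one_div, Real.inv_rpow h2.le, Real.rpow_neg h2.le,
      inv_inv, Scheme.gen]

/-- The method `ρ = 2(z-1)`, `s = z+1`. Here `s` has its root `-1` on the circle, which gives the
second singularity `(1+X)^(-α)` and the restriction `κ ≤ -α`. -/
theorem isQuad_trapezoidal {α κ : ℝ} (h1 : κ ≤ α) (h2 : κ ≤ -α) :
    IsQuad (taylorCoeff (Scheme.trapezoidal.gen α)) (Scheme.trapezoidal.gen α) α κ 2 := by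
  have hρ : ∀ z : ℂ, aeval z (C 2 * (X - C 1) : ℝ[X]) = 2 * (z - 1) := fun z => by simp
  have hs : ∀ z : ℂ, aeval z (X + C 1 : ℝ[X]) = z + 1 := fun z => by simp
  have hX : (X : ℝ[X]).reverse = 1 := by
    have := reverse_mul_X (1 : ℝ[X])
    rwa [one_mul, ← C_1, reverse_C, C_1] at this
  refine isQuad_of_lmm (ρ := C 2 * (X - C 1)) (s := X + C 1) one_le_two ?_ ?_ ?_ ?_ ?_ h1 ?_
  · rw [natDegree_C_mul two_ne_zero, natDegree_X_sub_C, natDegree_X_add_C]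
  · intro z hz
    rw [hρ] at hz
    have : z = 1 := by
      have := (mul_eq_zero.1 hz).resolve_left two_ne_zero
      exact sub_eq_zero.1 this
    subst this
    simp
  · intro z hz
    rw [hs] at hz
    have : z = -1 := eq_neg_of_add_eq_zero_left hz
    subst this
    simp
  -- `2(e^h - 1) - h(e^h + 1) = (2-h)(e^h - 1 - h - h²/2) - h³/2`.
  · have h3 := Real.exp_sub_sum_range_isBigO_pow 3
    have hb : (fun h : ℝ => 2 - h) =O[𝓝 0] fun _ => (1 : ℝ) :=
      (ContinuousAt.tendsto (by fun_prop)).isBigO_one ℝ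
    have h4 := ((isBigO_refl (fun h : ℝ => h ^ 3) (𝓝 0)).const_mul_left (-1 / 2)).add
      ((hb.mul h3).congr_right fun h => one_mul _)
    refine h4.congr_left fun h => ?_
    simp [Finset.sum_range_succ]
    ring
  · intro z _ hz
    rw [hs] at hz
    refine ⟨?_, h2⟩
    rw [hρ, eq_neg_of_add_eq_zero_left hz]
    norm_num
  · intro x hx
    have hx1 : 0 < 1 - x := by linarith [(abs_lt.1 hx).2]
    have hx2 : 0 < 1 + x := by linarith [(abs_lt.1 hx).1]
    have e1 : (C 2 * (X - C 1) : ℝ[X]).reverse.eval x = 2 * (1 - x) := by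
      rw [reverse_mul_of_domain, reverse_C, sub_eq_add_neg, ← C_neg, reverse_add_C, hX]
      simp
      ring
    have e2 : (X + C 1 : ℝ[X]).reverse.eval x = 1 + x := by
      rw [reverse_add_C, hX]
      simp
    rw [e1, e2, ← inv_div, Real.inv_rpow (by positivity), Real.rpow_neg (by positivity), inv_inv,
      Scheme.gen]

/-- The generating function is `(1-X)^α` times a polynomial, so `η = 0`. Consistency holds by
construction: that polynomial is the Taylor polynomial of `logQuot^α` in `1 - x`. -/
theorem isQuad_gngf (p : ℕ) (α : ℝ) :
    IsQuad (taylorCoeff ((Scheme.gngf p).gen α)) ((Scheme.gngf p).gen α) α α p := by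
  set Q : ℝ[X] := ∑ k ∈ Finset.Icc 1 p, C (newtonGregoryCoeff α (k - 1)) * (1 - X) ^ (k - 1)
    with hQ
  have hsum : ∀ x : ℝ, |x| < 1 → HasSum (fun n => PowerSeries.coeff n (bin (1 : ℝ) α * (Q : ℝ⟦X⟧)) * x ^ n)
      ((Scheme.gngf p).gen α x) := by
    intro x hx
    have h := hasSum_coeff_mul (hasSum_bin_real α hx) (hasSum_coe Q x)
    have e : Q.eval x = ∑ k ∈ Finset.Icc 1 p, newtonGregoryCoeff α (k - 1) * (1 - x) ^ (k - 1) := by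
      rw [hQ, eval_finsetSum]
      simp
    rw [e] at h
    exact h
  have hω : taylorCoeff ((Scheme.gngf p).gen α) =
      fun n => PowerSeries.coeff n (bin (1 : ℝ) α * (Q : ℝ⟦X⟧)) := by
    refine taylorCoeff_eq_of_hasSum ?_
    filter_upwards [(continuous_abs.tendsto' (0 : ℝ) 0 abs_zero).eventually_lt_const one_pos]
      with x hx using hsum x hx
  refine ⟨hω ▸ hsum, fun M => ⟨0, Q, decay_zero _, rapid_coe Q _, ?_⟩, ?_⟩
  · rw [hω, mul_zero, zero_add]
    ext n
    simp
  · have h1 := (taylor_isBigO (analyticAt_logQuot_rpow α) p).mono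
      (nhdsWithin_le_nhds (s := Set.Ioi 0))
    have h2 := (isBigO_refl (fun y : ℝ => y ^ α) (𝓝[>] 0)).mul h1.neg_left
    refine h2.congr' ?_ ?_
    · filter_upwards [Ioo_mem_nhdsGT (one_pos : (0 : ℝ) < 1)] with y hy
      have e : ∀ l, taylorCoeff (fun y => logQuot y ^ α) l = newtonGregoryCoeff α l := fun l => by
        rw [newtonGregoryCoeff_eq, logCoeff, neg_neg]
      rw [← mul_logQuot, Real.mul_rpow hy.1.le (logQuot_pos hy.2).le]
      simp only [Scheme.gen, sub_sub_cancel, e]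
      rw [← Finset.Ico_succ_right_eq_Icc, Finset.sum_Ico_eq_sum_range]
      simp only [Order.succ_eq_add_one, add_tsub_cancel_right, add_tsub_cancel_left]
      ring
    · filter_upwards [self_mem_nhdsWithin] with y hy
      rw [Real.rpow_add hy, Real.rpow_natCast]

theorem Scheme.Admissible.exists_isQuad {S : Scheme} {α δ : ℝ} {p : ℕ}
    (hS : S.Admissible p α δ) : ∃ κ : ℝ, IsQuad (taylorCoeff (S.gen α)) (S.gen α) α κ p ∧
      (α ≤ κ ∨ -κ - 1 ≤ δ - α - p) := by
  cases S with
  | fbdf q =>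
    obtain ⟨rfl, hp, hp6⟩ := hS
    exact ⟨α, isQuad_fbdf hp hp6 α, Or.inl le_rfl⟩
  | gngf q =>
    obtain ⟨rfl, -⟩ := hS
    exact ⟨α, isQuad_gngf _ α, Or.inl le_rfl⟩
  | trapezoidal =>
    obtain ⟨rfl, h⟩ := hS
    rcases le_total α 0 with h0 | h0
    · exact ⟨α, isQuad_trapezoidal le_rfl (by linarith), Or.inl le_rfl⟩
    -- With `κ = -α` and `p = 2` the requirement `-κ - 1 ≤ δ - α - p` is precisely `2α + 1 ≤ δ`; the
    -- alternative `α ≤ 0` leaves only `α = 0` here.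
    · refine ⟨-α, isQuad_trapezoidal (by linarith) le_rfl, ?_⟩
      rcases h with h | h
      · exact Or.inl (by linarith)
      · exact Or.inr (by push_cast; linarith)
  | lmm ρ s =>
    obtain ⟨hp, hdeg, hρ, hc, hs⟩ := hS
    exact ⟨α, isQuad_of_lmm hp hdeg hρ (lmmStable_of_norm_lt_one hs) hc
      (fun z h1 h2 => absurd h1 (hs z h2).ne) le_rfl fun x _ => rfl, Or.inl le_rfl⟩

end TemperedFLMM
end

theorem theorem3p1 (α δ σ : ℝ) (hδ : 0 < δ) (hσ : 0 ≤ σ) (p : ℕ)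
    (S : TemperedFLMM.Scheme) (hS : S.Admissible p α δ) :
    -- the weights are the coefficients of the tempered generating function, and they are
    -- the untempered weights multiplied by `e^(-kστ)`
    (∀ τ : ℝ, 0 < τ →
      (∀ᶠ z in 𝓝 (0 : ℝ), HasSum (fun k : ℕ => S.weight α σ τ k * z ^ k)
        (S.gen α (z * Real.exp (-σ * τ)))) ∧
      ∀ k : ℕ, S.weight α σ τ k = Real.exp (-(k * σ * τ)) * S.weight α 0 τ k) ∧
    -- the tempered derivative of `t^δ` exists at every `t > 0`
    (∀ t : ℝ, 0 < t → TemperedFLMM.TemperedDerivExistsAt σ α (fun x => x ^ δ) t) ∧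
    -- the error bound, uniform in the step size and in `0 < t_n ≤ T`
    (∀ T : ℝ, 0 < T → ∃ C : ℝ, ∀ τ : ℝ, 0 < τ → ∀ n : ℕ, 1 ≤ n → n * τ ≤ T →
      |TemperedFLMM.temperedDeriv σ α (fun x => x ^ δ) (n * τ)
          - S.flmm α σ τ n (fun x => x ^ δ)|
        ≤ C * ((n * τ) ^ (δ - α - p) * τ ^ p + (n * τ) ^ (-α - 1) * τ ^ (δ + 1))) := by
  obtain ⟨κ, h, hκ⟩ := hS.exists_isQuad
  exact ⟨fun τ _ => ⟨(h.hasSum_weight σ τ).1, h.weight_eq σ τ⟩,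
    fun t ht => TemperedFLMM.temperedDerivExistsAt_rpow hσ hδ α ht,
    fun T hT => h.error_bound hδ hσ hκ hT⟩
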